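/- **Theorem (Completeness of the constrained backwards strand semantics).** *Protocols.* A protocol $\mathcal P$ consists of an order-sorted signature with infinitely many variables and at least one ground term of each sort, with sorts $\mathsf{Msg}$ and $\mathsf{Fresh}$; a set $E$ of equations, with induced congruence $=_E$; pairwise distinct constants $r.ro.i$ of sort $\mathsf{Fresh}$ (for $r$ a variable of sort $\mathsf{Fresh}$, $ro$ a role, $i\in\mathbb N$); and a set of role-labelled strands $(ro)[u_1,\dots,u_n]$, where each $u_j$ is a sent message $M^+$, a received message $M^-$ or a constrained message $\{C,\mathit{Num}\}$, with $C$ of the form $?$, $M=M'$ or $M\neq M'$. Equality of states is taken modulo $=_E$ on messages; strands form multisets, the intruder knowledge and constraints are sets. *Forwards semantics.* A ground strand state $s$ is a multiset of strands $(ro,i)[v_1,\dots,v_l]$, each a ground instance modulo $E$ of an initial segment of a protocol strand of role $ro$, together with a finite set of known ground messages ("facts $m\in\mathcal I$"). It is initial if all its strands are empty and no message is known. In one step $s\to s'$, for a protocol strand $(ro)[u_1,\dots,u_n]$ and a sorted ground substitution $\tau$, either $j>1$ and a strand $(ro,i)[u_1\tau,\dots,u_{j-1}\tau]$ is extended by $u_j\tau$,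 or $j=1$ and a strand $(ro,i)[u_1\tau]$ is added, $i$ being one more than the largest identifier of role $ro$ in $s$. If $u_j=M^+$, then $r\tau=r.ro.i$ for the variables $r$ of sort $\mathsf{Fresh}$ in $M$, and $M\tau$ either becomes known (allowed only if it was not known modulo $E$) or the knowledge stays as it is. If $u_j=M^-$, then $M\tau$ must be known. If $u_j=\{C,\mathit{Num}\}$ with $C$ an equality or disequality, then $j>1$ is required and $C\tau$ must hold modulo $E$. If $C={?}$ there is no condition. *Symbolic states.* A constrained symbolic state $\langle S,\Psi\rangle$ consists of strands $[u_1,\dots,u_{i-1}\mid u_i,\dots,u_n]$, each an instance modulo $E$ of a protocol strand; of facts $w\in\mathcal I$ and $w\notin\mathcal I$; of variables $SS$ and $IK$ for further strands and facts (one or more of each kind, since unifiers may split such a variable into several); and of a finite conjunction $\Psi$ of disequalities $a\neq b$ of messages. It is initial if every bar is at the beginning and there is no fact $w\in\mathcal I$. For a ground sorted substitution $\theta$, write $\langle S,\Psi\rangle>^\theta s$ if: the occurrences of strands of $S$ with nonempty past can be assigned pairwise distinct occurrences of strands of $s$ so that $[u_1,\dots,u_{i-1}\mid\dots]$ is assigned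 a strand $[v_1,\dots,v_{i-1}]$ with $v_j=_E u_j\theta$ for all $j<i$; for each fact $w\in\mathcal I$ of $S$ some message of $s$ is $=_E w\theta$; for each fact $w\notin\mathcal I$ of $S$ none is; and $a\theta\neq_E b\theta$ for all $a\neq b$ in $\Psi$. *Backwards narrowing.* The rules are the following, used from right to left: $$\begin{aligned} \langle SS\,\&\,[L\mid M^-,L']\,\&\,\{M\in\mathcal I,IK\},\Psi\rangle&\to\langle SS\,\&\,[L,M^-\mid L']\,\&\,\{M\in\mathcal I,IK\},\Psi\rangle\\ \langle SS\,\&\,[L\mid M^+,L']\,\&\,\{IK\},\Psi\rangle&\to\langle SS\,\&\,[L,M^+\mid L']\,\&\,\{IK\},\Psi\rangle\\ \langle SS\,\&\,[L\mid M^+,L']\,\&\,\{M\notin\mathcal I,IK\},\Psi\rangle&\to\langle SS\,\&\,[L,M^+\mid L']\,\&\,\{M\in\mathcal I,IK\},\Psi\rangle\\ \langle SS\,\&\,[l_1\mid u^+,l_2]\,\&\,\{u\notin\mathcal I,IK\},\Psi\rangle&\to\langle SS\,\&\,\{u\in\mathcal I,IK\},\Psi\rangle\quad\text{for each protocol strand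 }[l_1,u^+,l_2]\\ \langle SS\,\&\,[L\mid c,L']\,\&\,\{IK\},\Psi\rangle&\to\langle SS\,\&\,[L,c\mid L']\,\&\,\{IK\},\Psi\rangle\quad\text{for }c=\{?,\mathit{Num}\}\text{ and }c=\{M=M,\mathit{Num}\}\\ \langle SS\,\&\,[L\mid c,L']\,\&\,\{IK\},\Psi\wedge M\neq M'\rangle&\to\langle SS\,\&\,[L,c\mid L']\,\&\,\{IK\},\Psi\rangle\quad\text{for }c=\{M\neq M',\mathit{Num}\} \end{aligned}$$ the last one only if the instantiated conjunction $\Psi\wedge M\neq M'$ is satisfiable in the algebra of terms with variables modulo $E$. Reading such a rule backwards as $l\to r$, a narrowing step from $\mathit{CstrS}$ away from a finite variable set $W\supseteq\mathrm{var}(\mathit{CstrS})$ renames $l\to r$ apart from $W$, chooses $\sigma$ in the complete set of unifiers of $\mathit{CstrS}$ and $l$ away from $W\cup\mathrm{var}(l)\cup\mathrm{var}(r)$ that a fixed complete unification procedure returns, and leads to $r\sigma$; its label is the restriction of $\sigma$ to $\mathrm{var}(\mathit{CstrS})$. A sequence of steps is labelled by the composition of the labels, and later steps are also away from the earlier $W$.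 *Theorem.* Let $\mathcal P$ be a protocol, fix any complete unification procedure, and let $s_0,s$ be ground strand states, $\mathit{CstrS}$ a constrained symbolic state, $\theta$ a ground substitution and $n\ge 0$ such that (i) $s_0$ is initial, (ii) $s_0\to^n s$, and (iii) $\mathit{CstrS}>^\theta s$. Then, for every finite set $W\supseteq\mathrm{var}(\mathit{CstrS})$, there are a constrained symbolic initial state $\mathit{CstrS}_0$, substitutions $\mu$ and $\theta'$, and $k\le n$ such that $k$ backwards narrowing steps away from $W$ lead from $\mathit{CstrS}$ to $\mathit{CstrS}_0$ with composed substitution $\mu$, and $\mathit{CstrS}_0>^{\theta'}s_0$. -/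

import Mathlib

universe u v w z

namespace CStrand

/-! ## Order-sorted terms and equational theories -/

/-- An order-sorted signature (operators may be overloaded: `rank f w s` means that
`f : w₁ … wₙ → s` is declared), with an infinite set of variables for every sort. -/
structure Signature where
  Srt : Type u
  [order : PartialOrder Srt]
  Op : Type v
  arity : Op → ℕ
  rank : (f : Op) → (Fin (arity f) → Srt) → Srt → Prop
  Var : Type w
  varSort : Var → Srt
  infinite_vars : ∀ s : Srt, {x : Var | varSort x = s}.Infinite

attribute [instance] Signature.order

inductive Term (G : Signature.{u, v, w}) : Type (max v w)
  | var : G.Var → Term G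
  | app : (f : G.Op) → (Fin (G.arity f) → Term G) → Term G

/-- `HasSort t s`: the term `t` is a well-formed term of sort `s`. -/
inductive HasSort {G : Signature.{u, v, w}} : Term G → G.Srt → Prop
  | var (x : G.Var) (s : G.Srt) : G.varSort x ≤ s → HasSort (.var x) s
  | app (f : G.Op) (a : Fin (G.arity f) → Term G) (w : Fin (G.arity f) → G.Srt)
      (s s' : G.Srt) : G.rank f w s → (∀ i, HasSort (a i) (w i)) → s ≤ s' →
      HasSort (.app f a) s'

namespace Term

variable {G : Signature.{u, v, w}}

def vars : Term G → Set G.Var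
  | .var x => {x}
  | .app _ a => ⋃ i, (a i).vars

def subst (σ : G.Var → Term G) : Term G → Term G
  | .var x => σ x
  | .app f a => .app f fun i => (a i).subst σ

def Ground (t : Term G) : Prop := t.vars = ∅

end Term

/-- A sort-preserving assignment of terms to variables. -/
def SortedAssign {G : Signature.{u, v, w}} (τ : G.Var → Term G) : Prop :=
  ∀ x, HasSort (τ x) (G.varSort x)

/-- A sort-preserving assignment of ground terms to variables. -/
def GroundAssign {G : Signature.{u, v, w}} (τ : G.Var → Term G) : Prop :=
  SortedAssign τ ∧ ∀ x, (τ x).Ground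

/-- Order-sorted equational deduction: the congruence `=_E`. -/
inductive EqE {G : Signature.{u, v, w}} (E : Set (Term G × Term G)) : Term G → Term G → Prop
  | refl (t : Term G) : EqE E t t
  | symm {t t' : Term G} : EqE E t t' → EqE E t' t
  | trans {t t' t'' : Term G} : EqE E t t' → EqE E t' t'' → EqE E t t''
  | ax (e : Term G × Term G) (σ : G.Var → Term G) : e ∈ E → SortedAssign σ →
      EqE E (e.1.subst σ) (e.2.subst σ)
  | congr (f : G.Op) (a b : Fin (G.arity f) → Term G) (s s' : G.Srt) :
      HasSort (.app f a) s → HasSort (.app f b) s' → (∀ i, EqE E (a i) (b i)) →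
      EqE E (.app f a) (.app f b)

/-! ## Signed and constrained messages -/

/-- Constraints of constrained messages: `?`, `M = M'` and `M ≠ M'`. -/
inductive Cstr (G : Signature.{u, v, w})
  | any : Cstr G
  | eq : Term G → Term G → Cstr G
  | ne : Term G → Term G → Cstr G

/-- Elements of a strand: `M⁺`, `M⁻` and `{Cstr, Num}`. -/
inductive SMsg (G : Signature.{u, v, w})
  | send : Term G → SMsg G
  | recv : Term G → SMsg G
  | cstr : Cstr G → ℕ → SMsg G

section Messages

variable {G : Signature.{u, v, w}}

def Cstr.subst (σ : G.Var → Term G) : Cstr G → Cstr G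
  | .any => .any
  | .eq a b => .eq (a.subst σ) (b.subst σ)
  | .ne a b => .ne (a.subst σ) (b.subst σ)

def SMsg.subst (σ : G.Var → Term G) : SMsg G → SMsg G
  | .send t => .send (t.subst σ)
  | .recv t => .recv (t.subst σ)
  | .cstr c n => .cstr (c.subst σ) n

/-- The message terms that occur in a strand element. -/
def SMsg.terms : SMsg G → Set (Term G)
  | .send t => {t}
  | .recv t => {t}
  | .cstr .any _ => ∅
  | .cstr (.eq a b) _ => {a, b}
  | .cstr (.ne a b) _ => {a, b}

/-- Equality of strand elements modulo `E`. -/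
inductive SMsg.EqE (E : Set (Term G × Term G)) : SMsg G → SMsg G → Prop
  | send {t t' : Term G} : CStrand.EqE E t t' → SMsg.EqE E (.send t) (.send t')
  | recv {t t' : Term G} : CStrand.EqE E t t' → SMsg.EqE E (.recv t) (.recv t')
  | any (n : ℕ) : SMsg.EqE E (.cstr .any n) (.cstr .any n)
  | eq {a b a' b' : Term G} (n : ℕ) : CStrand.EqE E a a' → CStrand.EqE E b b' →
      SMsg.EqE E (.cstr (.eq a b) n) (.cstr (.eq a' b') n)
  | ne {a b a' b' : Term G} (n : ℕ) : CStrand.EqE E a a' → CStrand.EqE E b b' →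
      SMsg.EqE E (.cstr (.ne a b) n) (.cstr (.ne a' b') n)

/-- Truth modulo `E` of an (instantiated) equality or disequality; `?` is not a condition. -/
def Cstr.Holds (E : Set (Term G × Term G)) : Cstr G → Prop
  | .any => False
  | .eq a b => CStrand.EqE E a b
  | .ne a b => ¬ CStrand.EqE E a b

end Messages

/-! ## Protocols -/

/-- A protocol specified by constrained strands: the signature and the equations of its
messages, the sorts `Msg` and `Fresh`, the constants `r.ro.i` that name the fresh variable `r`
in session `i` of role `ro`, and the set of role-labelled constrained strands. -/
structure Protocol where
  sig : Signature.{u, v, w}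
  msg : sig.Srt
  fresh : sig.Srt
  eqns : Set (Term sig × Term sig)
  eqns_sorted : ∀ e ∈ eqns, ∃ s, HasSort e.1 s ∧ HasSort e.2 s
  ground_nonempty : ∀ s : sig.Srt, ∃ t : Term sig, t.Ground ∧ HasSort t s
  Role : Type z
  freshName : {x : sig.Var // sig.varSort x = fresh} → Role → ℕ → sig.Op
  freshName_injective : ∀ x x' ro ro' i i', freshName x ro i = freshName x' ro' i' →
    x = x' ∧ ro = ro' ∧ i = i'
  freshName_const : ∀ x ro i, sig.arity (freshName x ro i) = 0
  freshName_rank : ∀ x ro i w, sig.rank (freshName x ro i) w fresh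
  strands : Set (Role × List (SMsg sig))
  strands_sorted : ∀ S ∈ strands, ∀ m ∈ S.2, ∀ t ∈ m.terms, HasSort t msg

/-! ## Ground states and the constrained forwards strand semantics -/

/-- A labelled ground strand `(ro, i)[v₁, …, vₗ]`: what role `ro` has done in session `i`. -/
structure GStrand (P : Protocol.{u, v, w, z}) where
  role : P.Role
  id : ℕ
  msgs : List (SMsg P.sig)

/-- A forwards state: a multiset of strands, and the messages `m` with `m ∈ I`
(a set: see `GState.EqE`). -/
structure GState (P : Protocol.{u, v, w, z}) where
  strands : Multiset (GStrand P)
  ik : Multiset (Term P.sig)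

/-- Equality as sets, up to the relation `R` on elements. -/
def SetRel {α : Type*} (R : α → α → Prop) (m m' : Multiset α) : Prop :=
  (∀ a ∈ m, ∃ b ∈ m', R a b) ∧ (∀ b ∈ m', ∃ a ∈ m, R a b)

section Forward

variable {P : Protocol.{u, v, w, z}}

/-- Equality of forwards states modulo the equations of messages and states. -/
def GState.EqE (s s' : GState P) : Prop :=
  Multiset.Rel (fun g g' => g.role = g'.role ∧ g.id = g'.id ∧
      List.Forall₂ (SMsg.EqE P.eqns) g.msgs g'.msgs) s.strands s'.strands ∧
    SetRel (CStrand.EqE P.eqns) s.ik s'.ik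

/-- Ground strand states: the strands are instances, modulo the equations, of initial segments
of protocol strands, and everything is ground. -/
def GState.IsGroundStrandState (s : GState P) : Prop :=
  (∀ g ∈ s.strands,
    (∃ ms, (g.role, ms) ∈ P.strands ∧ ∃ pre, pre <+: ms ∧ ∃ ρ : P.sig.Var → Term P.sig,
      GroundAssign ρ ∧ List.Forall₂ (SMsg.EqE P.eqns) (pre.map (SMsg.subst ρ)) g.msgs) ∧
    ∀ m ∈ g.msgs, ∀ t ∈ m.terms, t.Ground ∧ HasSort t P.msg) ∧
  ∀ t ∈ s.ik, t.Ground ∧ HasSort t P.msg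

/-- Initial ground states: nothing has been executed and nothing is known. -/
def GState.IsInitial (s : GState P) : Prop :=
  (∀ g ∈ s.strands, g.msgs = []) ∧ s.ik = 0

open Classical in
/-- The largest identifier of a strand of role `ro` (`0` if there is none). -/
noncomputable def maxStrId (SS : Multiset (GStrand P)) (ro : P.Role) : ℕ :=
  ((SS.filter fun g => g.role = ro).map GStrand.id).sup

/-- On the fresh variables of the term `t`, the assignment `τ` is the fresh substitution
`r ↦ r.ro.i`. -/
def FreshOn (τ : P.sig.Var → Term P.sig) (t : Term P.sig) (ro : P.Role) (i : ℕ) : Prop :=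
  ∀ x ∈ t.vars, ∀ hx : P.sig.varSort x = P.fresh,
    τ x = .app (P.freshName ⟨x, hx⟩ ro i) fun k => (Fin.cast (P.freshName_const _ _ _) k).elim0

/-- The ground instances of the rules of the constrained forwards strand semantics.
`τ` collects the values that earlier messages gave to variables, the choice of values for the
choice variables, and the fresh substitution. -/
inductive FRule : GState P → GState P → Prop
  /-- send and let the intruder learn the message -/
  | sendLearn (ro : P.Role) (i : ℕ) (pre post : List (SMsg P.sig)) (t : Term P.sig)
      (τ : P.sig.Var → Term P.sig) (SS : Multiset (GStrand P)) (IK : Multiset (Term P.sig)) :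
      (ro, pre ++ .send t :: post) ∈ P.strands → pre ≠ [] → GroundAssign τ →
      FreshOn τ t ro i → (∀ m ∈ IK, ¬ EqE P.eqns m (t.subst τ)) →
      FRule ⟨⟨ro, i, pre.map (SMsg.subst τ)⟩ ::ₘ SS, IK⟩
        ⟨⟨ro, i, pre.map (SMsg.subst τ) ++ [.send (t.subst τ)]⟩ ::ₘ SS, t.subst τ ::ₘ IK⟩
  /-- send without learning -/
  | send (ro : P.Role) (i : ℕ) (pre post : List (SMsg P.sig)) (t : Term P.sig)
      (τ : P.sig.Var → Term P.sig) (SS : Multiset (GStrand P)) (IK : Multiset (Term P.sig)) :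
      (ro, pre ++ .send t :: post) ∈ P.strands → pre ≠ [] → GroundAssign τ →
      FreshOn τ t ro i →
      FRule ⟨⟨ro, i, pre.map (SMsg.subst τ)⟩ ::ₘ SS, IK⟩
        ⟨⟨ro, i, pre.map (SMsg.subst τ) ++ [.send (t.subst τ)]⟩ ::ₘ SS, IK⟩
  /-- new strand that starts by sending, with learning -/
  | newSendLearn (ro : P.Role) (post : List (SMsg P.sig)) (t : Term P.sig)
      (τ : P.sig.Var → Term P.sig) (SS : Multiset (GStrand P)) (IK : Multiset (Term P.sig)) :
      (ro, .send t :: post) ∈ P.strands → GroundAssign τ →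
      FreshOn τ t ro (maxStrId SS ro + 1) → (∀ m ∈ IK, ¬ EqE P.eqns m (t.subst τ)) →
      FRule ⟨SS, IK⟩
        ⟨⟨ro, maxStrId SS ro + 1, [.send (t.subst τ)]⟩ ::ₘ SS, t.subst τ ::ₘ IK⟩
  /-- new strand that starts by sending, without learning -/
  | newSend (ro : P.Role) (post : List (SMsg P.sig)) (t : Term P.sig)
      (τ : P.sig.Var → Term P.sig) (SS : Multiset (GStrand P)) (IK : Multiset (Term P.sig)) :
      (ro, .send t :: post) ∈ P.strands → GroundAssign τ →
      FreshOn τ t ro (maxStrId SS ro + 1) →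
      FRule ⟨SS, IK⟩ ⟨⟨ro, maxStrId SS ro + 1, [.send (t.subst τ)]⟩ ::ₘ SS, IK⟩
  /-- receive -/
  | recv (ro : P.Role) (i : ℕ) (pre post : List (SMsg P.sig)) (t : Term P.sig)
      (τ : P.sig.Var → Term P.sig) (SS : Multiset (GStrand P)) (IK : Multiset (Term P.sig)) :
      (ro, pre ++ .recv t :: post) ∈ P.strands → pre ≠ [] → GroundAssign τ →
      FRule ⟨⟨ro, i, pre.map (SMsg.subst τ)⟩ ::ₘ SS, t.subst τ ::ₘ IK⟩
        ⟨⟨ro, i, pre.map (SMsg.subst τ) ++ [.recv (t.subst τ)]⟩ ::ₘ SS, t.subst τ ::ₘ IK⟩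
  /-- new strand that starts by receiving -/
  | newRecv (ro : P.Role) (post : List (SMsg P.sig)) (t : Term P.sig)
      (τ : P.sig.Var → Term P.sig) (SS : Multiset (GStrand P)) (IK : Multiset (Term P.sig)) :
      (ro, .recv t :: post) ∈ P.strands → GroundAssign τ →
      FRule ⟨SS, t.subst τ ::ₘ IK⟩
        ⟨⟨ro, maxStrId SS ro + 1, [.recv (t.subst τ)]⟩ ::ₘ SS, t.subst τ ::ₘ IK⟩
  /-- explicit deterministic choice -/
  | cond (ro : P.Role) (i : ℕ) (pre post : List (SMsg P.sig)) (c : Cstr P.sig) (num : ℕ)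
      (τ : P.sig.Var → Term P.sig) (SS : Multiset (GStrand P)) (IK : Multiset (Term P.sig)) :
      (ro, pre ++ .cstr c num :: post) ∈ P.strands → pre ≠ [] → GroundAssign τ →
      (c.subst τ).Holds P.eqns →
      FRule ⟨⟨ro, i, pre.map (SMsg.subst τ)⟩ ::ₘ SS, IK⟩
        ⟨⟨ro, i, pre.map (SMsg.subst τ) ++ [.cstr (c.subst τ) num]⟩ ::ₘ SS, IK⟩
  /-- explicit non-deterministic choice -/
  | choice (ro : P.Role) (i : ℕ) (pre post : List (SMsg P.sig)) (num : ℕ)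
      (τ : P.sig.Var → Term P.sig) (SS : Multiset (GStrand P)) (IK : Multiset (Term P.sig)) :
      (ro, pre ++ .cstr .any num :: post) ∈ P.strands → pre ≠ [] → GroundAssign τ →
      FRule ⟨⟨ro, i, pre.map (SMsg.subst τ)⟩ ::ₘ SS, IK⟩
        ⟨⟨ro, i, pre.map (SMsg.subst τ) ++ [.cstr .any num]⟩ ::ₘ SS, IK⟩
  /-- new strand that starts with a non-deterministic choice -/
  | newChoice (ro : P.Role) (post : List (SMsg P.sig)) (num : ℕ)
      (SS : Multiset (GStrand P)) (IK : Multiset (Term P.sig)) :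
      (ro, .cstr .any num :: post) ∈ P.strands →
      FRule ⟨SS, IK⟩ ⟨⟨ro, maxStrId SS ro + 1, [.cstr .any num]⟩ ::ₘ SS, IK⟩

/-- One forwards step: rewriting modulo the equations. -/
def FStep (s s' : GState P) : Prop := ∃ q q', s.EqE q ∧ FRule q q' ∧ q'.EqE s'

/-- `n` forwards steps. -/
def FSteps : ℕ → GState P → GState P → Prop
  | 0, s, s' => s.EqE s'
  | n + 1, s, s' => ∃ q, FSteps n s q ∧ FStep q s'

end Forward

/-! ## Symbolic constrained states

Terms for lists are kept modulo associativity and identity, terms for multisets of strands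
modulo associativity, commutativity and identity; terms for sets of facts and for conjunctions
of disequalities are in addition compared up to repetition (`CState.EqE`). In each of these
sorts, `Sum.inl` marks an element and `Sum.inr` a variable of the sort of the collection. -/

/-- Variables: of message sorts, for lists of strand elements, for sets of strands,
for sets of intruder facts, and for constraints. -/
inductive AVar (G : Signature.{u, v, w})
  | msg : G.Var → AVar G
  | lst : ℕ → AVar G
  | ss : ℕ → AVar G
  | ik : ℕ → AVar G
  | cs : ℕ → AVar G

abbrev SList (G : Signature.{u, v, w}) := List (SMsg G ⊕ ℕ)

/-- A strand `[past | future]`. -/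
structure Strand (G : Signature.{u, v, w}) where
  past : SList G
  future : SList G

abbrev StrandSet (G : Signature.{u, v, w}) := Multiset (Strand G ⊕ ℕ)

/-- Intruder facts: `pos m` is `m ∈ I`, `neg m` is `m ∉ I`. -/
inductive Fact (G : Signature.{u, v, w})
  | pos : Term G → Fact G
  | neg : Term G → Fact G

abbrev Know (G : Signature.{u, v, w}) := Multiset (Fact G ⊕ ℕ)

/-- Conjunctions of disequalities; the pair `(a, b)` stands for `a ≠ b`. -/
abbrev Store (G : Signature.{u, v, w}) := Multiset ((Term G × Term G) ⊕ ℕ)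

/-- A constrained state `⟨{strands & {ik}}, store⟩`. -/
structure CState (G : Signature.{u, v, w}) where
  strands : StrandSet G
  ik : Know G
  store : Store G

/-- Assignments of terms to the variables of all sorts. -/
structure Subst (G : Signature.{u, v, w}) where
  msg : G.Var → Term G
  lst : ℕ → SList G
  ss : ℕ → StrandSet G
  ik : ℕ → Know G
  cs : ℕ → Store G

section Symbolic

variable {G : Signature.{u, v, w}}

/-! ### Variables -/

def SMsg.vars (m : SMsg G) : Set (AVar G) := {a | ∃ t ∈ m.terms, ∃ x ∈ t.vars, a = .msg x}

def SList.vars (l : SList G) : Set (AVar G) :=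
  {a | (∃ m, .inl m ∈ l ∧ a ∈ m.vars) ∨ ∃ n, .inr n ∈ l ∧ a = .lst n}

def Strand.vars (A : Strand G) : Set (AVar G) := SList.vars A.past ∪ SList.vars A.future

def StrandSet.vars (M : StrandSet G) : Set (AVar G) :=
  {a | (∃ A, .inl A ∈ M ∧ a ∈ A.vars) ∨ ∃ n, .inr n ∈ M ∧ a = .ss n}

def Fact.term : Fact G → Term G
  | .pos t => t
  | .neg t => t

def Know.vars (K : Know G) : Set (AVar G) :=
  {a | (∃ f : Fact G, .inl f ∈ K ∧ ∃ x ∈ f.term.vars, a = .msg x) ∨ ∃ n, .inr n ∈ K ∧ a = .ik n}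

def Store.vars (Y : Store G) : Set (AVar G) :=
  {a | (∃ d : Term G × Term G, .inl d ∈ Y ∧ ∃ x ∈ d.1.vars ∪ d.2.vars, a = .msg x) ∨
    ∃ n, .inr n ∈ Y ∧ a = .cs n}

def CState.vars (S : CState G) : Set (AVar G) :=
  StrandSet.vars S.strands ∪ Know.vars S.ik ∪ Store.vars S.store

/-! ### Well-sortedness (`s` is the sort of messages) -/

def SList.WF (s : G.Srt) (l : SList G) : Prop :=
  ∀ m, .inl m ∈ l → ∀ t ∈ SMsg.terms m, HasSort t s

def StrandSet.WF (s : G.Srt) (M : StrandSet G) : Prop :=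
  ∀ A, .inl A ∈ M → SList.WF s A.past ∧ SList.WF s A.future

def Know.WF (s : G.Srt) (K : Know G) : Prop :=
  ∀ f : Fact G, .inl f ∈ K → HasSort f.term s

def Store.WF (s : G.Srt) (Y : Store G) : Prop :=
  ∀ d : Term G × Term G, .inl d ∈ Y → HasSort d.1 s ∧ HasSort d.2 s

def CState.WF (s : G.Srt) (S : CState G) : Prop :=
  StrandSet.WF s S.strands ∧ Know.WF s S.ik ∧ Store.WF s S.store

/-! ### Application of substitutions -/

def SList.subst (σ : Subst G) (l : SList G) : SList G :=
  l.flatMap (Sum.elim (fun m => [.inl (m.subst σ.msg)]) σ.lst)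

def Strand.subst (σ : Subst G) (A : Strand G) : Strand G :=
  ⟨SList.subst σ A.past, SList.subst σ A.future⟩

def StrandSet.subst (σ : Subst G) (M : StrandSet G) : StrandSet G :=
  M.bind (Sum.elim (fun A => {.inl (A.subst σ)}) σ.ss)

def Fact.subst (σ : G.Var → Term G) : Fact G → Fact G
  | .pos t => .pos (t.subst σ)
  | .neg t => .neg (t.subst σ)

def Know.subst (σ : Subst G) (K : Know G) : Know G :=
  K.bind (Sum.elim (fun f => {.inl (f.subst σ.msg)}) σ.ik)

def Store.subst (σ : Subst G) (Y : Store G) : Store G :=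
  Y.bind (Sum.elim (fun d => {.inl (d.1.subst σ.msg, d.2.subst σ.msg)}) σ.cs)

def CState.subst (σ : Subst G) (S : CState G) : CState G :=
  ⟨StrandSet.subst σ S.strands, Know.subst σ S.ik, Store.subst σ S.store⟩

/-! ### Equality modulo the equations of messages and of states -/

def SList.EqE (E : Set (Term G × Term G)) : SList G → SList G → Prop :=
  List.Forall₂ (Sum.LiftRel (SMsg.EqE E) Eq)

def StrandSet.EqE (E : Set (Term G × Term G)) : StrandSet G → StrandSet G → Prop :=
  Multiset.Rel (Sum.LiftRel
    (fun A B => SList.EqE E A.past B.past ∧ SList.EqE E A.future B.future) Eq)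

inductive Fact.EqE (E : Set (Term G × Term G)) : Fact G → Fact G → Prop
  | pos {t t' : Term G} : CStrand.EqE E t t' → Fact.EqE E (.pos t) (.pos t')
  | neg {t t' : Term G} : CStrand.EqE E t t' → Fact.EqE E (.neg t) (.neg t')

def Know.EqE (E : Set (Term G × Term G)) : Know G → Know G → Prop :=
  SetRel (Sum.LiftRel (Fact.EqE E) Eq)

def Store.EqE (E : Set (Term G × Term G)) : Store G → Store G → Prop :=
  SetRel (Sum.LiftRel (fun d d' => CStrand.EqE E d.1 d'.1 ∧ CStrand.EqE E d.2 d'.2) Eq)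

def CState.EqE (E : Set (Term G × Term G)) (S S' : CState G) : Prop :=
  StrandSet.EqE E S.strands S'.strands ∧ Know.EqE E S.ik S'.ik ∧ Store.EqE E S.store S'.store

/-! ### Substitutions, unifiers, complete sets of unifiers -/

namespace Subst

protected def id : Subst G :=
  ⟨.var, fun n => [.inr n], fun n => {.inr n}, fun n => {.inr n}, fun n => {.inr n}⟩

/-- First `σ`, then `τ`. -/
def comp (σ τ : Subst G) : Subst G :=
  ⟨fun x => (σ.msg x).subst τ.msg, fun n => SList.subst τ (σ.lst n),
    fun n => StrandSet.subst τ (σ.ss n), fun n => Know.subst τ (σ.ik n),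
    fun n => Store.subst τ (σ.cs n)⟩

def dom (σ : Subst G) : Set (AVar G) :=
  {a | match a with
    | .msg x => σ.msg x ≠ Subst.id.msg x
    | .lst n => σ.lst n ≠ Subst.id.lst n
    | .ss n => σ.ss n ≠ Subst.id.ss n
    | .ik n => σ.ik n ≠ Subst.id.ik n
    | .cs n => σ.cs n ≠ Subst.id.cs n}

/-- The variables of the term that `σ` assigns to a variable. -/
def varsAt (σ : Subst G) : AVar G → Set (AVar G)
  | .msg x => {a | ∃ y ∈ (σ.msg x).vars, a = .msg y}
  | .lst n => SList.vars (σ.lst n)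
  | .ss n => StrandSet.vars (σ.ss n)
  | .ik n => Know.vars (σ.ik n)
  | .cs n => Store.vars (σ.cs n)

/-- The variables introduced by `σ`. -/
def ran (σ : Subst G) : Set (AVar G) := ⋃ a ∈ σ.dom, σ.varsAt a

open Classical in
noncomputable def restrict (σ : Subst G) (W : Set (AVar G)) : Subst G :=
  ⟨fun x => if .msg x ∈ W then σ.msg x else Subst.id.msg x,
    fun n => if .lst n ∈ W then σ.lst n else Subst.id.lst n,
    fun n => if .ss n ∈ W then σ.ss n else Subst.id.ss n,
    fun n => if .ik n ∈ W then σ.ik n else Subst.id.ik n,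
    fun n => if .cs n ∈ W then σ.cs n else Subst.id.cs n⟩

/-- Substitutions proper: sorted (`s` is the sort of messages), with finite domain. -/
def IsSubst (s : G.Srt) (σ : Subst G) : Prop :=
  SortedAssign σ.msg ∧ (∀ n, SList.WF s (σ.lst n)) ∧ (∀ n, StrandSet.WF s (σ.ss n)) ∧
    (∀ n, Know.WF s (σ.ik n)) ∧ (∀ n, Store.WF s (σ.cs n)) ∧ σ.dom.Finite

/-- `σ` and `τ` agree modulo the equations at a variable. -/
def EqAt (E : Set (Term G × Term G)) (σ τ : Subst G) : AVar G → Prop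
  | .msg x => CStrand.EqE E (σ.msg x) (τ.msg x)
  | .lst n => SList.EqE E (σ.lst n) (τ.lst n)
  | .ss n => StrandSet.EqE E (σ.ss n) (τ.ss n)
  | .ik n => Know.EqE E (σ.ik n) (τ.ik n)
  | .cs n => Store.EqE E (σ.cs n) (τ.cs n)

end Subst

end Symbolic

section Backward

variable (P : Protocol.{u, v, w, z})

/-- `U` is a complete set of unifiers of `S` and `S'` away from `W`. -/
structure IsCSU (S S' : CState P.sig) (W : Set (AVar P.sig)) (U : Set (Subst P.sig)) : Prop where
  unifier : ∀ σ ∈ U, σ.IsSubst P.msg ∧ CState.EqE P.eqns (S.subst σ) (S'.subst σ)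
  complete : ∀ ρ : Subst P.sig, ρ.IsSubst P.msg →
    CState.EqE P.eqns (S.subst ρ) (S'.subst ρ) →
    ∃ σ ∈ U, ∃ η : Subst P.sig, η.IsSubst P.msg ∧ ∀ a ∈ W, (σ.comp η).EqAt P.eqns ρ a
  away : ∀ σ ∈ U, σ.dom ⊆ S.vars ∪ S'.vars ∧ Disjoint σ.ran W

/-- A unification procedure that is complete: it returns, for any two constrained states and any
finite set `W` of variables that contains theirs, a complete set of unifiers away from `W`. -/
def IsUnificationProcedure
    (csu : CState P.sig → CState P.sig → Set (AVar P.sig) → Set (Subst P.sig)) : Prop :=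
  ∀ S S' W, W.Finite → S.vars ∪ S'.vars ⊆ W → IsCSU P S S' W (csu S S' W)

variable {P}

/-- Satisfiability of a conjunction of disequalities in the algebra of terms with variables
modulo the equations. -/
def Store.Satisfiable (Y : Store P.sig) : Prop :=
  ∃ α : P.sig.Var → Term P.sig, SortedAssign α ∧
    ∀ d : Term P.sig × Term P.sig, .inl d ∈ Y →
      ¬ CStrand.EqE P.eqns (d.1.subst α) (d.2.subst α)

/-- `BRule l r c`: in the backwards direction, `l → r` if `c` is a renamed rule of the constrained
backwards strand semantics, where the condition `c` speaks about the unifier that is used.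
The numbers `SS`, `IK`, `L`, `L'`, `Y` are the names of variables for a set of strands,
a set of facts, two lists, and a constraint; `M`, `M'` are variables of sort `Msg`. -/
inductive BRule : CState P.sig → CState P.sig → (Subst P.sig → Prop) → Prop
  /-- a received message -/
  | recv (SS IK L L' Y : ℕ) (M : P.sig.Var) : L ≠ L' → P.sig.varSort M = P.msg →
      BRule
        ⟨{.inr SS, .inl ⟨[.inr L, .inl (.recv (.var M))], [.inr L']⟩},
          {.inl (.pos (.var M)), .inr IK}, {.inr Y}⟩
        ⟨{.inr SS, .inl ⟨[.inr L], [.inl (.recv (.var M)), .inr L']⟩},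
          {.inl (.pos (.var M)), .inr IK}, {.inr Y}⟩
        (fun _ => True)
  /-- a sent message that is not learnt -/
  | send (SS IK L L' Y : ℕ) (M : P.sig.Var) : L ≠ L' → P.sig.varSort M = P.msg →
      BRule
        ⟨{.inr SS, .inl ⟨[.inr L, .inl (.send (.var M))], [.inr L']⟩}, {.inr IK}, {.inr Y}⟩
        ⟨{.inr SS, .inl ⟨[.inr L], [.inl (.send (.var M)), .inr L']⟩}, {.inr IK}, {.inr Y}⟩
        (fun _ => True)
  /-- a sent message that is learnt -/
  | sendLearn (SS IK L L' Y : ℕ) (M : P.sig.Var) : L ≠ L' → P.sig.varSort M = P.msg →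
      BRule
        ⟨{.inr SS, .inl ⟨[.inr L, .inl (.send (.var M))], [.inr L']⟩},
          {.inl (.pos (.var M)), .inr IK}, {.inr Y}⟩
        ⟨{.inr SS, .inl ⟨[.inr L], [.inl (.send (.var M)), .inr L']⟩},
          {.inl (.neg (.var M)), .inr IK}, {.inr Y}⟩
        (fun _ => True)
  /-- a learnt message is sent by a strand of the protocol that is new in the state;
  `ξ` renames the variables of the protocol strand -/
  | newStrand (SS IK Y : ℕ) (ro : P.Role) (ms l₁ l₂ : List (SMsg P.sig)) (t : Term P.sig)
      (ξ : P.sig.Var → P.sig.Var) : (ro, ms) ∈ P.strands →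
      Set.InjOn ξ {x | ∃ m ∈ ms, .msg x ∈ m.vars} →
      (∀ x, P.sig.varSort (ξ x) = P.sig.varSort x) →
      ms.map (SMsg.subst fun x => .var (ξ x)) = l₁ ++ .send t :: l₂ →
      BRule
        ⟨{.inr SS}, {.inl (.pos t), .inr IK}, {.inr Y}⟩
        ⟨{.inr SS, .inl ⟨l₁.map .inl, (.send t :: l₂).map .inl⟩},
          {.inl (.neg t), .inr IK}, {.inr Y}⟩
        (fun _ => True)
  /-- explicit non-deterministic choice -/
  | choice (SS IK L L' Y num : ℕ) : L ≠ L' →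
      BRule
        ⟨{.inr SS, .inl ⟨[.inr L, .inl (.cstr .any num)], [.inr L']⟩}, {.inr IK}, {.inr Y}⟩
        ⟨{.inr SS, .inl ⟨[.inr L], [.inl (.cstr .any num), .inr L']⟩}, {.inr IK}, {.inr Y}⟩
        (fun _ => True)
  /-- explicit deterministic choice, equality -/
  | condEq (SS IK L L' Y num : ℕ) (M : P.sig.Var) : L ≠ L' → P.sig.varSort M = P.msg →
      BRule
        ⟨{.inr SS, .inl ⟨[.inr L, .inl (.cstr (.eq (.var M) (.var M)) num)], [.inr L']⟩},
          {.inr IK}, {.inr Y}⟩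
        ⟨{.inr SS, .inl ⟨[.inr L], [.inl (.cstr (.eq (.var M) (.var M)) num), .inr L']⟩},
          {.inr IK}, {.inr Y}⟩
        (fun _ => True)
  /-- explicit deterministic choice, disequality -/
  | condNe (SS IK L L' Y num : ℕ) (M M' : P.sig.Var) : L ≠ L' → M ≠ M' →
      P.sig.varSort M = P.msg → P.sig.varSort M' = P.msg →
      BRule
        ⟨{.inr SS, .inl ⟨[.inr L, .inl (.cstr (.ne (.var M) (.var M')) num)], [.inr L']⟩},
          {.inr IK}, {.inr Y}⟩
        ⟨{.inr SS, .inl ⟨[.inr L], [.inl (.cstr (.ne (.var M) (.var M')) num), .inr L']⟩},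
          {.inr IK}, {.inr Y, .inl (.var M, .var M')}⟩
        (fun σ => Store.Satisfiable (Store.subst σ {.inr Y, .inl (.var M, .var M')}))

/-- One backwards narrowing step `S ⇝_μ S'` away from `W ⊇ vars S`: a rule renamed away from `W`
is applied with a unifier from the complete set that the procedure `csu` returns; `μ` is the part
of the unifier that binds variables of `S`. -/
def NarrowStep (csu : CState P.sig → CState P.sig → Set (AVar P.sig) → Set (Subst P.sig))
    (W : Set (AVar P.sig)) (S : CState P.sig) (μ : Subst P.sig) (S' : CState P.sig) : Prop :=
  W.Finite ∧ S.vars ⊆ W ∧ ∃ l r c σ, BRule l r c ∧ Disjoint (l.vars ∪ r.vars) W ∧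
    σ ∈ csu S l (W ∪ (l.vars ∪ r.vars)) ∧ c σ ∧ S' = r.subst σ ∧ μ = σ.restrict S.vars

/-- `Narrows csu W k S μ S'`: `k` backwards narrowing steps lead from `S` to `S'`, and `μ` is the
composition of their substitutions. Later steps are also away from `W`. -/
inductive Narrows (csu : CState P.sig → CState P.sig → Set (AVar P.sig) → Set (Subst P.sig)) :
    Set (AVar P.sig) → ℕ → CState P.sig → Subst P.sig → CState P.sig → Prop
  | zero (W : Set (AVar P.sig)) (S : CState P.sig) : Narrows csu W 0 S Subst.id S
  | succ {W W' : Set (AVar P.sig)} {k : ℕ} {S S₁ S₂ : CState P.sig} {μ ν : Subst P.sig} :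
      NarrowStep csu W S μ S₁ → W ⊆ W' → Narrows csu W' k S₁ ν S₂ →
      Narrows csu W (k + 1) S (μ.comp ν) S₂

variable (P)

/-- Constrained symbolic strand states: every strand is an instance, modulo the equations, of a
protocol strand with the bar somewhere; besides the strands and the facts there are variables
`SS` and `IK` for further strands and facts (unifiers modulo associativity, commutativity and
identity may split such a variable into several, `SS ↦ SS₁ & SS₂`); the constraint is a
conjunction of disequalities between messages. -/
def IsSymbolicState (S : CState P.sig) : Prop :=
  S.WF P.msg ∧
  (∀ A, .inl A ∈ S.strands → ∃ ro ms, (ro, ms) ∈ P.strands ∧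
    ∃ ρ : P.sig.Var → Term P.sig, SortedAssign ρ ∧
      SList.EqE P.eqns ((ms.map (SMsg.subst ρ)).map .inl) (A.past ++ A.future)) ∧
  (∃ n, .inr n ∈ S.strands) ∧ (∃ n, .inr n ∈ S.ik) ∧ (∀ n, .inr n ∉ S.store)

variable {P}

/-- Symbolic initial states: all bars are at the beginning, no fact `m ∈ I`. -/
def CState.IsInitial {G : Signature.{u, v, w}} (S : CState G) : Prop :=
  (∀ A, .inl A ∈ S.strands → A.past = []) ∧ ∀ t, .inl (.pos t) ∉ S.ik

/-- The strands of `S` (with multiplicity) that have begun, i.e. whose past is not empty. -/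
def CState.begun {G : Signature.{u, v, w}} (S : CState G) : Multiset (Strand G) :=
  (S.strands.filterMap Sum.getLeft?).filter fun A => A.past.isEmpty = false

/-- The lifting relation `S >^θ s`. Distinct occurrences of strands of `S` correspond to distinct
occurrences of strands of `s`; a strand that has not begun has no counterpart in `s`. -/
def Lifts (S : CState P.sig) (θ : P.sig.Var → Term P.sig) (s : GState P) : Prop :=
  GroundAssign θ ∧
  (∃ T, T ≤ s.strands ∧ Multiset.Rel (fun A g =>
    List.Forall₂ (fun a m => ∃ m', a = .inl m' ∧ SMsg.EqE P.eqns m (m'.subst θ)) A.past g.msgs)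
    S.begun T) ∧
  (∀ t, .inl (.pos t) ∈ S.ik → ∃ m ∈ s.ik, EqE P.eqns m (t.subst θ)) ∧
  (∀ t, .inl (.neg t) ∈ S.ik → ¬ ∃ m ∈ s.ik, EqE P.eqns m (t.subst θ)) ∧
  (∀ a b, .inl (a, b) ∈ S.store → ¬ EqE P.eqns (a.subst θ) (b.subst θ))

end Backward

end CStrand

namespace CStrand

/-! ## Terms -/

section Terms

variable {G : Signature.{u, v, w}} {E : Set (Term G × Term G)}

/-! The forwards run is undone from its end, one step at a time. By `FRule.effect`, a step q → s
appends one element m to one ground strand g (possibly a new one) and either leaves the knowledge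
alone or makes the sent message known. Given a symbolic state S that lifts s, two questions decide
what happens (`lifts_or_canStep`): is g the counterpart of a strand A of S, and, if m was learnt,
does S contain a positive fact that θ makes equal to it? If neither, S already lifts q and no
narrowing is needed; this is why k ≤ n and not k = n. If g belongs to A, the past of A ends with an
element equal to m under θ, and the rule for that kind of element moves the bar back. If only the
fact is present, the rule that introduces a protocol strand explains it. Whenever learning is
undone, the fact m ∈ I turns into m ∉ I, which is true in q because only unknown messages are
learnt.

That the rule l → r applies is shown with an explicit unifier ρ (`canStep_of_instance`): message
variables of S take their values under θ, those of the rule take values τ read off the step, and the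
collection variables of the rule absorb the rest of S. Then `exists_narrowStep` passes to the
unification procedure: some σ in the complete set and some η satisfy ση =_E ρ on all relevant
variables, so the η-instance of rσ equals rρ and lifts q. Lifting is inherited by more general
states (`Lifts.of_subst`), hence rσ lifts q, with η absorbed into the ground assignment. That
assignment also witnesses the satisfiability condition of the disequality rule.

Two points need care. First, ρ must fix the strand variables of S and keep a variable in the value
of each of its fact variables; otherwise σ might insert arbitrary strands or lose the variables, and
rσ might fail to be a symbolic state. Second, the rule for received messages needs a fact that S may
lack; ρ creates it out of a fact variable of S.

Induction on n (`exists_narrows`) ends with a state that lifts s₀ and is therefore initial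
(`Lifts.isInitial`). -/

theorem Term.subst_subst (σ τ : G.Var → Term G) (t : Term G) :
    (t.subst σ).subst τ = t.subst fun x => (σ x).subst τ := by
  induction t with
  | var x => rfl
  | app f a ih => simp only [Term.subst, ih]

theorem Term.subst_congr {σ τ : G.Var → Term G} {t : Term G} (h : ∀ x ∈ t.vars, σ x = τ x) :
    t.subst σ = t.subst τ := by
  induction t with
  | var x => exact h x rfl
  | app f a ih =>
    simp only [Term.subst, Term.app.injEq, heq_eq_eq, true_and]
    funext i
    exact ih i fun x hx => h x (Set.mem_iUnion.2 ⟨i, hx⟩)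

theorem Term.subst_var (t : Term G) : t.subst .var = t := by
  induction t with
  | var x => rfl
  | app f a ih => simp only [Term.subst, ih]

theorem Term.Ground.subst {t : Term G} (h : t.Ground) (σ : G.Var → Term G) : t.subst σ = t := by
  conv_rhs => rw [← Term.subst_var t]
  refine Term.subst_congr fun x hx => ?_
  rw [h] at hx
  exact hx.elim

theorem Term.vars_finite (t : Term G) : t.vars.Finite := by
  induction t with
  | var x => exact Set.finite_singleton x
  | app f a ih => exact Set.finite_iUnion ih

theorem Term.mem_vars_subst {σ : G.Var → Term G} {t : Term G} {y : G.Var} :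
    y ∈ (t.subst σ).vars ↔ ∃ x ∈ t.vars, y ∈ (σ x).vars := by
  induction t with
  | var x => simp [Term.subst, Term.vars]
  | app f a ih =>
    simp only [Term.subst, Term.vars, Set.mem_iUnion, ih]
    constructor
    · rintro ⟨i, x, hx, hy⟩
      exact ⟨x, ⟨i, hx⟩, hy⟩
    · rintro ⟨x, ⟨i, hx⟩, hy⟩
      exact ⟨i, x, hx, hy⟩

theorem Term.ground_subst {σ : G.Var → Term G} (h : ∀ x, (σ x).Ground) (t : Term G) :
    (t.subst σ).Ground := by
  refine Set.eq_empty_of_forall_notMem fun y hy => ?_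
  obtain ⟨x, -, hx⟩ := Term.mem_vars_subst.1 hy
  rw [h x] at hx
  exact hx

theorem HasSort.mono {t : Term G} {s s' : G.Srt} (h : HasSort t s) (hs : s ≤ s') :
    HasSort t s' := by
  cases h with
  | var x _ h => exact .var x _ (h.trans hs)
  | app f a w s _ hr ha h => exact .app f a w s _ hr ha (h.trans hs)

theorem HasSort.subst {t : Term G} {s : G.Srt} (h : HasSort t s) {σ : G.Var → Term G}
    (hσ : SortedAssign σ) : HasSort (t.subst σ) s := by
  induction h with
  | var x s h => exact (hσ x).mono h
  | app f a w s s' hr _ h ih => exact .app f _ w s s' hr ih h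

theorem sortedAssign_var : SortedAssign (G := G) .var := fun x => .var x _ le_rfl

theorem SortedAssign.comp {σ τ : G.Var → Term G} (hσ : SortedAssign σ) (hτ : SortedAssign τ) :
    SortedAssign fun x => (σ x).subst τ := fun x => (hσ x).subst hτ

theorem EqE.subst {t t' : Term G} (h : EqE E t t') {σ : G.Var → Term G} (hσ : SortedAssign σ) :
    EqE E (t.subst σ) (t'.subst σ) := by
  induction h with
  | refl t => exact .refl _
  | symm _ ih => exact ih.symm
  | trans _ _ ih ih' => exact ih.trans ih'
  | ax e τ he hτ =>
    rw [Term.subst_subst, Term.subst_subst]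
    exact .ax e _ he (hτ.comp hσ)
  | congr f a b s s' ha hb _ ih => exact .congr f _ _ s s' (ha.subst hσ) (hb.subst hσ) ih

/-- `EqE.congr` applies to well-sorted terms only, so equal values may be substituted inside `t`
because `t` has a sort. This is why well-sortedness accompanies the symbolic states throughout. -/
theorem HasSort.subst_eqE {t : Term G} {s : G.Srt} (h : HasSort t s) {σ τ : G.Var → Term G}
    (hσ : SortedAssign σ) (hτ : SortedAssign τ) (hστ : ∀ x ∈ t.vars, EqE E (σ x) (τ x)) :
    EqE E (t.subst σ) (t.subst τ) := by
  induction h with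
  | var x s h => exact hστ x rfl
  | app f a w s s' hr ha h ih =>
    exact .congr f _ _ s s (.app f _ w s s hr (fun i => (ha i).subst hσ) le_rfl)
      (.app f _ w s s hr (fun i => (ha i).subst hτ) le_rfl)
      fun i => ih i fun x hx => hστ x (Set.mem_iUnion.2 ⟨i, hx⟩)

/-! ## Strand elements -/

theorem SMsg.subst_subst (σ τ : G.Var → Term G) (m : SMsg G) :
    (m.subst σ).subst τ = m.subst fun x => (σ x).subst τ := by
  rcases m with t | t | ⟨_ | ⟨a, b⟩ | ⟨a, b⟩, n⟩ <;>
    simp [SMsg.subst, Cstr.subst, Term.subst_subst]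

theorem SMsg.subst_congr {σ τ : G.Var → Term G} {m : SMsg G}
    (h : ∀ x, AVar.msg x ∈ m.vars → σ x = τ x) : m.subst σ = m.subst τ := by
  have h' : ∀ t ∈ m.terms, t.subst σ = t.subst τ := fun t ht =>
    Term.subst_congr fun x hx => h x ⟨t, ht, x, hx, rfl⟩
  rcases m with t | t | ⟨_ | ⟨a, b⟩ | ⟨a, b⟩, n⟩ <;>
    simp_all [SMsg.subst, Cstr.subst, SMsg.terms]

theorem SMsg.terms_subst {σ : G.Var → Term G} {m : SMsg G} :
    (m.subst σ).terms = (Term.subst σ) '' m.terms := by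
  rcases m with t | t | ⟨_ | ⟨a, b⟩ | ⟨a, b⟩, n⟩ <;>
    simp [SMsg.subst, Cstr.subst, SMsg.terms, Set.image_insert_eq]

theorem SMsg.terms_finite (m : SMsg G) : m.terms.Finite := by
  rcases m with t | t | ⟨_ | ⟨a, b⟩ | ⟨a, b⟩, n⟩ <;> simp [SMsg.terms]

theorem SMsg.vars_finite (m : SMsg G) : m.vars.Finite := by
  refine (m.terms_finite.biUnion fun t _ => t.vars_finite.image AVar.msg).subset ?_
  rintro a ⟨t, ht, x, hx, rfl⟩
  exact Set.mem_biUnion ht ⟨x, hx, rfl⟩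

theorem SMsg.EqE.refl (m : SMsg G) : SMsg.EqE E m m := by
  rcases m with t | t | ⟨_ | ⟨a, b⟩ | ⟨a, b⟩, n⟩ <;> constructor <;> exact .refl _

theorem SMsg.EqE.symm {m m' : SMsg G} (h : SMsg.EqE E m m') : SMsg.EqE E m' m := by
  cases h <;> constructor <;> apply CStrand.EqE.symm <;> assumption

theorem SMsg.EqE.trans {m m' m'' : SMsg G} (h : SMsg.EqE E m m') (h' : SMsg.EqE E m' m'') :
    SMsg.EqE E m m'' := by
  cases h <;> cases h' <;> constructor <;> apply CStrand.EqE.trans <;> assumption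

theorem SMsg.EqE.subst {m m' : SMsg G} (h : SMsg.EqE E m m') {σ : G.Var → Term G}
    (hσ : SortedAssign σ) : SMsg.EqE E (m.subst σ) (m'.subst σ) := by
  cases h <;> constructor <;> apply CStrand.EqE.subst <;> assumption

theorem SMsg.subst_eqE {m : SMsg G} {s : G.Srt} (h : ∀ t ∈ m.terms, HasSort t s)
    {σ τ : G.Var → Term G} (hσ : SortedAssign σ) (hτ : SortedAssign τ)
    (hστ : ∀ x, AVar.msg x ∈ m.vars → CStrand.EqE E (σ x) (τ x)) :
    SMsg.EqE E (m.subst σ) (m.subst τ) := by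
  have h' : ∀ t ∈ m.terms, CStrand.EqE E (t.subst σ) (t.subst τ) := fun t ht =>
    (h t ht).subst_eqE hσ hτ fun x hx => hστ x ⟨t, ht, x, hx, rfl⟩
  rcases m with t | t | ⟨_ | ⟨a, b⟩ | ⟨a, b⟩, n⟩ <;> constructor <;> apply h' <;> simp [SMsg.terms]

end Terms

/-! ## Relations between multisets -/

section Multisets

variable {α β γ : Type*}

theorem rel_comp {r : α → β → Prop} {r' : β → γ → Prop} {a : Multiset α} {b : Multiset β}
    {c : Multiset γ} (h : Multiset.Rel r a b) (h' : Multiset.Rel r' b c) :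
    Multiset.Rel (Relation.Comp r r') a c := by
  induction h generalizing c with
  | zero => rw [Multiset.rel_zero_left.1 h']; exact .zero
  | cons hab _ ih =>
    obtain ⟨d, c', hbd, hc', rfl⟩ := Multiset.rel_cons_left.1 h'
    exact .cons ⟨_, hab, hbd⟩ (ih hc')

/-- A splitting of `b` induces one of `a`. This transports a choice of distinct counterparts, or
cuts it down to fewer strands. -/
theorem rel_exists_of_le {r : α → β → Prop} {a : Multiset α} {b b' : Multiset β}
    (h : Multiset.Rel r a b) (hb : b' ≤ b) : ∃ a' ≤ a, Multiset.Rel r a' b' := by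
  obtain ⟨c, rfl⟩ := Multiset.le_iff_exists_add.1 hb
  obtain ⟨a', a'', h', -, rfl⟩ := Multiset.rel_add_right.1 h
  exact ⟨a', Multiset.le_add_right _ _, h'⟩

theorem rel_exists_left {r : α → β → Prop} {a : Multiset α} {b : Multiset β}
    (h : Multiset.Rel r a b) {y : β} (hy : y ∈ b) : ∃ x ∈ a, r x y :=
  Multiset.exists_mem_of_rel_of_mem (Multiset.rel_flip.2 h) hy

theorem SetRel.refl {r : α → α → Prop} (hr : ∀ a, r a a) (m : Multiset α) : SetRel r m m :=
  ⟨fun a ha => ⟨a, ha, hr a⟩, fun a ha => ⟨a, ha, hr a⟩⟩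

theorem SetRel.trans {r : α → α → Prop} (hr : ∀ a b c, r a b → r b c → r a c)
    {l m n : Multiset α} (h : SetRel r l m) (h' : SetRel r m n) : SetRel r l n := by
  constructor
  · intro a ha
    obtain ⟨b, hb, hab⟩ := h.1 a ha
    obtain ⟨c, hc, hbc⟩ := h'.1 b hb
    exact ⟨c, hc, hr _ _ _ hab hbc⟩
  · intro c hc
    obtain ⟨b, hb, hbc⟩ := h'.2 c hc
    obtain ⟨a, ha, hab⟩ := h.2 b hb
    exact ⟨a, ha, hr _ _ _ hab hbc⟩

theorem SetRel.symm {r : α → α → Prop} (hr : ∀ a b, r a b → r b a)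
    {l m : Multiset α} (h : SetRel r l m) : SetRel r m l := by
  constructor
  · intro a ha
    obtain ⟨b, hb, hab⟩ := h.2 a ha
    exact ⟨b, hb, hr _ _ hab⟩
  · intro a ha
    obtain ⟨b, hb, hab⟩ := h.1 a ha
    exact ⟨b, hb, hr _ _ hab⟩

theorem SetRel.bind {r : β → β → Prop} {f g : α → Multiset β} {m : Multiset α}
    (h : ∀ a ∈ m, SetRel r (f a) (g a)) : SetRel r (m.bind f) (m.bind g) := by
  constructor
  · intro b hb
    obtain ⟨a, ha, hb⟩ := Multiset.mem_bind.1 hb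
    obtain ⟨c, hc, hbc⟩ := (h a ha).1 b hb
    exact ⟨c, Multiset.mem_bind.2 ⟨a, ha, hc⟩, hbc⟩
  · intro b hb
    obtain ⟨a, ha, hb⟩ := Multiset.mem_bind.1 hb
    obtain ⟨c, hc, hbc⟩ := (h a ha).2 b hb
    exact ⟨c, Multiset.mem_bind.2 ⟨a, ha, hc⟩, hbc⟩

theorem setRel_singleton {r : α → α → Prop} {a b : α} (h : r a b) : SetRel r {a} {b} := by
  simp [SetRel, h]

end Multisets

/-! ## Equality of symbolic states modulo the equations -/

section SymbolicEquality

variable {G : Signature.{u, v, w}} {E : Set (Term G × Term G)}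

theorem liftRel_refl {α : Type*} {r : α → α → Prop} (hr : ∀ a, r a a) (a : α ⊕ ℕ) :
    Sum.LiftRel r Eq a a := by
  rcases a with a | n
  · exact .inl (hr a)
  · exact .inr rfl

theorem liftRel_symm {α : Type*} {r : α → α → Prop} (hr : ∀ a b, r a b → r b a) (a b : α ⊕ ℕ)
    (h : Sum.LiftRel r Eq a b) : Sum.LiftRel r Eq b a := by
  cases h with
  | inl h => exact .inl (hr _ _ h)
  | inr h => exact .inr h.symm

theorem liftRel_trans {α : Type*} {r : α → α → Prop} (hr : ∀ a b c, r a b → r b c → r a c)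
    (a b c : α ⊕ ℕ) (h : Sum.LiftRel r Eq a b) (h' : Sum.LiftRel r Eq b c) :
    Sum.LiftRel r Eq a c := by
  cases h with
  | inl h => cases h' with | inl h' => exact .inl (hr _ _ _ h h')
  | inr h => cases h' with | inr h' => exact .inr (h.trans h')

theorem SList.EqE.refl (l : SList G) : SList.EqE E l l :=
  List.forall₂_same.2 fun a _ => liftRel_refl SMsg.EqE.refl a

theorem SList.EqE.symm {l l' : SList G} (h : SList.EqE E l l') : SList.EqE E l' l :=
  (List.Forall₂.flip h).imp fun a b => liftRel_symm (fun _ _ => SMsg.EqE.symm) b a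

theorem SList.EqE.trans {l l' l'' : SList G} (h : SList.EqE E l l') (h' : SList.EqE E l' l'') :
    SList.EqE E l l'' := by
  unfold SList.EqE at *
  induction h generalizing l'' with
  | nil => exact h'
  | cons hab _ ih =>
    cases h' with
    | cons hbc h' => exact .cons (liftRel_trans (fun _ _ _ => SMsg.EqE.trans) _ _ _ hab hbc) (ih h')

theorem SList.EqE.append {l l' m m' : SList G} (h : SList.EqE E l l') (h' : SList.EqE E m m') :
    SList.EqE E (l ++ m) (l' ++ m') := List.rel_append h h'

/-- Equality of strands modulo the equations. -/
def Strand.EqE (E : Set (Term G × Term G)) (A B : Strand G) : Prop :=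
  SList.EqE E A.past B.past ∧ SList.EqE E A.future B.future

theorem Strand.EqE.refl (A : Strand G) : Strand.EqE E A A := ⟨.refl _, .refl _⟩

theorem Strand.EqE.symm {A B : Strand G} (h : Strand.EqE E A B) : Strand.EqE E B A :=
  ⟨h.1.symm, h.2.symm⟩

theorem Strand.EqE.trans {A B C : Strand G} (h : Strand.EqE E A B) (h' : Strand.EqE E B C) :
    Strand.EqE E A C := ⟨h.1.trans h'.1, h.2.trans h'.2⟩

theorem StrandSet.eqE_iff {M M' : StrandSet G} :
    StrandSet.EqE E M M' ↔ Multiset.Rel (Sum.LiftRel (Strand.EqE E) Eq) M M' := Iff.rfl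

theorem StrandSet.EqE.refl (M : StrandSet G) : StrandSet.EqE E M M :=
  Multiset.rel_refl_of_refl_on fun a _ => liftRel_refl Strand.EqE.refl a

theorem StrandSet.EqE.symm {M M' : StrandSet G} (h : StrandSet.EqE E M M') :
    StrandSet.EqE E M' M :=
  (Multiset.rel_flip.2 h).mono fun a _ b _ => liftRel_symm (fun _ _ => Strand.EqE.symm) b a

theorem StrandSet.EqE.trans {M M' M'' : StrandSet G} (h : StrandSet.EqE E M M')
    (h' : StrandSet.EqE E M' M'') : StrandSet.EqE E M M'' :=
  (rel_comp h h').mono fun a _ c _ ⟨b, hab, hbc⟩ =>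
    liftRel_trans (fun _ _ _ => Strand.EqE.trans) a b c hab hbc

theorem Fact.EqE.refl (f : Fact G) : Fact.EqE E f f := by
  cases f <;> constructor <;> exact .refl _

theorem Fact.EqE.symm {f f' : Fact G} (h : Fact.EqE E f f') : Fact.EqE E f' f := by
  cases h <;> constructor <;> apply CStrand.EqE.symm <;> assumption

theorem Fact.EqE.trans {f f' f'' : Fact G} (h : Fact.EqE E f f') (h' : Fact.EqE E f' f'') :
    Fact.EqE E f f'' := by
  cases h <;> cases h' <;> constructor <;> apply CStrand.EqE.trans <;> assumption

theorem Know.EqE.refl (K : Know G) : Know.EqE E K K :=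
  SetRel.refl (liftRel_refl Fact.EqE.refl) K

theorem Know.EqE.symm {K K' : Know G} (h : Know.EqE E K K') : Know.EqE E K' K :=
  SetRel.symm (liftRel_symm fun _ _ => Fact.EqE.symm) h

theorem Know.EqE.trans {K K' K'' : Know G} (h : Know.EqE E K K') (h' : Know.EqE E K' K'') :
    Know.EqE E K K'' :=
  SetRel.trans (liftRel_trans fun _ _ _ => Fact.EqE.trans) h h'

theorem Store.EqE.refl (Y : Store G) : Store.EqE E Y Y :=
  SetRel.refl (liftRel_refl fun _ => ⟨.refl _, .refl _⟩) Y

theorem Store.EqE.symm {Y Y' : Store G} (h : Store.EqE E Y Y') : Store.EqE E Y' Y :=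
  SetRel.symm (liftRel_symm fun _ _ h => ⟨h.1.symm, h.2.symm⟩) h

theorem Store.EqE.trans {Y Y' Y'' : Store G} (h : Store.EqE E Y Y') (h' : Store.EqE E Y' Y'') :
    Store.EqE E Y Y'' :=
  SetRel.trans (liftRel_trans fun _ _ _ h h' => ⟨h.1.trans h'.1, h.2.trans h'.2⟩) h h'

theorem CState.EqE.symm {S S' : CState G} (h : CState.EqE E S S') : CState.EqE E S' S :=
  ⟨h.1.symm, h.2.1.symm, h.2.2.symm⟩

theorem CState.EqE.trans {S S' S'' : CState G} (h : CState.EqE E S S') (h' : CState.EqE E S' S'') :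
    CState.EqE E S S'' := ⟨h.1.trans h'.1, h.2.1.trans h'.2.1, h.2.2.trans h'.2.2⟩

end SymbolicEquality

/-! ## Substitutions on symbolic states -/

section SymbolicSubst

variable {G : Signature.{u, v, w}} {E : Set (Term G × Term G)}

@[simp] theorem SList.subst_nil (σ : Subst G) : SList.subst σ [] = [] := rfl

@[simp] theorem SList.subst_inl_cons (σ : Subst G) (m : SMsg G) (l : SList G) :
    SList.subst σ (.inl m :: l) = .inl (m.subst σ.msg) :: SList.subst σ l := rfl

@[simp] theorem SList.subst_inr_cons (σ : Subst G) (n : ℕ) (l : SList G) :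
    SList.subst σ (.inr n :: l) = σ.lst n ++ SList.subst σ l := rfl

theorem SList.subst_append (σ : Subst G) (l l' : SList G) :
    SList.subst σ (l ++ l') = SList.subst σ l ++ SList.subst σ l' := List.flatMap_append

theorem SList.subst_map_inl (σ : Subst G) (l : List (SMsg G)) :
    SList.subst σ (l.map .inl) = (l.map (SMsg.subst σ.msg)).map .inl := by
  induction l with
  | nil => rfl
  | cons m l ih => simp [ih]

@[simp] theorem StrandSet.subst_inl_cons (σ : Subst G) (A : Strand G) (M : StrandSet G) :
    StrandSet.subst σ (.inl A ::ₘ M) = .inl (A.subst σ) ::ₘ StrandSet.subst σ M := by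
  simp [StrandSet.subst]

@[simp] theorem StrandSet.subst_inr_cons (σ : Subst G) (n : ℕ) (M : StrandSet G) :
    StrandSet.subst σ (.inr n ::ₘ M) = σ.ss n + StrandSet.subst σ M := by
  simp [StrandSet.subst]

@[simp] theorem StrandSet.subst_inl (σ : Subst G) (A : Strand G) :
    StrandSet.subst σ {.inl A} = {.inl (A.subst σ)} := by
  simp [StrandSet.subst]

@[simp] theorem StrandSet.subst_inr (σ : Subst G) (n : ℕ) :
    StrandSet.subst σ {.inr n} = σ.ss n := by
  simp [StrandSet.subst]

@[simp] theorem Know.subst_inl_cons (σ : Subst G) (f : Fact G) (K : Know G) :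
    Know.subst σ (.inl f ::ₘ K) = .inl (f.subst σ.msg) ::ₘ Know.subst σ K := by
  simp [Know.subst]

@[simp] theorem Know.subst_inr (σ : Subst G) (n : ℕ) : Know.subst σ {.inr n} = σ.ik n := by
  simp [Know.subst]

theorem Know.subst_add (σ : Subst G) (K K' : Know G) :
    Know.subst σ (K + K') = Know.subst σ K + Know.subst σ K' :=
  Multiset.add_bind _ _ _

@[simp] theorem Store.subst_inr (σ : Subst G) (n : ℕ) : Store.subst σ {.inr n} = σ.cs n := by
  simp [Store.subst]

@[simp] theorem Store.subst_inr_cons (σ : Subst G) (n : ℕ) (Y : Store G) :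
    Store.subst σ (.inr n ::ₘ Y) = σ.cs n + Store.subst σ Y := by
  simp [Store.subst]

@[simp] theorem Store.subst_inl (σ : Subst G) (d : Term G × Term G) :
    Store.subst σ {.inl d} = {.inl (d.1.subst σ.msg, d.2.subst σ.msg)} := by
  simp [Store.subst]

theorem Know.mem_subst {σ : Subst G} {K : Know G} {a : Fact G ⊕ ℕ} :
    a ∈ Know.subst σ K ↔ (∃ f, .inl f ∈ K ∧ a = .inl (f.subst σ.msg)) ∨
      ∃ n, .inr n ∈ K ∧ a ∈ σ.ik n := by
  simp [Know.subst, Multiset.mem_bind]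

theorem Store.mem_subst {σ : Subst G} {Y : Store G} {a : (Term G × Term G) ⊕ ℕ} :
    a ∈ Store.subst σ Y ↔ (∃ d, .inl d ∈ Y ∧ a = .inl (d.1.subst σ.msg, d.2.subst σ.msg)) ∨
      ∃ n, .inr n ∈ Y ∧ a ∈ σ.cs n := by
  simp [Store.subst, Multiset.mem_bind]

theorem StrandSet.mem_subst {σ : Subst G} {M : StrandSet G} {a : Strand G ⊕ ℕ} :
    a ∈ StrandSet.subst σ M ↔ (∃ A, .inl A ∈ M ∧ a = .inl (A.subst σ)) ∨
      ∃ n, .inr n ∈ M ∧ a ∈ σ.ss n := by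
  simp [StrandSet.subst, Multiset.mem_bind]

/-! ### Composition -/

theorem SList.subst_subst (σ τ : Subst G) (l : SList G) :
    SList.subst τ (SList.subst σ l) = SList.subst (σ.comp τ) l := by
  induction l with
  | nil => rfl
  | cons a l ih =>
    rcases a with m | n
    · simp [ih, SMsg.subst_subst, Subst.comp]
    · simp [SList.subst_append, ih, Subst.comp]

theorem Strand.subst_subst (σ τ : Subst G) (A : Strand G) :
    (A.subst σ).subst τ = A.subst (σ.comp τ) := by
  simp [Strand.subst, SList.subst_subst]

theorem StrandSet.subst_subst (σ τ : Subst G) (M : StrandSet G) :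
    StrandSet.subst τ (StrandSet.subst σ M) = StrandSet.subst (σ.comp τ) M := by
  unfold StrandSet.subst
  rw [Multiset.bind_assoc]
  refine Multiset.bind_congr fun a _ => ?_
  rcases a with A | n
  · simp [Strand.subst_subst]
  · rfl

theorem Fact.subst_subst (σ τ : G.Var → Term G) (f : Fact G) :
    (f.subst σ).subst τ = f.subst fun x => (σ x).subst τ := by
  cases f <;> simp [Fact.subst, Term.subst_subst]

theorem Know.subst_subst (σ τ : Subst G) (K : Know G) :
    Know.subst τ (Know.subst σ K) = Know.subst (σ.comp τ) K := by
  unfold Know.subst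
  rw [Multiset.bind_assoc]
  refine Multiset.bind_congr fun a _ => ?_
  rcases a with f | n
  · simp [Fact.subst_subst, Subst.comp]
  · rfl

theorem Store.subst_subst (σ τ : Subst G) (Y : Store G) :
    Store.subst τ (Store.subst σ Y) = Store.subst (σ.comp τ) Y := by
  unfold Store.subst
  rw [Multiset.bind_assoc]
  refine Multiset.bind_congr fun a _ => ?_
  rcases a with d | n
  · simp [Term.subst_subst, Subst.comp]
  · rfl

theorem CState.subst_subst (σ τ : Subst G) (S : CState G) :
    (S.subst σ).subst τ = S.subst (σ.comp τ) := by
  simp [CState.subst, StrandSet.subst_subst, Know.subst_subst, Store.subst_subst]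

/-! ### Compatibility with equality -/

theorem SList.EqE.subst {l l' : SList G} (h : SList.EqE E l l') {σ : Subst G}
    (hσ : SortedAssign σ.msg) : SList.EqE E (SList.subst σ l) (SList.subst σ l') := by
  refine List.rel_flatMap h fun a b hab => ?_
  cases hab with
  | inl hab => exact .cons (.inl (hab.subst hσ)) .nil
  | inr hab => subst hab; exact SList.EqE.refl _

theorem SList.subst_eqE {l : SList G} {s : G.Srt} (h : SList.WF s l) {σ τ : Subst G}
    (hσ : SortedAssign σ.msg) (hτ : SortedAssign τ.msg) (hστ : ∀ a ∈ SList.vars l, σ.EqAt E τ a) :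
    SList.EqE E (SList.subst σ l) (SList.subst τ l) := by
  induction l with
  | nil => exact .refl _
  | cons a l ih =>
    have ih' := ih (fun m hm => h m (.tail _ hm)) fun a ha => hστ a <| by
      rcases ha with ⟨m, hm, ha⟩ | ⟨n, hn, ha⟩
      · exact .inl ⟨m, .tail _ hm, ha⟩
      · exact .inr ⟨n, .tail _ hn, ha⟩
    rcases a with m | n
    · exact .cons (.inl (SMsg.subst_eqE (h m (.head _)) hσ hτ fun x hx =>
        hστ _ (.inl ⟨m, .head _, hx⟩))) ih'
    · exact SList.EqE.append (hστ _ (.inr ⟨n, .head _, rfl⟩)) ih'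

theorem Strand.subst_eqE {A : Strand G} {s : G.Srt} (h : SList.WF s A.past)
    (h' : SList.WF s A.future) {σ τ : Subst G}
    (hσ : SortedAssign σ.msg) (hτ : SortedAssign τ.msg) (hστ : ∀ a ∈ A.vars, σ.EqAt E τ a) :
    Strand.EqE E (A.subst σ) (A.subst τ) :=
  ⟨SList.subst_eqE h hσ hτ fun a ha => hστ a (.inl ha),
    SList.subst_eqE h' hσ hτ fun a ha => hστ a (.inr ha)⟩

theorem StrandSet.subst_eqE {M : StrandSet G} {s : G.Srt} (h : StrandSet.WF s M) {σ τ : Subst G}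
    (hσ : SortedAssign σ.msg) (hτ : SortedAssign τ.msg)
    (hστ : ∀ a ∈ StrandSet.vars M, σ.EqAt E τ a) :
    StrandSet.EqE E (StrandSet.subst σ M) (StrandSet.subst τ M) := by
  induction M using Multiset.induction with
  | empty => exact .refl _
  | cons a M ih =>
    have ih' := ih (fun A hA => h A (Multiset.mem_cons_of_mem hA)) fun a ha => hστ a <| by
      rcases ha with ⟨m, hm, ha⟩ | ⟨n, hn, ha⟩
      · exact .inl ⟨m, Multiset.mem_cons_of_mem hm, ha⟩
      · exact .inr ⟨n, Multiset.mem_cons_of_mem hn, ha⟩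
    rcases a with A | n
    · have hA := h A (Multiset.mem_cons_self _ _)
      simp only [StrandSet.subst_inl_cons]
      exact .cons (.inl (Strand.subst_eqE hA.1 hA.2 hσ hτ fun x hx =>
        hστ _ (.inl ⟨A, Multiset.mem_cons_self _ _, hx⟩))) ih'
    · simp only [StrandSet.subst_inr_cons]
      exact Multiset.Rel.add (hστ _ (.inr ⟨n, Multiset.mem_cons_self _ _, rfl⟩)) ih'

theorem Fact.subst_eqE {f : Fact G} {s : G.Srt} (h : HasSort f.term s) {σ τ : G.Var → Term G}
    (hσ : SortedAssign σ) (hτ : SortedAssign τ)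
    (hστ : ∀ x ∈ f.term.vars, CStrand.EqE E (σ x) (τ x)) :
    Fact.EqE E (f.subst σ) (f.subst τ) := by
  cases f <;> constructor <;> exact h.subst_eqE hσ hτ hστ

theorem Know.subst_eqE {K : Know G} {s : G.Srt} (h : Know.WF s K) {σ τ : Subst G}
    (hσ : SortedAssign σ.msg) (hτ : SortedAssign τ.msg) (hστ : ∀ a ∈ Know.vars K, σ.EqAt E τ a) :
    Know.EqE E (Know.subst σ K) (Know.subst τ K) := by
  refine SetRel.bind fun a ha => ?_
  rcases a with f | n
  · exact setRel_singleton (.inl (Fact.subst_eqE (h f ha) hσ hτ fun x hx =>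
      hστ _ (.inl ⟨f, ha, x, hx, rfl⟩)))
  · exact hστ _ (.inr ⟨n, ha, rfl⟩)

theorem Store.subst_eqE {Y : Store G} {s : G.Srt} (h : Store.WF s Y) {σ τ : Subst G}
    (hσ : SortedAssign σ.msg) (hτ : SortedAssign τ.msg) (hστ : ∀ a ∈ Store.vars Y, σ.EqAt E τ a) :
    Store.EqE E (Store.subst σ Y) (Store.subst τ Y) := by
  refine SetRel.bind fun a ha => ?_
  rcases a with d | n
  · exact setRel_singleton (.inl
      ⟨(h d ha).1.subst_eqE hσ hτ fun x hx => hστ _ (.inl ⟨d, ha, x, .inl hx, rfl⟩),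
        (h d ha).2.subst_eqE hσ hτ fun x hx => hστ _ (.inl ⟨d, ha, x, .inr hx, rfl⟩)⟩)
  · exact hστ _ (.inr ⟨n, ha, rfl⟩)

/-- A complete set of unifiers only provides agreement modulo `E` on finitely many variables; this
converts it into equality of instances. -/
theorem CState.subst_eqE {S : CState G} {s : G.Srt} (h : S.WF s) {σ τ : Subst G}
    (hσ : SortedAssign σ.msg) (hτ : SortedAssign τ.msg) (hστ : ∀ a ∈ S.vars, σ.EqAt E τ a) :
    CState.EqE E (S.subst σ) (S.subst τ) :=
  ⟨StrandSet.subst_eqE h.1 hσ hτ fun a ha => hστ a (.inl (.inl ha)),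
    Know.subst_eqE h.2.1 hσ hτ fun a ha => hστ a (.inl (.inr ha)),
    Store.subst_eqE h.2.2 hσ hτ fun a ha => hστ a (.inr ha)⟩

theorem eqAt_of_eq {σ τ : Subst G} {a : AVar G} (h : match a with
    | .msg x => σ.msg x = τ.msg x
    | .lst n => σ.lst n = τ.lst n
    | .ss n => σ.ss n = τ.ss n
    | .ik n => σ.ik n = τ.ik n
    | .cs n => σ.cs n = τ.cs n) : σ.EqAt E τ a := by
  cases a <;> simp only [Subst.EqAt] at h ⊢ <;> rw [h]
  · exact .refl _
  · exact .refl _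
  · exact .refl _
  · exact .refl _
  · exact .refl _

/-! ### Well-sortedness -/

theorem SMsg.sorted_subst {m : SMsg G} {s : G.Srt} (h : ∀ t ∈ m.terms, HasSort t s)
    {σ : G.Var → Term G} (hσ : SortedAssign σ) : ∀ t ∈ (m.subst σ).terms, HasSort t s := by
  rw [SMsg.terms_subst]
  rintro _ ⟨t, ht, rfl⟩
  exact (h t ht).subst hσ

theorem SList.WF.subst {s : G.Srt} {l : SList G} (h : SList.WF s l) {σ : Subst G}
    (hσ : SortedAssign σ.msg) (hl : ∀ n, SList.WF s (σ.lst n)) : SList.WF s (SList.subst σ l) := by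
  intro m hm
  obtain ⟨a, ha, hm⟩ := List.mem_flatMap.1 hm
  rcases a with m' | n
  · simp only [Sum.elim_inl, List.mem_singleton, Sum.inl.injEq] at hm
    subst hm
    exact SMsg.sorted_subst (h m' ha) hσ
  · exact hl n m hm

theorem Strand.sorted_subst {s : G.Srt} {A : Strand G}
    (h : SList.WF s A.past ∧ SList.WF s A.future) {σ : Subst G}
    (hσ : SortedAssign σ.msg) (hl : ∀ n, SList.WF s (σ.lst n)) :
    SList.WF s (A.subst σ).past ∧ SList.WF s (A.subst σ).future :=
  ⟨h.1.subst hσ hl, h.2.subst hσ hl⟩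

theorem StrandSet.WF.subst {s : G.Srt} {M : StrandSet G} (h : StrandSet.WF s M) {σ : Subst G}
    (hσ : SortedAssign σ.msg) (hl : ∀ n, SList.WF s (σ.lst n))
    (hss : ∀ n, StrandSet.WF s (σ.ss n)) : StrandSet.WF s (StrandSet.subst σ M) := by
  intro A hA
  rcases StrandSet.mem_subst.1 hA with ⟨B, hB, hAB⟩ | ⟨n, -, hA⟩
  · obtain rfl := Sum.inl.inj hAB
    exact Strand.sorted_subst (h B hB) hσ hl
  · exact hss n A hA

theorem Fact.sorted_subst {s : G.Srt} {f : Fact G} (h : HasSort f.term s) {σ : G.Var → Term G}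
    (hσ : SortedAssign σ) : HasSort (f.subst σ).term s := by
  cases f <;> exact h.subst hσ

theorem Know.WF.subst {s : G.Srt} {K : Know G} (h : Know.WF s K) {σ : Subst G}
    (hσ : SortedAssign σ.msg) (hik : ∀ n, Know.WF s (σ.ik n)) : Know.WF s (Know.subst σ K) := by
  intro f hf
  rcases Know.mem_subst.1 hf with ⟨f', hf', e⟩ | ⟨n, -, hf⟩
  · obtain rfl := Sum.inl.inj e
    exact Fact.sorted_subst (h f' hf') hσ
  · exact hik n f hf

theorem Store.WF.subst {s : G.Srt} {Y : Store G} (h : Store.WF s Y) {σ : Subst G}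
    (hσ : SortedAssign σ.msg) (hcs : ∀ n, Store.WF s (σ.cs n)) : Store.WF s (Store.subst σ Y) := by
  intro d hd
  rcases Store.mem_subst.1 hd with ⟨d', hd', e⟩ | ⟨n, -, hd⟩
  · obtain rfl := Sum.inl.inj e
    exact ⟨(h d' hd').1.subst hσ, (h d' hd').2.subst hσ⟩
  · exact hcs n d hd

theorem CState.WF.subst {s : G.Srt} {S : CState G} (h : S.WF s) {σ : Subst G}
    (hσ : σ.IsSubst s) : (S.subst σ).WF s :=
  ⟨h.1.subst hσ.1 hσ.2.1 hσ.2.2.1, h.2.1.subst hσ.1 hσ.2.2.2.1, h.2.2.subst hσ.1 hσ.2.2.2.2.1⟩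

/-! ### Finiteness of the set of variables -/

theorem SList.vars_finite (l : SList G) : (SList.vars l).Finite := by
  refine (l.finite_toSet.biUnion (t := fun a => Sum.elim SMsg.vars (fun n => {AVar.lst n}) a)
    fun a _ => ?_).subset ?_
  · rcases a with m | n
    · exact m.vars_finite
    · exact Set.finite_singleton _
  · rintro a (⟨m, hm, ha⟩ | ⟨n, hn, rfl⟩)
    · exact Set.mem_iUnion₂.2 ⟨.inl m, hm, ha⟩
    · exact Set.mem_iUnion₂.2 ⟨.inr n, hn, rfl⟩

theorem StrandSet.vars_finite (M : StrandSet G) : (StrandSet.vars M).Finite := by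
  refine (M.finite_toSet.biUnion (t := fun a => Sum.elim Strand.vars (fun n => {AVar.ss n}) a)
    fun a _ => ?_).subset ?_
  · rcases a with A | n
    · exact A.past.vars_finite.union A.future.vars_finite
    · exact Set.finite_singleton _
  · rintro a (⟨m, hm, ha⟩ | ⟨n, hn, rfl⟩)
    · exact Set.mem_iUnion₂.2 ⟨.inl m, hm, ha⟩
    · exact Set.mem_iUnion₂.2 ⟨.inr n, hn, rfl⟩

theorem Know.vars_finite (K : Know G) : (Know.vars K).Finite := by
  refine (K.finite_toSet.biUnion
    (t := fun a => Sum.elim (fun f : Fact G => .msg '' f.term.vars) (fun n => {AVar.ik n}) a)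
    fun a _ => ?_).subset ?_
  · rcases a with f | n
    · exact f.term.vars_finite.image _
    · exact Set.finite_singleton _
  · rintro a (⟨f, hf, x, hx, rfl⟩ | ⟨n, hn, rfl⟩)
    · exact Set.mem_iUnion₂.2 ⟨.inl f, hf, ⟨x, hx, rfl⟩⟩
    · exact Set.mem_iUnion₂.2 ⟨.inr n, hn, rfl⟩

theorem Store.vars_finite (Y : Store G) : (Store.vars Y).Finite := by
  refine (Y.finite_toSet.biUnion (t := fun a => Sum.elim
    (fun d : Term G × Term G => .msg '' (d.1.vars ∪ d.2.vars)) (fun n => {AVar.cs n}) a)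
    fun a _ => ?_).subset ?_
  · rcases a with d | n
    · exact (d.1.vars_finite.union d.2.vars_finite).image _
    · exact Set.finite_singleton _
  · rintro a (⟨d, hd, x, hx, rfl⟩ | ⟨n, hn, rfl⟩)
    · exact Set.mem_iUnion₂.2 ⟨.inl d, hd, ⟨x, hx, rfl⟩⟩
    · exact Set.mem_iUnion₂.2 ⟨.inr n, hn, rfl⟩

theorem CState.vars_finite (S : CState G) : S.vars.Finite :=
  ((StrandSet.vars_finite _).union (Know.vars_finite _)).union (Store.vars_finite _)

end SymbolicSubst

/-! ## The lifting relation, componentwise -/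

section Lifting

variable {P : Protocol.{u, v, w, z}}

/-- The strands that have begun. -/
def StrandSet.begun {G : Signature.{u, v, w}} (M : StrandSet G) : Multiset (Strand G) :=
  (M.filterMap Sum.getLeft?).filter fun A => A.past.isEmpty = false

section Begun

variable {G : Signature.{u, v, w}}

@[simp] theorem StrandSet.begun_inr_cons (n : ℕ) (M : StrandSet G) :
    StrandSet.begun (.inr n ::ₘ M) = StrandSet.begun M := by
  unfold StrandSet.begun
  rw [Multiset.filterMap_cons_none _ _ rfl]

theorem StrandSet.begun_inl_cons_of_nil {A : Strand G} (h : A.past = []) (M : StrandSet G) :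
    StrandSet.begun (.inl A ::ₘ M) = StrandSet.begun M := by
  unfold StrandSet.begun
  rw [Multiset.filterMap_cons_some Sum.getLeft? _ _ rfl,
    Multiset.filter_cons_of_neg _ (by simp [h])]

theorem StrandSet.begun_inl_cons_of_ne_nil {A : Strand G} (h : A.past ≠ []) (M : StrandSet G) :
    StrandSet.begun (.inl A ::ₘ M) = A ::ₘ StrandSet.begun M := by
  unfold StrandSet.begun
  rw [Multiset.filterMap_cons_some Sum.getLeft? _ _ rfl,
    Multiset.filter_cons_of_pos _ (by simpa using h)]

theorem StrandSet.begun_add (M M' : StrandSet G) :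
    StrandSet.begun (M + M') = StrandSet.begun M + StrandSet.begun M' := by
  unfold StrandSet.begun
  rw [Multiset.filterMap_add, Multiset.filter_add]

theorem StrandSet.mem_begun {A : Strand G} {M : StrandSet G} :
    A ∈ StrandSet.begun M ↔ .inl A ∈ M ∧ A.past ≠ [] := by
  simp [StrandSet.begun, Multiset.mem_filter, Multiset.mem_filterMap]

/-- When list and strand variables are fixed, empty pasts stay empty, nonempty ones stay nonempty,
and no strand is added. -/
theorem StrandSet.begun_subst {ρ : Subst G} (hl : ρ.lst = Subst.id.lst)
    (hs : ρ.ss = Subst.id.ss) (M : StrandSet G) :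
    StrandSet.begun (StrandSet.subst ρ M) = (StrandSet.begun M).map (Strand.subst ρ) := by
  induction M using Multiset.induction with
  | empty => rfl
  | cons a M ih =>
    rcases a with A | n
    · rw [StrandSet.subst_inl_cons]
      by_cases h : A.past = []
      · rw [begun_inl_cons_of_nil h, begun_inl_cons_of_nil (by simp [Strand.subst, h]), ih]
      · have h' : (A.subst ρ).past ≠ [] := by
          rcases A with ⟨_ | ⟨m | n, p⟩, f⟩
          · exact absurd rfl h
          · simp [Strand.subst]
          · simp [Strand.subst, hl, Subst.id]
        rw [begun_inl_cons_of_ne_nil h, begun_inl_cons_of_ne_nil h', ih, Multiset.map_cons]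
    · rw [subst_inr_cons, begun_inr_cons, hs, begun_add, ih]
      simp [Subst.id, begun]

/-- Only an inequality, since `η` may put further begun strands in place of a strand variable. List
variables in pasts are excluded because they could become empty lists, and a begun strand would be
lost. -/
theorem StrandSet.map_subst_begun_le (η : Subst G) {M : StrandSet G}
    (h : ∀ A, .inl A ∈ M → ∀ a ∈ A.past, ∃ m, a = .inl m) :
    (StrandSet.begun M).map (Strand.subst η) ≤ StrandSet.begun (StrandSet.subst η M) := by
  induction M using Multiset.induction with
  | empty => rfl
  | cons a M ih =>
    have ih' := ih fun A hA => h A (Multiset.mem_cons_of_mem hA)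
    rcases a with A | n
    · have hA := h A (Multiset.mem_cons_self _ _)
      rw [StrandSet.subst_inl_cons]
      rcases A with ⟨_ | ⟨a, p⟩, f⟩
      · rwa [begun_inl_cons_of_nil rfl, begun_inl_cons_of_nil rfl]
      · obtain ⟨m, rfl⟩ := hA a (.head _)
        rw [begun_inl_cons_of_ne_nil (by simp), begun_inl_cons_of_ne_nil (by simp [Strand.subst]),
          Multiset.map_cons]
        exact Multiset.cons_le_cons _ ih'
    · rw [StrandSet.subst_inr_cons, begun_inr_cons, begun_add]
      exact ih'.trans (Multiset.le_add_left _ _)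

/-- Lists are compared position by position, so an empty past equals only an empty past. -/
theorem StrandSet.EqE.begun {E : Set (Term G × Term G)} {M M' : StrandSet G}
    (h : StrandSet.EqE E M M') :
    Multiset.Rel (Strand.EqE E) (StrandSet.begun M) (StrandSet.begun M') := by
  rw [StrandSet.eqE_iff] at h
  induction h with
  | zero => exact .zero
  | cons hab _ ih =>
    cases hab with
    | inl hab =>
      rename_i A B
      by_cases hA : A.past = []
      · have hB : B.past = [] := List.forall₂_nil_left_iff.1 (hA ▸ hab.1)
        rwa [begun_inl_cons_of_nil hA, begun_inl_cons_of_nil hB]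
      · have hB : B.past ≠ [] := fun hB => hA (List.forall₂_nil_right_iff.1 (hB ▸ hab.1))
        rw [begun_inl_cons_of_ne_nil hA, begun_inl_cons_of_ne_nil hB]
        exact .cons hab ih
    | inr _ => simpa using ih

end Begun

/-- The past of the symbolic strand `A`, instantiated by `θ`, is the ground strand `g`. -/
def StrandLift (θ : P.sig.Var → Term P.sig) (A : Strand P.sig) (g : GStrand P) : Prop :=
  List.Forall₂ (fun a m => ∃ m', a = .inl m' ∧ SMsg.EqE P.eqns m (m'.subst θ)) A.past g.msgs

def StrandsLift (M : StrandSet P.sig) (θ : P.sig.Var → Term P.sig) (D : Multiset (GStrand P)) :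
    Prop :=
  ∃ T, T ≤ D ∧ Multiset.Rel (StrandLift θ) (StrandSet.begun M) T

def KnowLift (K : Know P.sig) (θ : P.sig.Var → Term P.sig) (I : Multiset (Term P.sig)) : Prop :=
  (∀ t, .inl (.pos t) ∈ K → ∃ m ∈ I, EqE P.eqns m (t.subst θ)) ∧
  (∀ t, .inl (.neg t) ∈ K → ¬ ∃ m ∈ I, EqE P.eqns m (t.subst θ))

def StoreLift (Y : Store P.sig) (θ : P.sig.Var → Term P.sig) : Prop :=
  ∀ a b, .inl (a, b) ∈ Y → ¬ EqE P.eqns (a.subst θ) (b.subst θ)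

theorem lifts_iff {S : CState P.sig} {θ : P.sig.Var → Term P.sig} {s : GState P} :
    Lifts S θ s ↔ GroundAssign θ ∧ StrandsLift S.strands θ s.strands ∧ KnowLift S.ik θ s.ik ∧
      StoreLift S.store θ := by
  unfold KnowLift
  rw [and_assoc]
  rfl

/-! ### Invariance under equality of symbolic states -/

theorem StrandLift.eqE {θ : P.sig.Var → Term P.sig} (hθ : SortedAssign θ) {A B : Strand P.sig}
    {g : GStrand P} (h : StrandLift θ A g) (hAB : Strand.EqE P.eqns A B) : StrandLift θ B g := by
  obtain ⟨hp, -⟩ := hAB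
  unfold StrandLift at *
  generalize A.past = l at h hp
  generalize B.past = l' at hp ⊢
  unfold SList.EqE at hp
  induction hp generalizing g with
  | nil => exact h
  | @cons a b p p' hab _ ih =>
    rcases g with ⟨ro, i, ms⟩
    cases h with
    | cons ham h =>
      obtain ⟨m', rfl, hm'⟩ := ham
      cases hab with
      | inl hab => exact .cons ⟨_, rfl, hm'.trans (hab.subst hθ)⟩ (ih (g := ⟨ro, i, _⟩) h)

theorem StrandsLift.eqE {θ : P.sig.Var → Term P.sig} (hθ : SortedAssign θ)
    {M M' : StrandSet P.sig} {D : Multiset (GStrand P)} (h : StrandsLift M θ D)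
    (hM : StrandSet.EqE P.eqns M M') : StrandsLift M' θ D := by
  obtain ⟨T, hT, hr⟩ := h
  exact ⟨T, hT, (rel_comp hM.symm.begun hr).mono fun A _ g _ ⟨B, hAB, hB⟩ => hB.eqE hθ hAB.symm⟩

theorem KnowLift.eqE {θ : P.sig.Var → Term P.sig} (hθ : SortedAssign θ)
    {K K' : Know P.sig} {I : Multiset (Term P.sig)} (h : KnowLift K θ I)
    (hK : Know.EqE P.eqns K K') : KnowLift K' θ I := by
  constructor
  · intro t ht
    obtain ⟨a, ha, hat⟩ := hK.2 _ ht
    cases hat with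
    | inl hat =>
      cases hat with
      | pos hat =>
        obtain ⟨m, hm, hmt⟩ := h.1 _ ha
        exact ⟨m, hm, hmt.trans (hat.subst hθ)⟩
  · rintro t ht ⟨m, hm, hmt⟩
    obtain ⟨a, ha, hat⟩ := hK.2 _ ht
    cases hat with
    | inl hat =>
      cases hat with
      | neg hat => exact h.2 _ ha ⟨m, hm, hmt.trans (hat.subst hθ).symm⟩

theorem StoreLift.eqE {θ : P.sig.Var → Term P.sig} (hθ : SortedAssign θ)
    {Y Y' : Store P.sig} (h : StoreLift Y θ) (hY : Store.EqE P.eqns Y Y') : StoreLift Y' θ := by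
  intro a b hab heq
  obtain ⟨c, hc, hcd⟩ := hY.2 _ hab
  cases hcd with
  | inl hcd => exact h _ _ hc (((hcd.1.subst hθ).trans heq).trans (hcd.2.subst hθ).symm)

theorem Lifts.eqE {S S' : CState P.sig} {θ : P.sig.Var → Term P.sig} {s : GState P}
    (h : Lifts S θ s) (hS : CState.EqE P.eqns S S') : Lifts S' θ s := by
  rw [lifts_iff] at *
  exact ⟨h.1, h.2.1.eqE h.1.1 hS.1, h.2.2.1.eqE h.1.1 hS.2.1, h.2.2.2.eqE h.1.1 hS.2.2⟩

/-- The lifting relation is invariant under equality of ground states. -/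
theorem Lifts.of_gstate_eqE {S : CState P.sig} {θ : P.sig.Var → Term P.sig} {s s' : GState P}
    (h : Lifts S θ s') (hs : s.EqE s') : Lifts S θ s := by
  rw [lifts_iff] at *
  obtain ⟨hθ, ⟨T, hT, hr⟩, hk, hst⟩ := h
  refine ⟨hθ, ?_, ⟨fun t ht => ?_, ?_⟩, hst⟩
  -- The counterparts chosen in `s'` are pulled back to distinct occurrences in `s`.
  · obtain ⟨T', hT', hr'⟩ := rel_exists_of_le hs.1 hT
    refine ⟨T', hT', (rel_comp hr (Multiset.rel_flip.2 hr')).mono ?_⟩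
    rintro A - g - ⟨g', hA, -, -, hg⟩
    unfold StrandLift at *
    generalize g.msgs = l at hg ⊢
    generalize A.past = p at hA ⊢
    generalize g'.msgs = l' at hA hg
    clear hT hr hT' hr'
    induction hA generalizing l with
    | nil => rw [List.forall₂_nil_right_iff.1 hg]; exact .nil
    | cons ham _ ih =>
      cases hg with
      | cons hg hgs =>
        obtain ⟨m', rfl, hm'⟩ := ham
        exact .cons ⟨m', rfl, hg.trans hm'⟩ (ih _ hgs)
  · obtain ⟨m, hm, hmt⟩ := hk.1 t ht
    obtain ⟨m', hm', hmm⟩ := hs.2.2 m hm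
    exact ⟨m', hm', hmm.trans hmt⟩
  · rintro t ht ⟨m, hm, hmt⟩
    obtain ⟨m', hm', hmm⟩ := hs.2.1 m hm
    exact hk.2 t ht ⟨m', hm', hmm.symm.trans hmt⟩

/-! ### Removing and applying substitutions -/

theorem StrandLift.of_subst {η : Subst P.sig} {θ : P.sig.Var → Term P.sig} {A : Strand P.sig}
    {g : GStrand P} (hA : ∀ a ∈ A.past, ∃ m, a = .inl m) (h : StrandLift θ (A.subst η) g) :
    StrandLift (fun x => (η.msg x).subst θ) A g := by
  rcases A with ⟨p, f⟩
  rcases g with ⟨ro, i, ms⟩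
  simp only [StrandLift, Strand.subst] at *
  induction p generalizing ms with
  | nil => simpa using h
  | cons a p ih =>
    obtain ⟨m, rfl⟩ := hA a (.head _)
    rw [SList.subst_inl_cons] at h
    cases h with
    | cons ham h =>
      obtain ⟨m', e, hm'⟩ := ham
      obtain rfl := Sum.inl.inj e
      rw [SMsg.subst_subst] at hm'
      exact .cons ⟨m, rfl, hm'⟩ (ih (fun a ha => hA a (.tail _ ha)) _ h)

theorem StrandsLift.of_subst {η : Subst P.sig} {θ : P.sig.Var → Term P.sig} {M : StrandSet P.sig}
    {D : Multiset (GStrand P)} (hM : ∀ A, .inl A ∈ M → ∀ a ∈ A.past, ∃ m, a = .inl m)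
    (h : StrandsLift (StrandSet.subst η M) θ D) :
    StrandsLift M (fun x => (η.msg x).subst θ) D := by
  obtain ⟨T, hT, hr⟩ := h
  obtain ⟨T', hT', hr'⟩ := rel_exists_of_le (Multiset.rel_flip.2 hr)
    (StrandSet.map_subst_begun_le η hM)
  refine ⟨T', hT'.trans hT, ?_⟩
  rw [← Multiset.rel_flip, Multiset.rel_map_left] at hr'
  exact hr'.mono fun A hA g _ h => StrandLift.of_subst (hM A (StrandSet.mem_begun.1 hA).1) h

theorem KnowLift.of_subst {η : Subst P.sig} {θ : P.sig.Var → Term P.sig} {K : Know P.sig}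
    {I : Multiset (Term P.sig)} (h : KnowLift (Know.subst η K) θ I) :
    KnowLift K (fun x => (η.msg x).subst θ) I := by
  constructor
  · intro t ht
    rw [← Term.subst_subst]
    exact h.1 _ (Know.mem_subst.2 (.inl ⟨_, ht, rfl⟩))
  · intro t ht
    rw [← Term.subst_subst]
    exact h.2 _ (Know.mem_subst.2 (.inl ⟨_, ht, rfl⟩))

theorem StoreLift.of_subst {η : Subst P.sig} {θ : P.sig.Var → Term P.sig} {Y : Store P.sig}
    (h : StoreLift (Store.subst η Y) θ) : StoreLift Y (fun x => (η.msg x).subst θ) := by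
  intro a b hab
  rw [← Term.subst_subst, ← Term.subst_subst]
  exact h _ _ (Store.mem_subst.2 (.inl ⟨_, hab, rfl⟩))

/-- Lifting passes from an instance to the more general state: the ground assignment absorbs `η`,
and counterparts for the additional strands of the instance are discarded. This permits replacing a
ground unifier by the procedure's. -/
theorem Lifts.of_subst {η : Subst P.sig} (hη : SortedAssign η.msg) {S : CState P.sig}
    {θ : P.sig.Var → Term P.sig} {s : GState P}
    (hS : ∀ A, .inl A ∈ S.strands → ∀ a ∈ A.past, ∃ m, a = .inl m)
    (h : Lifts (S.subst η) θ s) : Lifts S (fun x => (η.msg x).subst θ) s := by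
  rw [lifts_iff] at *
  exact ⟨⟨hη.comp h.1.1, fun x => Term.ground_subst h.1.2 _⟩, h.2.1.of_subst hS,
    h.2.2.1.of_subst, h.2.2.2.of_subst⟩

/-- `hρ` holds when `ρ` replaces some variables by their ground values under `θ` and fixes the
others; such a `ρ` does not change what `θ` makes of a term. -/
theorem StrandLift.subst {ρ : Subst P.sig} {θ : P.sig.Var → Term P.sig}
    (hρ : (fun x => (ρ.msg x).subst θ) = θ) {A : Strand P.sig} {g : GStrand P}
    (h : StrandLift θ A g) : StrandLift θ (A.subst ρ) g := by
  rcases A with ⟨p, f⟩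
  rcases g with ⟨ro, i, ms⟩
  simp only [StrandLift, Strand.subst] at *
  induction h with
  | nil => exact .nil
  | cons ham _ ih =>
    obtain ⟨m', rfl, hm'⟩ := ham
    exact .cons ⟨_, rfl, by rwa [SMsg.subst_subst, hρ]⟩ ih

theorem StrandsLift.subst {ρ : Subst P.sig} {θ : P.sig.Var → Term P.sig}
    (hρ : (fun x => (ρ.msg x).subst θ) = θ) (hl : ρ.lst = Subst.id.lst)
    (hs : ρ.ss = Subst.id.ss) {M : StrandSet P.sig} {D : Multiset (GStrand P)}
    (h : StrandsLift M θ D) : StrandsLift (StrandSet.subst ρ M) θ D := by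
  obtain ⟨T, hT, hr⟩ := h
  refine ⟨T, hT, ?_⟩
  rw [StrandSet.begun_subst hl hs, Multiset.rel_map_left]
  exact hr.mono fun A _ g _ h => h.subst hρ

theorem StoreLift.subst {ρ : Subst P.sig} {θ : P.sig.Var → Term P.sig}
    (hρ : (fun x => (ρ.msg x).subst θ) = θ) {Y : Store P.sig} (hY : ∀ n, .inr n ∉ Y)
    (h : StoreLift Y θ) : StoreLift (Store.subst ρ Y) θ := by
  intro a b hab
  rcases Store.mem_subst.1 hab with ⟨d, hd, e⟩ | ⟨n, hn, -⟩
  · obtain ⟨rfl, rfl⟩ := Prod.mk.inj (Sum.inl.inj e)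
    rw [Term.subst_subst, Term.subst_subst, hρ]
    exact h _ _ hd
  · exact absurd hn (hY n)

/-- The lifting relation depends only on the values at the variables of the symbolic state. -/
theorem Lifts.congr {S : CState P.sig} {θ θ' : P.sig.Var → Term P.sig} {s : GState P}
    (h : Lifts S θ s) (hθ' : GroundAssign θ') (hθ : ∀ x, .msg x ∈ S.vars → θ x = θ' x) :
    Lifts S θ' s := by
  rw [lifts_iff] at *
  obtain ⟨-, ⟨T, hT, hr⟩, hk, hst⟩ := h
  have hik : ∀ f : Fact P.sig, .inl f ∈ S.ik → f.term.subst θ = f.term.subst θ' := fun f hf =>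
    Term.subst_congr fun x hx => hθ x (.inl (.inr (.inl ⟨f, hf, x, hx, rfl⟩)))
  refine ⟨hθ', ⟨T, hT, hr.mono fun A hA g _ h => ?_⟩, ⟨fun t ht => ?_, fun t ht => ?_⟩,
    fun a b hab => ?_⟩
  · have hA' := (StrandSet.mem_begun.1 hA).1
    have hvars : ∀ m, .inl m ∈ A.past → m.subst θ = m.subst θ' := fun m hm =>
      SMsg.subst_congr fun x hx =>
        hθ x (.inl (.inl (.inl ⟨A, hA', .inl (.inl ⟨m, hm, hx⟩)⟩)))
    unfold StrandLift at *
    generalize A.past = p at h hvars ⊢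
    generalize g.msgs = l at h ⊢
    clear hT hr hA hA'
    induction h with
    | nil => exact .nil
    | cons ham _ ih =>
      obtain ⟨m', rfl, hm'⟩ := ham
      exact .cons ⟨m', rfl, hvars m' (.head _) ▸ hm'⟩ (ih fun m hm => hvars m (.tail _ hm))
  · rw [← show t.subst θ = t.subst θ' from hik (.pos t) ht]
    exact hk.1 t ht
  · rw [← show t.subst θ = t.subst θ' from hik (.neg t) ht]
    exact hk.2 t ht
  · rw [← Term.subst_congr (σ := θ) fun x hx => hθ x (.inr (.inl ⟨_, hab, x, .inl hx, rfl⟩)),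
      ← Term.subst_congr (σ := θ) fun x hx => hθ x (.inr (.inl ⟨_, hab, x, .inr hx, rfl⟩))]
    exact hst a b hab

end Lifting

/-! ## Symbolic states -/

section SymbolicStates

variable {P : Protocol.{u, v, w, z}}

/-- The list is an instance, modulo the equations, of a protocol strand. -/
def IsInstance (P : Protocol.{u, v, w, z}) (l : SList P.sig) : Prop :=
  ∃ ro ms, (ro, ms) ∈ P.strands ∧ ∃ ρ : P.sig.Var → Term P.sig, SortedAssign ρ ∧
    SList.EqE P.eqns ((ms.map (SMsg.subst ρ)).map .inl) l

theorem isSymbolicState_iff {S : CState P.sig} :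
    IsSymbolicState P S ↔ S.WF P.msg ∧
      (∀ A, .inl A ∈ S.strands → IsInstance P (A.past ++ A.future)) ∧
      (∃ n, .inr n ∈ S.strands) ∧ (∃ n, .inr n ∈ S.ik) ∧ (∀ n, .inr n ∉ S.store) := Iff.rfl

/-- Protocol strands contain no list variables, and equality of lists never relates an element to a
variable. -/
theorem IsInstance.exists_inl {l : SList P.sig} (h : IsInstance P l) :
    ∀ a ∈ l, ∃ m, a = .inl m := by
  obtain ⟨ro, ms, -, ρ, -, h⟩ := h
  unfold SList.EqE at h
  generalize ms.map (SMsg.subst ρ) = k at h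
  induction k generalizing l with
  | nil => rw [List.map_nil, List.forall₂_nil_left_iff] at h; simp [h]
  | cons m k ih =>
    cases h with
    | cons hab h =>
      cases hab with
      | inl _ =>
        intro a ha
        rcases List.mem_cons.1 ha with rfl | ha
        · exact ⟨_, rfl⟩
        · exact ih h a ha

theorem IsInstance.subst {l : SList P.sig} (h : IsInstance P l) {σ : Subst P.sig}
    (hσ : SortedAssign σ.msg) : IsInstance P (SList.subst σ l) := by
  obtain ⟨ro, ms, hms, ρ, hρ, h⟩ := h
  refine ⟨ro, ms, hms, _, hρ.comp hσ, ?_⟩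
  have h' := h.subst hσ
  rw [SList.subst_map_inl, List.map_map (g := SMsg.subst σ.msg)] at h'
  rwa [show SMsg.subst σ.msg ∘ SMsg.subst ρ = SMsg.subst fun x => (ρ x).subst σ.msg from
    funext (SMsg.subst_subst _ _)] at h'

theorem IsInstance.eqE {l l' : SList P.sig} (h : IsInstance P l) (hl : SList.EqE P.eqns l l') :
    IsInstance P l' := by
  obtain ⟨ro, ms, hms, ρ, hρ, h⟩ := h
  exact ⟨ro, ms, hms, ρ, hρ, h.trans hl⟩

theorem IsSymbolicState.past_inl {S : CState P.sig} (h : IsSymbolicState P S) :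
    ∀ A, .inl A ∈ S.strands → ∀ a ∈ A.past, ∃ m, a = .inl m := fun A hA a ha =>
  IsInstance.exists_inl (h.2.1 A hA) a (List.mem_append_left _ ha)

theorem IsSymbolicState.eqE {S S' : CState P.sig} (h : IsSymbolicState P S)
    (hS : CState.EqE P.eqns S S') (hS' : S'.WF P.msg) : IsSymbolicState P S' := by
  rw [isSymbolicState_iff] at *
  obtain ⟨-, hA, ⟨n, hn⟩, ⟨n', hn'⟩, hst⟩ := h
  refine ⟨hS', fun B hB => ?_, ⟨n, ?_⟩, ⟨n', ?_⟩, fun k hk => ?_⟩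
  · obtain ⟨a, ha, hab⟩ := rel_exists_left hS.1 hB
    cases hab with
    | inl hab => exact (hA _ ha).eqE (hab.1.append hab.2)
  · obtain ⟨b, hb, hab⟩ := Multiset.exists_mem_of_rel_of_mem hS.1 hn
    cases hab with
    | inr e => exact e ▸ hb
  · obtain ⟨b, hb, hab⟩ := hS.2.1.1 _ hn'
    cases hab with
    | inr e => exact e ▸ hb
  · obtain ⟨a, ha, hab⟩ := hS.2.2.2 _ hk
    cases hab with
    | inr e => exact hst _ ha

/-- A strand put in place of a strand variable need not be an instance of a protocol strand, so
`hss` forbids it. Added facts only have to be well-sorted, so `hik` merely asks that a variable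
survive. -/
theorem IsSymbolicState.subst {S : CState P.sig} (h : IsSymbolicState P S) {σ : Subst P.sig}
    (hσ : σ.IsSubst P.msg)
    (hss : ∀ n, .ss n ∈ S.vars → (∃ k, .inr k ∈ σ.ss n) ∧ ∀ A, .inl A ∉ σ.ss n)
    (hik : ∀ n, .ik n ∈ S.vars → ∃ k, .inr k ∈ σ.ik n) : IsSymbolicState P (S.subst σ) := by
  rw [isSymbolicState_iff] at *
  obtain ⟨hwf, hA, ⟨n, hn⟩, ⟨n', hn'⟩, hst⟩ := h
  have hvar : ∀ n, .inr n ∈ S.strands → .ss n ∈ S.vars := fun n hn =>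
    .inl (.inl (.inr ⟨n, hn, rfl⟩))
  refine ⟨hwf.subst hσ, fun B hB => ?_, ?_, ?_, fun k hk => ?_⟩
  · rcases StrandSet.mem_subst.1 hB with ⟨A, hAS, e⟩ | ⟨n, hn, hB⟩
    · obtain rfl := Sum.inl.inj e
      simp only [Strand.subst, ← SList.subst_append]
      exact (hA A hAS).subst hσ.1
    · exact absurd hB ((hss n (hvar n hn)).2 B)
  · obtain ⟨k, hk⟩ := (hss n (hvar n hn)).1
    exact ⟨k, StrandSet.mem_subst.2 (.inr ⟨n, hn, hk⟩)⟩
  · obtain ⟨k, hk⟩ := hik n' (.inl (.inr (.inr ⟨n', hn', rfl⟩)))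
    exact ⟨k, Know.mem_subst.2 (.inr ⟨n', hn', hk⟩)⟩
  · rcases Store.mem_subst.1 hk with ⟨d, hd, e⟩ | ⟨n, hn, -⟩
    · cases e
    · exact hst n hn

end SymbolicStates

section Narrowing

variable {P : Protocol.{u, v, w, z}}

theorem IsSymbolicState.of_imp {S S' : CState P.sig} (h : IsSymbolicState P S) (hwf : S'.WF P.msg)
    (hA : ∀ A, .inl A ∈ S'.strands → .inl A ∈ S.strands ∨ IsInstance P (A.past ++ A.future))
    (hss : ∀ n, .inr n ∈ S.strands → .inr n ∈ S'.strands)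
    (hik : ∀ n, .inr n ∈ S.ik → .inr n ∈ S'.ik)
    (hcs : ∀ n, .inr n ∈ S'.store → .inr n ∈ S.store) : IsSymbolicState P S' := by
  rw [isSymbolicState_iff] at *
  obtain ⟨-, hA', ⟨n, hn⟩, ⟨n', hn'⟩, hst⟩ := h
  exact ⟨hwf, fun A h => (hA A h).elim (hA' A) id, ⟨n, hss n hn⟩, ⟨n', hik n' hn'⟩,
    fun n hn => hst n (hcs n hn)⟩

/-! ## The backwards rules -/

theorem hasSort_var {G : Signature.{u, v, w}} {x : G.Var} {s : G.Srt} (h : G.varSort x = s) :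
    HasSort (.var x) s := .var x s h.le

theorem BRule.wf {l r : CState P.sig} {c : Subst P.sig → Prop} (h : BRule l r c) :
    l.WF P.msg ∧ r.WF P.msg := by
  cases h with
  | newStrand SS IK Y ro ms l₁ l₂ t ξ hms hinj hsort heq =>
    have hs : ∀ m ∈ l₁ ++ .send t :: l₂, ∀ t ∈ m.terms, HasSort t P.msg := by
      rw [← heq]
      intro m hm
      obtain ⟨m', hm', rfl⟩ := List.mem_map.1 hm
      exact SMsg.sorted_subst (P.strands_sorted _ hms m' hm') fun x => hasSort_var (hsort x)
    have ht : HasSort t P.msg := hs (.send t) (by simp) t rfl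
    refine ⟨⟨?_, ?_, ?_⟩, ⟨?_, ?_, ?_⟩⟩ <;>
      simp [StrandSet.WF, SList.WF, Know.WF, Store.WF, Fact.term, ht]
    exact ⟨fun m hm => hs m (by simp [hm]), by simpa [SMsg.terms] using ht,
      fun m hm => hs m (by simp [hm])⟩
  | _ =>
    refine ⟨⟨?_, ?_, ?_⟩, ⟨?_, ?_, ?_⟩⟩ <;>
      simp_all [StrandSet.WF, SList.WF, Know.WF, Store.WF, Fact.term, SMsg.terms, hasSort_var]

/-- Moving the bar leaves the concatenation of past and future unchanged, and an introduced strand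
is a renamed protocol strand; the remaining strands already occur on the left. -/
theorem BRule.isSymbolicState {l r : CState P.sig} {c : Subst P.sig → Prop} (h : BRule l r c)
    {σ : Subst P.sig} (hσ : σ.IsSubst P.msg) (hl : IsSymbolicState P (l.subst σ)) :
    IsSymbolicState P (r.subst σ) := by
  have hwf : (r.subst σ).WF P.msg := h.wf.2.subst hσ
  refine hl.of_imp hwf ?_ ?_ ?_ ?_
  · cases h with
    | newStrand SS IK Y ro ms l₁ l₂ t ξ hms hinj hsort heq =>
      intro A hA
      simp only [CState.subst, Multiset.insert_eq_cons, StrandSet.subst_inr_cons,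
        StrandSet.subst_inl, Multiset.mem_add, Multiset.mem_singleton, Sum.inl.injEq] at hA
      refine hA.imp (by simp [CState.subst]) ?_
      rintro rfl
      simp only [Strand.subst, ← SList.subst_append, ← List.map_append, ← heq]
      refine IsInstance.subst ⟨ro, ms, hms, _, fun x => hasSort_var (hsort x), .refl _⟩ hσ.1
    | _ =>
      intro A hA
      simp only [CState.subst, Multiset.insert_eq_cons, StrandSet.subst_inr_cons,
        StrandSet.subst_inl, Multiset.mem_add, Multiset.mem_singleton, Sum.inl.injEq] at hA
      refine hA.imp (by simp +contextual [CState.subst]) ?_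
      rintro rfl
      have hl' := (isSymbolicState_iff.1 hl).2.1
      simp only [CState.subst, Multiset.insert_eq_cons, StrandSet.subst_inr_cons,
        StrandSet.subst_inl, Multiset.mem_add, Multiset.mem_singleton] at hl'
      have hi := hl' _ (.inr rfl)
      simpa [Strand.subst] using hi
  · cases h <;> simp +contextual [CState.subst]
  · cases h <;> simp +contextual [CState.subst]
  · cases h <;> simp +contextual [CState.subst]

/-- The assignment under which `r.subst σ` lifts a ground state satisfies every disequality in the
store, the new one included, so it witnesses satisfiability. -/
theorem BRule.condition {l r : CState P.sig} {c : Subst P.sig → Prop} (h : BRule l r c)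
    {σ : Subst P.sig} {θ : P.sig.Var → Term P.sig} {s : GState P} (hl : Lifts (r.subst σ) θ s) :
    c σ := by
  cases h with
  | condNe => exact ⟨θ, hl.1.1, fun d hd => hl.2.2.2.2 d.1 d.2 hd⟩
  | _ => trivial

/-! ## Lifting a narrowing step -/

/-- A unifier `ρ` of a symbolic state and the left-hand side of a rule that leads to a lifting of
`q` can be replaced by a unifier from the complete set. -/
theorem exists_narrowStep {csu : CState P.sig → CState P.sig → Set (AVar P.sig) →
      Set (Subst P.sig)} (hcsu : IsUnificationProcedure P csu) {S : CState P.sig}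
    (hS : IsSymbolicState P S) {W : Set (AVar P.sig)} (hW : W.Finite) (hSW : S.vars ⊆ W)
    {l r : CState P.sig} {c : Subst P.sig → Prop} (hr : BRule l r c)
    (hdisj : Disjoint (l.vars ∪ r.vars) W) {ρ : Subst P.sig} (hρ : ρ.IsSubst P.msg)
    (hu : CState.EqE P.eqns (S.subst ρ) (l.subst ρ))
    (hss : ∀ n, .ss n ∈ S.vars → ρ.ss n = {.inr n})
    (hik : ∀ n, .ik n ∈ S.vars → .inr n ∈ ρ.ik n)
    {θ : P.sig.Var → Term P.sig} {q : GState P} (hl : Lifts (r.subst ρ) θ q) :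
    ∃ (S' : CState P.sig) (μ : Subst P.sig) (θ' : P.sig.Var → Term P.sig),
      NarrowStep csu W S μ S' ∧ IsSymbolicState P S' ∧ Lifts S' θ' q := by
  -- Agreement with `ρ` is also needed on variables of `r` that do not occur in `l`, such as those
  -- of an introduced protocol strand.
  have hfin : (W ∪ (l.vars ∪ r.vars)).Finite :=
    hW.union (l.vars_finite.union r.vars_finite)
  have hcs := hcsu S l _ hfin
    (Set.union_subset (hSW.trans Set.subset_union_left)
      (Set.subset_union_left.trans Set.subset_union_right))
  obtain ⟨σ, hσ, η, hη, hat⟩ := hcs.complete ρ hρ hu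
  obtain ⟨hσs, hσu⟩ := hcs.unifier σ hσ
  have hSσ : IsSymbolicState P (S.subst σ) := by
    refine hS.subst hσs (fun n hn => ?_) fun n hn => ?_
    -- What `η` makes of `σ.ss n` is a single variable, so `σ.ss n` contains no strand and is not
    -- empty.
    · have h : StrandSet.EqE P.eqns (StrandSet.subst η (σ.ss n)) {.inr n} := by
        rw [← hss n hn]
        exact hat (.ss n) (.inl (hSW hn))
      have hA : ∀ A, .inl A ∉ σ.ss n := fun A hA => by
        obtain ⟨b, hb, hab⟩ := Multiset.exists_mem_of_rel_of_mem h
          (StrandSet.mem_subst.2 (.inl ⟨A, hA, rfl⟩))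
        rw [Multiset.mem_singleton] at hb
        subst hb
        cases hab
      refine ⟨?_, hA⟩
      obtain ⟨a, ha, -⟩ := rel_exists_left h (Multiset.mem_singleton_self _)
      rcases StrandSet.mem_subst.1 ha with ⟨A, hA', -⟩ | ⟨k, hk, -⟩
      · exact absurd hA' (hA A)
      · exact ⟨k, hk⟩
    -- A variable in the value of `ρ` can only come from a variable in the value of `σ`.
    · have h : Know.EqE P.eqns (Know.subst η (σ.ik n)) (ρ.ik n) := hat (.ik n) (.inl (hSW hn))
      obtain ⟨a, ha, hab⟩ := h.2 _ (hik n hn)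
      rcases Know.mem_subst.1 ha with ⟨f, -, rfl⟩ | ⟨k, hk, -⟩
      · cases hab
      · exact ⟨k, hk⟩
  have hr' : IsSymbolicState P (r.subst σ) :=
    hr.isSymbolicState hσs (hSσ.eqE hσu (hr.wf.1.subst hσs))
  have hlift : Lifts ((r.subst σ).subst η) θ q := by
    rw [CState.subst_subst]
    exact hl.eqE (CState.subst_eqE hr.wf.2 (hσs.1.comp hη.1) hρ.1
      fun a ha => hat a (.inr (.inr ha))).symm
  have hlift' := hlift.of_subst hη.1 hr'.past_inl
  exact ⟨_, _, _, ⟨hW, hSW, l, r, c, σ, hr, hdisj, hσ, hr.condition hlift', rfl, rfl⟩, hr',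
    hlift'⟩

end Narrowing

/-! ## New variables -/

section Fresh

variable {G : Signature.{u, v, w}}

theorem exists_new_nat {f : ℕ → AVar G} (hf : Function.Injective f) {W : Set (AVar G)}
    (hW : W.Finite) : ∃ n, f n ∉ W :=
  (hW.preimage hf.injOn).exists_notMem

theorem exists_new_var (s : G.Srt) {W : Set (AVar G)} (hW : W.Finite) :
    ∃ x, G.varSort x = s ∧ .msg x ∉ W := by
  have hf : (AVar.msg ⁻¹' W : Set G.Var).Finite :=
    hW.preimage fun _ _ _ _ h => AVar.msg.inj h
  obtain ⟨x, hx, hx'⟩ := ((G.infinite_vars s).sdiff hf).nonempty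
  exact ⟨x, hx, hx'⟩

/-- The variables of `F` are renamed one at a time, each to a variable of its own sort outside `W`
and outside the images already in use. -/
theorem exists_renaming {F : Set G.Var} (hF : F.Finite) {W : Set (AVar G)} (hW : W.Finite) :
    ∃ ξ : G.Var → G.Var, Set.InjOn ξ F ∧ (∀ x, G.varSort (ξ x) = G.varSort x) ∧
      ∀ x ∈ F, .msg (ξ x) ∉ W := by
  classical
  induction F, hF using Set.Finite.induction_on with
  | empty => exact ⟨id, by simp, fun _ => rfl, by simp⟩
  | @insert a F ha hF ih =>
    obtain ⟨ξ, hi, hs, hn⟩ := ih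
    obtain ⟨y, hy, hyW⟩ := exists_new_var (G.varSort a)
      (hW.union ((hF.image ξ).image AVar.msg))
    have hyF : y ∉ ξ '' F := fun h => hyW (.inr ⟨y, h, rfl⟩)
    have hne : ∀ x ∈ F, x ≠ a := fun x hx e => ha (e ▸ hx)
    refine ⟨Function.update ξ a y, ?_, fun x => ?_, fun x hx => ?_⟩
    · rw [Set.injOn_insert ha]
      refine ⟨fun x hx x' hx' e => hi hx hx' ?_, ?_⟩
      · rwa [Function.update_of_ne (hne x hx), Function.update_of_ne (hne x' hx')] at e
      · rw [Function.update_self]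
        rintro ⟨x, hx, e⟩
        rw [Function.update_of_ne (hne x hx)] at e
        exact hyF ⟨x, hx, e⟩
    · by_cases h : x = a
      · subst h; rw [Function.update_self, hy]
      · rw [Function.update_of_ne h, hs]
    · rcases hx with rfl | hx
      · rw [Function.update_self]
        exact fun h => hyW (.inl h)
      · rw [Function.update_of_ne (hne x hx)]
        exact hn x hx

/-- Names of variables for lists, strands, facts and constraints that do not occur in `W`. -/
structure NewNames (W : Set (AVar G)) (L L' SS IK Y : ℕ) : Prop where
  ne : L ≠ L'
  lst : .lst L ∉ W
  lst' : .lst L' ∉ W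
  ss : .ss SS ∉ W
  ik : .ik IK ∉ W
  cs : .cs Y ∉ W

theorem exists_newNames {W : Set (AVar G)} (hW : W.Finite) :
    ∃ L L' SS IK Y, NewNames W L L' SS IK Y := by
  have hl : Function.Injective (AVar.lst (G := G)) := fun _ _ h => AVar.lst.inj h
  obtain ⟨L, hL⟩ := exists_new_nat hl hW
  obtain ⟨L', hL'⟩ := exists_new_nat hl (hW.insert (AVar.lst L))
  obtain ⟨SS, hSS⟩ := exists_new_nat (f := AVar.ss) (fun _ _ h => AVar.ss.inj h) hW
  obtain ⟨IK, hIK⟩ := exists_new_nat (f := AVar.ik) (fun _ _ h => AVar.ik.inj h) hW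
  obtain ⟨Y, hY⟩ := exists_new_nat (f := AVar.cs) (fun _ _ h => AVar.cs.inj h) hW
  exact ⟨L, L', SS, IK, Y, fun e => hL' (.inl (e ▸ rfl)), hL, fun h => hL' (.inr h), hSS, hIK, hY⟩

end Fresh

/-! ## Ground unifiers -/

section GroundUnifiers

variable {P : Protocol.{u, v, w, z}}

/-- `ρ₀` instantiates the message variables in `W` by `θ` and those in `V` by `τ`, adds the
facts `X` to the variable `n₀` for sets of facts, and leaves other collections unchanged;
`ϑ` is a ground assignment with these values. -/
structure IsInstantiation (W : Set (AVar P.sig)) (V : Set P.sig.Var)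
    (θ τ ϑ : P.sig.Var → Term P.sig) (n₀ : ℕ) (X : Know P.sig) (ρ₀ : Subst P.sig) : Prop where
  ground : GroundAssign ϑ
  eq_old : ∀ x, .msg x ∈ W → θ x = ϑ x
  subst_eq : (fun x => (ρ₀.msg x).subst ϑ) = ϑ
  msg_old : ∀ x, .msg x ∈ W → ρ₀.msg x = θ x
  msg_new : ∀ x ∈ V, ρ₀.msg x = τ x
  lst : ρ₀.lst = Subst.id.lst
  ss : ρ₀.ss = Subst.id.ss
  ik : ρ₀.ik = Function.update Subst.id.ik n₀ (.inr n₀ ::ₘ X)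
  isSubst : ρ₀.IsSubst P.msg

theorem isSubst_id (s : P.sig.Srt) : (Subst.id : Subst P.sig).IsSubst s := by
  refine ⟨sortedAssign_var, fun n m hm => ?_, fun n A hA => ?_, fun n f hf => ?_, fun n d hd => ?_,
    ?_⟩
  · simp [Subst.id] at hm
  · simp [Subst.id] at hA
  · simp [Subst.id] at hf
  · simp [Subst.id] at hd
  · convert Set.finite_empty
    ext a
    cases a <;> simp [Subst.dom]

/-- Take `ϑ` to be `θ` on `W` and `τ` elsewhere, and let `ρ₀` agree with it on `W` and `V`. The
values are ground, so `ρ₀` followed by `ϑ` is `ϑ` again. -/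
theorem exists_isInstantiation {W : Set (AVar P.sig)} (hW : W.Finite) {V : Set P.sig.Var}
    (hV : V.Finite) (hVW : ∀ x ∈ V, .msg x ∉ W) {θ τ : P.sig.Var → Term P.sig}
    (hθ : GroundAssign θ) (hτ : GroundAssign τ) (n₀ : ℕ) {X : Know P.sig} (hX : X.WF P.msg) :
    ∃ ϑ ρ₀, IsInstantiation W V θ τ ϑ n₀ X ρ₀ := by
  classical
  let ϑ : P.sig.Var → Term P.sig := fun x => if .msg x ∈ W then θ x else τ x
  have hϑ : GroundAssign ϑ := by
    refine ⟨fun x => ?_, fun x => ?_⟩ <;> dsimp only [ϑ] <;> split_ifs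
    exacts [hθ.1 x, hτ.1 x, hθ.2 x, hτ.2 x]
  -- The identity outside `W` and `V` keeps the domain finite.
  let m : P.sig.Var → Term P.sig := fun x => if .msg x ∈ W ∨ x ∈ V then ϑ x else .var x
  let ρ₀ : Subst P.sig :=
    { Subst.id with msg := m, ik := Function.update Subst.id.ik n₀ (.inr n₀ ::ₘ X) }
  have hid := isSubst_id (P := P) P.msg
  refine ⟨ϑ, ρ₀, hϑ, fun x hx => (if_pos hx).symm, funext fun x => ?_, fun x hx => ?_,
    fun x hx => ?_, rfl, rfl, rfl, fun x => ?_, hid.2.1, hid.2.2.1, fun n => ?_, hid.2.2.2.2.1, ?_⟩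
  · by_cases h : .msg x ∈ W ∨ x ∈ V
    · simp only [ρ₀, m, if_pos h, (hϑ.2 x).subst]
    · simp only [ρ₀, m, if_neg h, Term.subst]
  · simp [ρ₀, m, ϑ, hx]
  · simp [ρ₀, m, ϑ, hx, hVW x hx]
  · simp only [ρ₀, m]
    split_ifs
    exacts [hϑ.1 x, sortedAssign_var x]
  · by_cases h : n = n₀
    · subst h
      simp only [ρ₀, Function.update_self]
      intro f hf
      exact hX f (by simpa using hf)
    · simp only [ρ₀, Function.update_of_ne h]
      exact hid.2.2.2.1 n
  · refine ((hW.union (hV.image AVar.msg)).insert (AVar.ik n₀)).subset ?_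
    rintro (x | n | n | n | n) h
    · by_cases hx : .msg x ∈ W ∨ x ∈ V
      · exact .inr (hx.imp id fun hx => ⟨x, hx, rfl⟩)
      · exact absurd (if_neg hx) h
    · exact absurd rfl h
    · exact absurd rfl h
    · by_cases hn : n = n₀
      · exact .inl (hn ▸ rfl)
      · exact absurd (Function.update_of_ne hn _ _) h
    · exact absurd rfl h

/-- Change the values at one variable for sets of strands, sets of facts and constraints,
and at two variables for lists. -/
def Subst.extend {G : Signature.{u, v, w}} (ρ : Subst G) (L L' SS IK Y : ℕ) (p f : SList G)
    (M : StrandSet G) (K : Know G) (D : Store G) : Subst G :=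
  ⟨ρ.msg, Function.update (Function.update ρ.lst L p) L' f, Function.update ρ.ss SS M,
    Function.update ρ.ik IK K, Function.update ρ.cs Y D⟩

theorem forall_update {ι : Type*} [DecidableEq ι] {β : ι → Type*} {Q : ∀ n, β n → Prop}
    {f : ∀ n, β n} {k : ι} {b : β k} (hb : Q k b) (hf : ∀ n, Q n (f n)) (n : ι) :
    Q n (Function.update f k b n) := by
  by_cases h : n = k
  · subst h; rwa [Function.update_self]
  · rw [Function.update_of_ne h]; exact hf n

theorem Subst.IsSubst.extend {G : Signature.{u, v, w}} {s : G.Srt} {ρ : Subst G}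
    (h : ρ.IsSubst s) (L L' SS IK Y : ℕ) {p f : SList G}
    {M : StrandSet G} {K : Know G} {D : Store G} (hp : p.WF s) (hf : f.WF s) (hM : M.WF s)
    (hK : K.WF s) (hD : D.WF s) : (ρ.extend L L' SS IK Y p f M K D).IsSubst s := by
  obtain ⟨h1, h2, h3, h4, h5, h6⟩ := h
  refine ⟨h1, forall_update hf (forall_update hp h2), forall_update hM h3, forall_update hK h4,
    forall_update hD h5, ?_⟩
  refine (h6.union (Set.toFinite {.lst L, .lst L', .ss SS, .ik IK, .cs Y})).subset ?_
  rintro (x | n | n | n | n) h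
  · exact .inl h
  · by_cases hn : n = L'
    · simp [hn]
    by_cases hn' : n = L
    · simp [hn']
    refine .inl fun e => h ?_
    simpa [Subst.extend, hn, hn'] using e
  · by_cases hn : n = SS
    · simp [hn]
    refine .inl fun e => h ?_
    simpa [Subst.extend, hn] using e
  · by_cases hn : n = IK
    · simp [hn]
    refine .inl fun e => h ?_
    simpa [Subst.extend, hn] using e
  · by_cases hn : n = Y
    · simp [hn]
    refine .inl fun e => h ?_
    simpa [Subst.extend, hn] using e

theorem NewNames.eqAt_extend {G : Signature.{u, v, w}} {E : Set (Term G × Term G)}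
    {W : Set (AVar G)} {L L' SS IK Y : ℕ}
    (h : NewNames W L L' SS IK Y) (ρ : Subst G) {p f : SList G}
    {M : StrandSet G} {K : Know G} {D : Store G} :
    ∀ a ∈ W, ρ.EqAt E (ρ.extend L L' SS IK Y p f M K D) a := by
  rintro (x | n | n | n | n) ha <;> apply eqAt_of_eq <;> simp only [Subst.extend]
  · have hn : n ≠ L' := by rintro rfl; exact h.lst' ha
    have hn' : n ≠ L := by rintro rfl; exact h.lst ha
    rw [Function.update_of_ne hn, Function.update_of_ne hn']
  · have hn : n ≠ SS := by rintro rfl; exact h.ss ha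
    rw [Function.update_of_ne hn]
  · have hn : n ≠ IK := by rintro rfl; exact h.ik ha
    rw [Function.update_of_ne hn]
  · have hn : n ≠ Y := by rintro rfl; exact h.cs ha
    rw [Function.update_of_ne hn]

/-! ### Intruder facts -/

theorem KnowLift.add {K K' : Know P.sig} {θ : P.sig.Var → Term P.sig} {I : Multiset (Term P.sig)}
    (h : KnowLift K θ I) (h' : KnowLift K' θ I) : KnowLift (K + K') θ I :=
  ⟨fun t ht => (Multiset.mem_add.1 ht).elim (h.1 t) (h'.1 t),
    fun t ht => (Multiset.mem_add.1 ht).elim (h.2 t) (h'.2 t)⟩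

theorem KnowLift.subst {ρ : Subst P.sig} {θ : P.sig.Var → Term P.sig}
    {K : Know P.sig} {I : Multiset (Term P.sig)}
    (h : KnowLift K (fun x => (ρ.msg x).subst θ) I)
    (hρ : ∀ n, .inr n ∈ K → KnowLift (ρ.ik n) θ I) : KnowLift (Know.subst ρ K) θ I := by
  constructor <;> intro t ht <;> rcases Know.mem_subst.1 ht with ⟨f | f, hf, e⟩ | ⟨n, hn, hf⟩
  · obtain rfl := Fact.pos.inj (Sum.inl.inj e)
    rw [Term.subst_subst]
    exact h.1 f hf
  · cases e
  · exact (hρ n hn).1 t hf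
  · cases e
  · obtain rfl := Fact.neg.inj (Sum.inl.inj e)
    rw [Term.subst_subst]
    exact h.2 f hf
  · exact (hρ n hn).2 t hf

theorem Fact.subst_congr {G : Signature.{u, v, w}} {σ τ : G.Var → Term G} {f : Fact G}
    (h : ∀ x ∈ f.term.vars, σ x = τ x) : f.subst σ = f.subst τ := by
  cases f <;> exact congrArg _ (Term.subst_congr h)

variable {W : Set (AVar P.sig)} {V : Set P.sig.Var} {θ τ ϑ : P.sig.Var → Term P.sig} {n₀ : ℕ}
  {X : Know P.sig} {ρ₀ : Subst P.sig}

/-- Facts form sets, so `K` need not split exactly into `F` and `K'`: several facts of `K` may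
collapse to one of `F`, a fact may be kept in `K'` and matched by `F` as well, and a fact of `F`
without a partner in `K` is supplied by `X` through the variable `n₀`. -/
theorem IsInstantiation.know_eqE (h : IsInstantiation W V θ τ ϑ n₀ X ρ₀) {K K' : Know P.sig}
    (hKW : K.vars ⊆ W) (hn₀ : .inr n₀ ∈ K) (hK' : K' ⊆ K) (hK'' : ∀ n, .inr n ∈ K → .inr n ∈ K')
    {F : Multiset (Fact P.sig)} (hFV : ∀ f ∈ F, f.term.vars ⊆ V)
    (hF : ∀ f ∈ F, (∃ f', .inl f' ∈ K ∧ Fact.EqE P.eqns (f'.subst θ) (f.subst τ)) ∨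
      .inl (f.subst τ) ∈ X)
    (hF' : ∀ f', .inl f' ∈ K → .inl f' ∈ K' ∨
      ∃ f ∈ F, Fact.EqE P.eqns (f'.subst θ) (f.subst τ)) {ρ : Subst P.sig} {IK : ℕ}
    (hρ : ρ.msg = ρ₀.msg) (hIK : ρ.ik IK = Know.subst ρ₀ K') :
    Know.EqE P.eqns (Know.subst ρ₀ K) (Know.subst ρ (F.map .inl + {.inr IK})) := by
  have hold : ∀ f, .inl f ∈ K → f.subst ρ₀.msg = f.subst θ := fun f hf =>
    Fact.subst_congr fun x hx => h.msg_old x (hKW (.inl ⟨f, hf, x, hx, rfl⟩))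
  have hnew : ∀ f ∈ F, f.subst ρ₀.msg = f.subst τ := fun f hf =>
    Fact.subst_congr fun x hx => h.msg_new x (hFV f hf hx)
  rw [Know.subst_add, Know.subst_inr, hIK]
  constructor
  · intro a ha
    rcases Know.mem_subst.1 ha with ⟨f', hf', rfl⟩ | ⟨n, hn, ha'⟩
    · rcases hF' f' hf' with hK | ⟨f, hf, he⟩
      · exact ⟨_, Multiset.mem_add.2 (.inr (Know.mem_subst.2 (.inl ⟨f', hK, rfl⟩))),
          liftRel_refl Fact.EqE.refl _⟩
      · refine ⟨.inl (f.subst ρ.msg), Multiset.mem_add.2 (.inl (Know.mem_subst.2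
          (.inl ⟨f, Multiset.mem_map_of_mem _ hf, rfl⟩))), .inl ?_⟩
        rwa [hρ, hold f' hf', hnew f hf]
    · exact ⟨a, Multiset.mem_add.2 (.inr (Know.mem_subst.2 (.inr ⟨n, hK'' n hn, ha'⟩))),
        liftRel_refl Fact.EqE.refl _⟩
  · intro b hb
    rcases Multiset.mem_add.1 hb with hb | hb
    · rcases Know.mem_subst.1 hb with ⟨f₁, hf₁, rfl⟩ | ⟨n, hn, -⟩
      · obtain ⟨f, hf, e⟩ := Multiset.mem_map.1 hf₁
        obtain rfl := Sum.inl.inj e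
        rw [hρ, hnew f hf]
        rcases hF f hf with ⟨f', hf', he⟩ | hX
        · exact ⟨_, Know.mem_subst.2 (.inl ⟨f', hf', rfl⟩), .inl (by rwa [hold f' hf'])⟩
        · refine ⟨_, Know.mem_subst.2 (.inr ⟨n₀, hn₀, ?_⟩), liftRel_refl Fact.EqE.refl _⟩
          rw [h.ik, Function.update_self]
          exact Multiset.mem_cons_of_mem hX
      · simp at hn
    · refine ⟨b, Know.mem_subst.2 ?_, liftRel_refl Fact.EqE.refl _⟩
      exact (Know.mem_subst.1 hb).imp (fun ⟨f, hf, e⟩ => ⟨f, hK' hf, e⟩)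
        fun ⟨n, hn, e⟩ => ⟨n, hK' hn, e⟩

/-- On the rule's own facts, `ρ` followed by `ϑ` is `τ`; the facts `X` that enter through `n₀` are
true under every assignment. -/
theorem IsInstantiation.knowLift (h : IsInstantiation W V θ τ ϑ n₀ X ρ₀) (hτ : GroundAssign τ)
    {K' : Know P.sig} {I : Multiset (Term P.sig)} (hK' : KnowLift K' ϑ I)
    (hX : ∀ ϑ, KnowLift X ϑ I)
    {F : Multiset (Fact P.sig)} (hFV : ∀ f ∈ F, f.term.vars ⊆ V)
    (hF : KnowLift (F.map .inl) τ I) {ρ : Subst P.sig} {IK : ℕ}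
    (hρ : ρ.msg = ρ₀.msg) (hIK : ρ.ik IK = Know.subst ρ₀ K') :
    KnowLift (Know.subst ρ (F.map .inl + {.inr IK})) ϑ I := by
  rw [Know.subst_add, Know.subst_inr, hIK]
  refine KnowLift.add (KnowLift.subst ?_ fun n hn => ?_) (KnowLift.subst ?_ fun n hn => ?_)
  · have heq : ∀ f ∈ F, f.term.subst (fun x => (ρ.msg x).subst ϑ) = f.term.subst τ := fun f hf =>
      Term.subst_congr fun x hx => by rw [hρ, h.msg_new x (hFV f hf hx), (hτ.2 x).subst]
    constructor <;> intro t ht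
    · obtain ⟨f, hf, e⟩ := Multiset.mem_map.1 ht
      obtain rfl := Sum.inl.inj e
      exact (heq _ hf) ▸ hF.1 t ht
    · obtain ⟨f, hf, e⟩ := Multiset.mem_map.1 ht
      obtain rfl := Sum.inl.inj e
      exact (heq _ hf) ▸ hF.2 t ht
  · simp at hn
  · rwa [h.subst_eq]
  · rw [h.ik]
    refine forall_update (Q := fun _ K => KnowLift K ϑ I) ?_ (fun n => ?_) n
    · exact ⟨fun t ht => (hX ϑ).1 t (by simpa using ht), fun t ht => (hX ϑ).2 t (by simpa using ht)⟩
    · constructor <;> intro t ht <;> simp [Subst.id] at ht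

end GroundUnifiers

/-! ### Narrowing steps from ground unifiers -/

section Rules

variable {P : Protocol.{u, v, w, z}}

/-- Lifting reads only the pasts, whereas moving the bar changes the future too. -/
theorem StrandsLift.change_future {p f f' : SList P.sig} {M : StrandSet P.sig}
    {θ : P.sig.Var → Term P.sig} {D : Multiset (GStrand P)}
    (h : StrandsLift (.inl ⟨p, f⟩ ::ₘ M) θ D) : StrandsLift (.inl ⟨p, f'⟩ ::ₘ M) θ D := by
  by_cases hp : p = []
  · unfold StrandsLift at *
    rwa [StrandSet.begun_inl_cons_of_nil hp] at *
  · obtain ⟨T, hT, hr⟩ := h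
    rw [StrandSet.begun_inl_cons_of_ne_nil hp] at hr
    obtain ⟨g, T', hg, hr', rfl⟩ := Multiset.rel_cons_left.1 hr
    refine ⟨_, hT, ?_⟩
    rw [StrandSet.begun_inl_cons_of_ne_nil hp]
    exact .cons hg hr'

theorem SList.vars_append {G : Signature.{u, v, w}} (l l' : SList G) :
    SList.vars (l ++ l') = SList.vars l ∪ SList.vars l' := by
  ext a
  simp only [SList.vars, List.mem_append, Set.mem_union, Set.mem_ofPred_eq]
  grind

theorem SMsg.mem_vars_subst_var {G : Signature.{u, v, w}} {ξ : G.Var → G.Var} {m : SMsg G}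
    {a : AVar G} (h : a ∈ (m.subst fun x => .var (ξ x)).vars) :
    ∃ x, .msg x ∈ m.vars ∧ a = .msg (ξ x) := by
  obtain ⟨t, ht, x, hx, rfl⟩ := h
  rw [SMsg.terms_subst] at ht
  obtain ⟨t, ht, rfl⟩ := ht
  obtain ⟨y, hy, hxy⟩ := Term.mem_vars_subst.1 hx
  obtain rfl : x = ξ y := hxy
  exact ⟨y, ⟨t, ht, y, hy, rfl⟩, rfl⟩

/-- A backwards narrowing step from `S` leads to a symbolic state that lifts `q`. -/
def CanStep (csu : CState P.sig → CState P.sig → Set (AVar P.sig) → Set (Subst P.sig))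
    (W : Set (AVar P.sig)) (S : CState P.sig) (q : GState P) : Prop :=
  ∃ (S' : CState P.sig) (μ : Subst P.sig) (θ' : P.sig.Var → Term P.sig),
    NarrowStep csu W S μ S' ∧ IsSymbolicState P S' ∧ Lifts S' θ' q

variable {csu : CState P.sig → CState P.sig → Set (AVar P.sig) → Set (Subst P.sig)}
  {S : CState P.sig} {W : Set (AVar P.sig)} {V : Set P.sig.Var} {θ τ : P.sig.Var → Term P.sig}
  {q : GState P} {L L' SS IK Y n₀ : ℕ} {F F' : Multiset (Fact P.sig)} {c : Subst P.sig → Prop}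
  {K X : Know P.sig}

/-- The part common to all rules. A rule replaces the facts `F` by `F'` and adds the disequalities
`Z`. The unifier sends `L`, `L'`, `SS`, `IK`, `Y` to instances of `p`, `f`, `Rest`, `K` and the
store of `S`. The state formed by `M`, `K` and the old store lifts `q` before the rule's own
additions; `hstrands` is the strand component, which depends on the rule. -/
theorem canStep_of_instance (hcsu : IsUnificationProcedure P csu) (hS : IsSymbolicState P S)
    (hW : W.Finite) (hSW : S.vars ⊆ W) (hN : NewNames W L L' SS IK Y)
    {Ml Mr : StrandSet P.sig} {Z : Multiset (Term P.sig × Term P.sig)}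
    (hr : BRule ⟨Ml, F.map .inl + {.inr IK}, {.inr Y}⟩
      ⟨Mr, F'.map .inl + {.inr IK}, .inr Y ::ₘ Z.map .inl⟩ c)
    (hV : V.Finite) (hVW : ∀ x ∈ V, .msg x ∉ W) (hMl : ∀ a ∈ Ml.vars, a ∉ W)
    (hMr : ∀ a ∈ Mr.vars, a ∉ W) (hF : ∀ f ∈ F, f.term.vars ⊆ V) (hF' : ∀ f ∈ F', f.term.vars ⊆ V)
    (hZ : ∀ d ∈ Z, d.1.vars ∪ d.2.vars ⊆ V)
    (hτ : GroundAssign τ) {p f : SList P.sig} {Rest : StrandSet P.sig}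
    (hp : p.WF P.msg) (hf : f.WF P.msg) (hRest : Rest.WF P.msg)
    (hXwf : X.WF P.msg) (hXl : ∀ ϑ, KnowLift X ϑ q.ik) (hn₀ : .inr n₀ ∈ S.ik)
    (hK : K ⊆ S.ik) (hKn : ∀ n, .inr n ∈ S.ik → .inr n ∈ K)
    (hFK : ∀ f ∈ F, (∃ f', .inl f' ∈ S.ik ∧ Fact.EqE P.eqns (f'.subst θ) (f.subst τ)) ∨
      .inl (f.subst τ) ∈ X)
    (hKF : ∀ f', .inl f' ∈ S.ik → .inl f' ∈ K ∨
      ∃ f ∈ F, Fact.EqE P.eqns (f'.subst θ) (f.subst τ))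
    (hF'l : KnowLift (F'.map .inl) τ q.ik)
    (hZl : ∀ d ∈ Z, ¬ EqE P.eqns (d.1.subst τ) (d.2.subst τ))
    {M : StrandSet P.sig} (hM : (StrandSet.vars M) ⊆ W) (hl : Lifts ⟨M, K, S.store⟩ θ q)
    (hstrands : ∀ {ϑ : P.sig.Var → Term P.sig} {ρ₀ ρ : Subst P.sig},
      IsInstantiation W V θ τ ϑ n₀ X ρ₀ → ρ.msg = ρ₀.msg →
      ρ.lst L = SList.subst ρ₀ p → ρ.lst L' = SList.subst ρ₀ f →
      ρ.ss SS = StrandSet.subst ρ₀ Rest →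
      StrandsLift M ϑ q.strands →
      StrandSet.EqE P.eqns (StrandSet.subst ρ₀ S.strands) (StrandSet.subst ρ Ml) ∧
        StrandsLift (StrandSet.subst ρ Mr) ϑ q.strands) : CanStep csu W S q := by
  obtain ⟨ϑ, ρ₀, h⟩ := exists_isInstantiation hW hV hVW hl.1 hτ n₀ hXwf
  have hKwf : K.WF P.msg := fun f hf => hS.1.2.1 f (hK hf)
  have hKW : Know.vars S.ik ⊆ W := fun a ha => hSW (.inl (.inr ha))
  have hlϑ : Lifts ⟨M, K, S.store⟩ ϑ q := by
    refine hl.congr h.ground fun x hx => h.eq_old x ?_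
    rcases hx with (hx | ⟨f, hf, y, hy, e⟩ | ⟨n, -, e⟩) | hx
    · exact hM hx
    · exact hKW (.inl ⟨f, hK hf, y, hy, e⟩)
    · cases e
    · exact hSW (.inr hx)
  rw [lifts_iff] at hlϑ
  obtain ⟨-, hlM, hlK, hlY⟩ := hlϑ
  have hs := h.isSubst
  -- The parts of `S` assigned to the rule's variables are instantiated by `ρ₀` because unification
  -- compares them with the instance of `S`.
  let ρ := ρ₀.extend L L' SS IK Y (SList.subst ρ₀ p) (SList.subst ρ₀ f)
    (StrandSet.subst ρ₀ Rest) (Know.subst ρ₀ K) (Store.subst ρ₀ S.store)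
  have hρ : ρ.IsSubst P.msg := hs.extend L L' SS IK Y (hp.subst hs.1 hs.2.1)
    (hf.subst hs.1 hs.2.1) (hRest.subst hs.1 hs.2.1 hs.2.2.1) (hKwf.subst hs.1 hs.2.2.2.1)
    (Store.WF.subst hS.1.2.2 hs.1 hs.2.2.2.2.1)
  have hIK : ρ.ik IK = Know.subst ρ₀ K := Function.update_self ..
  have hY : ρ.cs Y = Store.subst ρ₀ S.store := Function.update_self ..
  obtain ⟨hMl', hMr'⟩ := hstrands (ρ := ρ) h rfl
    ((Function.update_of_ne hN.ne _ _).trans (Function.update_self ..)) (Function.update_self ..)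
    (Function.update_self ..) hlM
  refine exists_narrowStep hcsu hS hW hSW hr ?_ hρ ?_ (fun n hn => ?_) (fun n hn => ?_) (θ := ϑ) ?_
  · have hfact : ∀ F : Multiset (Fact P.sig), (∀ f ∈ F, f.term.vars ⊆ V) →
        ∀ a ∈ Know.vars (F.map .inl + {.inr IK}), a ∉ W := by
      rintro F hF a (⟨f, hf, x, hx, rfl⟩ | ⟨n, hn, rfl⟩)
      · obtain ⟨f', hf', e⟩ : ∃ f' ∈ F, Sum.inl (β := ℕ) f' = .inl f := by simpa using hf
        obtain rfl := Sum.inl.inj e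
        exact hVW x (hF _ hf' hx)
      · obtain rfl : n = IK := by simpa using hn
        exact hN.ik
    refine Set.disjoint_left.2 ?_
    rintro a (((ha | ha) | ha) | ((ha | ha) | ha))
    · exact hMl a ha
    · exact hfact F hF a ha
    · obtain ⟨d, hd, -⟩ | ⟨n, hn, rfl⟩ := ha
      · simp at hd
      · obtain rfl : n = Y := by simpa using hn
        exact hN.cs
    · exact hMr a ha
    · exact hfact F' hF' a ha
    · obtain ⟨d, hd, x, hx, rfl⟩ | ⟨n, hn, rfl⟩ := ha
      · have hd' : d ∈ Z := by simpa using hd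
        exact hVW x (hZ d hd' hx)
      · obtain rfl : n = Y := by simpa using hn
        exact hN.cs
  -- The newly bound names do not occur in `S`, so `ρ` and `ρ₀` give it the same instance up to
  -- equality; the components are then compared.
  · refine (CState.subst_eqE hS.1 hs.1 hρ.1 fun a ha => hN.eqAt_extend ρ₀ a (hSW ha)).symm.trans
      ⟨hMl', h.know_eqE hKW hn₀ hK hKn hF hFK hKF rfl hIK, ?_⟩
    simp only [CState.subst, Store.subst_inr, hY]
    exact .refl _
  · have hne : n ≠ SS := by rintro rfl; exact hN.ss (hSW hn)
    simp [ρ, Subst.extend, hne, h.ss, Subst.id]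
  · have hne : n ≠ IK := by rintro rfl; exact hN.ik (hSW hn)
    simp only [ρ, Subst.extend, Function.update_of_ne hne, h.ik]
    exact forall_update (Q := fun n K => Sum.inr n ∈ K) (by simp) (by simp [Subst.id]) n
  · rw [lifts_iff]
    refine ⟨h.ground, hMr', h.knowLift hτ hlK hXl hF' hF'l rfl hIK, ?_⟩
    simp only [CState.subst, Store.subst_inr_cons, hY]
    intro a b hab
    rcases Multiset.mem_add.1 hab with hab | hab
    · exact hlY.subst h.subst_eq hS.2.2.2.2 a b hab
    · obtain ⟨d, hd, e⟩ | ⟨n, hn, -⟩ := Store.mem_subst.1 hab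
      · have hd' : d ∈ Z := by simpa using hd
        obtain ⟨rfl, rfl⟩ := Prod.mk.inj (Sum.inl.inj e)
        have heq : ∀ t : Term P.sig, t.vars ⊆ V → (t.subst ρ.msg).subst ϑ = t.subst τ := by
          intro t ht
          rw [Term.subst_subst]
          refine Term.subst_congr fun x hx => ?_
          rw [show ρ.msg x = τ x from h.msg_new x (ht hx), (hτ.2 x).subst]
        have hv := hZ d hd'
        rw [heq _ (Set.subset_union_left.trans hv), heq _ (Set.subset_union_right.trans hv)]
        exact hZl d hd'
      · simp at hn

/-- Narrowing with a rule that moves the bar of the strand `A` of `S` over its last element. -/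
theorem canStep_move (hcsu : IsUnificationProcedure P csu) (hS : IsSymbolicState P S)
    (hW : W.Finite) (hSW : S.vars ⊆ W) (hN : NewNames W L L' SS IK Y) {u u₀ : SMsg P.sig}
    {Z : Multiset (Term P.sig × Term P.sig)}
    (hr : BRule ⟨{.inr SS, .inl ⟨[.inr L, .inl u], [.inr L']⟩}, F.map .inl + {.inr IK}, {.inr Y}⟩
      ⟨{.inr SS, .inl ⟨[.inr L], [.inl u, .inr L']⟩}, F'.map .inl + {.inr IK},
        .inr Y ::ₘ Z.map .inl⟩ c)
    (hV : V.Finite) (hVW : ∀ x ∈ V, .msg x ∉ W) (huV : ∀ x, .msg x ∈ u.vars → x ∈ V)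
    (hF : ∀ f ∈ F, f.term.vars ⊆ V) (hF' : ∀ f ∈ F', f.term.vars ⊆ V)
    (hZ : ∀ d ∈ Z, d.1.vars ∪ d.2.vars ⊆ V) (hτ : GroundAssign τ)
    {A : Strand P.sig} {p : SList P.sig} {Rest : StrandSet P.sig}
    (hAS : S.strands = .inl A ::ₘ Rest) (hA : A.past = p ++ [.inl u₀])
    (hu : SMsg.EqE P.eqns (u₀.subst θ) (u.subst τ))
    (hXwf : X.WF P.msg) (hXl : ∀ ϑ, KnowLift X ϑ q.ik) (hn₀ : .inr n₀ ∈ S.ik)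
    (hK : K ⊆ S.ik) (hKn : ∀ n, .inr n ∈ S.ik → .inr n ∈ K)
    (hFK : ∀ f ∈ F, (∃ f', .inl f' ∈ S.ik ∧ Fact.EqE P.eqns (f'.subst θ) (f.subst τ)) ∨
      .inl (f.subst τ) ∈ X)
    (hKF : ∀ f', .inl f' ∈ S.ik → .inl f' ∈ K ∨
      ∃ f ∈ F, Fact.EqE P.eqns (f'.subst θ) (f.subst τ))
    (hF'l : KnowLift (F'.map .inl) τ q.ik)
    (hZl : ∀ d ∈ Z, ¬ EqE P.eqns (d.1.subst τ) (d.2.subst τ))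
    (hl : Lifts ⟨.inl ⟨p, A.future⟩ ::ₘ Rest, K, S.store⟩ θ q) : CanStep csu W S q := by
  have hAmem : .inl A ∈ S.strands := by simp [hAS]
  have hRmem : ∀ {a}, a ∈ Rest → a ∈ S.strands := fun ha => by simp [hAS, ha]
  have hSW' : StrandSet.vars S.strands ⊆ W := fun a ha => hSW (.inl (.inl ha))
  have hAW : A.vars ⊆ W := fun a ha => hSW' (.inl ⟨A, hAmem, ha⟩)
  have hAwf := hS.1.1 A hAmem
  have huvars : ∀ a ∈ u.vars, a ∉ W := by
    rintro a ⟨t, ht, x, hx, rfl⟩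
    exact hVW x (huV x ⟨t, ht, x, hx, rfl⟩)
  have hu₀W : u₀.vars ⊆ W := fun a ha => hAW (.inl (.inl ⟨u₀, by simp [hA], ha⟩))
  refine canStep_of_instance (p := p) (f := A.future) (Rest := Rest) hcsu hS hW hSW hN hr hV hVW
    ?_ ?_ hF hF' hZ hτ ?_ hAwf.2 (fun B hB => hS.1.1 B (hRmem hB)) hXwf hXl hn₀ hK hKn hFK hKF
    hF'l hZl ?_ hl ?_
  · rintro a (⟨B, hB, ha⟩ | ⟨n, hn, rfl⟩)
    · obtain rfl : B = ⟨[.inr L, .inl u], [.inr L']⟩ := by simpa using hB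
      simp only [Strand.vars, SList.vars] at ha
      rcases ha with (⟨m, hm, ha⟩ | ⟨n, hn, rfl⟩) | (⟨m, hm, ha⟩ | ⟨n, hn, rfl⟩)
      · obtain rfl : m = u := by simpa using hm
        exact huvars a ha
      · obtain rfl : n = L := by simpa using hn
        exact hN.lst
      · simp at hm
      · obtain rfl : n = L' := by simpa using hn
        exact hN.lst'
    · obtain rfl : n = SS := by simpa using hn
      exact hN.ss
  · rintro a (⟨B, hB, ha⟩ | ⟨n, hn, rfl⟩)
    · obtain rfl : B = ⟨[.inr L], [.inl u, .inr L']⟩ := by simpa using hB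
      simp only [Strand.vars, SList.vars] at ha
      rcases ha with (⟨m, hm, ha⟩ | ⟨n, hn, rfl⟩) | (⟨m, hm, ha⟩ | ⟨n, hn, rfl⟩)
      · simp at hm
      · obtain rfl : n = L := by simpa using hn
        exact hN.lst
      · obtain rfl : m = u := by simpa using hm
        exact huvars a ha
      · obtain rfl : n = L' := by simpa using hn
        exact hN.lst'
    · obtain rfl : n = SS := by simpa using hn
      exact hN.ss
  · exact fun m hm => hAwf.1 m (by simp [hA, hm])
  · rintro a (⟨B, hB, ha⟩ | ⟨n, hn, rfl⟩)
    · rcases Multiset.mem_cons.1 hB with e | hB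
      · obtain rfl := Sum.inl.inj e
        refine hAW (ha.imp (fun ha => ?_) id)
        rw [hA, SList.vars_append]
        exact .inl ha
      · exact hSW' (.inl ⟨B, hRmem hB, ha⟩)
    · exact hSW' (.inr ⟨n, hRmem (by simpa using hn), rfl⟩)
  · intro ϑ ρ₀ ρ h hρ hL hL' hSS hM
    constructor
    -- `SS` absorbs the other strands, `L` the past before the last element and `L'` the future; the
    -- last element matches by `hu`.
    · rw [hAS, StrandSet.subst_inl_cons, Multiset.insert_eq_cons, StrandSet.subst_inr_cons,
        StrandSet.subst_inl, hSS, add_comm, Multiset.singleton_add]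
      refine .cons (.inl ?_) (StrandSet.EqE.refl _)
      simp only [Strand.subst, hA, SList.subst_append, SList.subst_inl_cons, SList.subst_inr_cons,
        SList.subst_nil, hL, hL', hρ, List.append_nil]
      refine ⟨(SList.EqE.refl _).append (.cons (.inl ?_) .nil), .refl _⟩
      rwa [SMsg.subst_congr fun x hx => h.msg_old x (hu₀W hx),
        SMsg.subst_congr fun x hx => h.msg_new x (huV x hx)]
    · rw [Multiset.insert_eq_cons, StrandSet.subst_inr_cons,
        StrandSet.subst_inl, hSS, add_comm, Multiset.singleton_add]
      have h' := hM.subst h.subst_eq h.lst h.ss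
      rw [StrandSet.subst_inl_cons] at h'
      simp only [Strand.subst, SList.subst_inl_cons, SList.subst_inr_cons,
        SList.subst_nil, hL, List.append_nil] at h' ⊢
      exact h'.change_future

/-- Narrowing with a rule that introduces a protocol strand. -/
theorem canStep_newStrand (hcsu : IsUnificationProcedure P csu) (hS : IsSymbolicState P S)
    (hW : W.Finite) (hSW : S.vars ⊆ W) {ro : P.Role} {pre post : List (SMsg P.sig)}
    {t t' : Term P.sig} (hms : (ro, pre ++ .send t :: post) ∈ P.strands) (hτ : GroundAssign τ)
    (hK : K ⊆ S.ik) (hKn : ∀ n, .inr n ∈ S.ik → .inr n ∈ K)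
    (ht' : .inl (.pos t') ∈ S.ik) (htt' : EqE P.eqns (t'.subst θ) (t.subst τ))
    (hKF : ∀ f', .inl f' ∈ S.ik → .inl f' ∈ K ∨
      Fact.EqE P.eqns (f'.subst θ) (.pos (t.subst τ)))
    (hq : ∀ m ∈ q.ik, ¬ EqE P.eqns m (t.subst τ))
    {i : ℕ} {D : Multiset (GStrand P)} (hl : Lifts ⟨S.strands, K, S.store⟩ θ ⟨D, q.ik⟩)
    (hD : pre ≠ [] ∧ q.strands = ⟨ro, i, pre.map (SMsg.subst τ)⟩ ::ₘ D ∨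
      pre = [] ∧ q.strands = D) : CanStep csu W S q := by
  obtain ⟨L, L', SS, IK, Y, hN⟩ := exists_newNames hW
  obtain ⟨n₀, hn₀⟩ := hS.2.2.2.1
  set ms := pre ++ .send t :: post with hmsdef
  let U : Set P.sig.Var := {x | ∃ m ∈ ms, .msg x ∈ m.vars}
  have hU : U.Finite := by
    have h := (ms.finite_toSet.biUnion fun m _ => m.vars_finite).preimage
      (f := AVar.msg) fun _ _ _ _ h => AVar.msg.inj h
    refine h.subset ?_
    rintro x ⟨m, hm, hx⟩
    exact Set.mem_iUnion₂.2 ⟨m, hm, hx⟩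
  obtain ⟨ξ, hξi, hξs, hξW⟩ := exists_renaming hU hW
  have hmap : ms.map (SMsg.subst fun x => .var (ξ x)) =
      pre.map (SMsg.subst fun x => .var (ξ x)) ++ .send (t.subst fun x => .var (ξ x)) ::
        post.map (SMsg.subst fun x => .var (ξ x)) := by
    simp [hmsdef, SMsg.subst]
  have hr := BRule.newStrand SS IK Y ro ms _ _ _ ξ hms hξi hξs hmap
  classical
  -- The values of `τ` carried along the renaming, consistent since `ξ` is injective on `U`.
  let τ' : P.sig.Var → Term P.sig := fun y =>
    if h : ∃ x ∈ U, ξ x = y then τ h.choose else τ y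
  have hτξ : ∀ x ∈ U, τ' (ξ x) = τ x := by
    intro x hx
    have h : ∃ x' ∈ U, ξ x' = ξ x := ⟨x, hx, rfl⟩
    simp only [τ', dif_pos h]
    rw [hξi h.choose_spec.1 hx h.choose_spec.2]
  have hτ' : GroundAssign τ' := by
    refine ⟨fun y => ?_, fun y => ?_⟩ <;> dsimp only [τ'] <;> split_ifs with h
    · have hs := hξs h.choose
      rw [h.choose_spec.2] at hs
      rw [hs]
      exact hτ.1 _
    · exact hτ.1 y
    · exact hτ.2 _
    · exact hτ.2 y
  have htU : ∀ x ∈ t.vars, x ∈ U := fun x hx =>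
    ⟨.send t, by simp [hmsdef], t, rfl, x, hx, rfl⟩
  have htτ : (t.subst fun x => .var (ξ x)).subst τ' = t.subst τ := by
    rw [Term.subst_subst]
    exact Term.subst_congr fun x hx => hτξ x (htU x hx)
  have htV : (t.subst fun x => .var (ξ x)).vars ⊆ ξ '' U := by
    intro y hy
    obtain ⟨x, hx, hxy⟩ := Term.mem_vars_subst.1 hy
    exact ⟨x, htU x hx, (show y = ξ x from hxy).symm⟩
  have hSW' : StrandSet.vars S.strands ⊆ W := fun a ha => hSW (.inl (.inl ha))
  have hl' : Lifts ⟨S.strands, K, S.store⟩ θ q := by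
    refine ⟨hl.1, ?_, hl.2.2⟩
    obtain ⟨T, hT, hrel⟩ := hl.2.1
    refine ⟨T, hT.trans ?_, hrel⟩
    rcases hD with ⟨-, e⟩ | ⟨-, e⟩ <;> rw [e]
    exact Multiset.le_cons_self _ _
  -- This rule has no list variables, so the empty lists are arbitrary values; `SS` absorbs all
  -- strands of `S`.
  refine canStep_of_instance (F := {.pos _}) (F' := {.neg _}) (Z := 0) (X := 0) (p := []) (f := [])
    (V := ξ '' U) (τ := τ') (Rest := S.strands) (M := S.strands) hcsu hS hW hSW hN
    hr (hU.image ξ) ?_ ?_ ?_ ?_ ?_ (by simp) hτ' (by simp [SList.WF])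
    (by simp [SList.WF]) hS.1.1
    (by simp [Know.WF]) (fun _ => by simp [KnowLift]) hn₀ hK hKn ?_ ?_ ?_ (by simp) hSW' hl' ?_
  · rintro _ ⟨x, hx, rfl⟩
    exact hξW x hx
  · rintro a (⟨B, hB, -⟩ | ⟨n, hn, rfl⟩)
    · simp at hB
    · obtain rfl : n = SS := by simpa using hn
      exact hN.ss
  · rintro a (⟨B, hB, ha⟩ | ⟨n, hn, rfl⟩)
    · obtain rfl := Sum.inl.inj (Multiset.mem_singleton.1
        ((Multiset.mem_cons.1 hB).resolve_left (by simp)))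
      simp only [Strand.vars] at ha
      rw [← SList.vars_append, ← List.map_append, ← hmap] at ha
      rcases ha with ⟨m, hm, ha⟩ | ⟨n, hn, -⟩
      · obtain ⟨m', hm', rfl⟩ : ∃ m' ∈ ms, (m'.subst fun x => .var (ξ x)) = m := by
          simpa using hm
        obtain ⟨x, hx, rfl⟩ := SMsg.mem_vars_subst_var ha
        exact hξW x ⟨m', hm', hx⟩
      · simp at hn
    · obtain rfl : n = SS := by simpa using hn
      exact hN.ss
  · simpa [Fact.term] using htV
  · simpa [Fact.term] using htV
  · intro f hf
    rw [Multiset.mem_singleton.1 hf]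
    exact .inl ⟨_, ht', .pos (by rwa [htτ])⟩
  · refine fun f' hf' => (hKF f' hf').imp id fun h => ⟨_, Multiset.mem_singleton_self _, ?_⟩
    simpa only [Fact.subst, htτ] using h
  · refine ⟨by simp, fun t₁ ht₁ => ?_⟩
    obtain rfl : t₁ = t.subst fun x => .var (ξ x) := by simpa using ht₁
    rw [htτ]
    rintro ⟨m, hm, hmt⟩
    exact hq m hm hmt
  · intro ϑ ρ₀ ρ h hρ hL hL' hSS hM
    rw [StrandSet.subst_inr, hSS]
    refine ⟨.refl _, ?_⟩
    rw [Multiset.insert_eq_cons, StrandSet.subst_inr_cons, StrandSet.subst_inl, hSS, add_comm,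
      Multiset.singleton_add]
    -- The introduced strand needs a counterpart of its own when it has begun, so the strands of `S`
    -- are placed inside `D`, leaving that strand of `q` free.
    have hlD' : StrandsLift S.strands ϑ D := by
      have h1 := hl.congr (θ' := ϑ) h.ground fun x hx => h.eq_old x ?_
      · exact h1.2.1
      · rcases hx with (hx | ⟨f, hf, y, hy, e⟩ | ⟨n, -, e⟩) | hx
        · exact hSW' hx
        · exact hSW (.inl (.inr (.inl ⟨f, hK hf, y, hy, e⟩)))
        · cases e
        · exact hSW (.inr hx)
    obtain ⟨T, hT, hrel⟩ := hlD'.subst h.subst_eq h.lst h.ss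
    rcases hD with ⟨hne, e⟩ | ⟨rfl, e⟩
    · refine ⟨⟨ro, i, pre.map (SMsg.subst τ)⟩ ::ₘ T, e ▸ Multiset.cons_le_cons _ hT, ?_⟩
      rw [StrandSet.begun_inl_cons_of_ne_nil
        (by simpa [Strand.subst, SList.subst_map_inl, -List.map_map] using hne)]
      refine .cons ?_ hrel
      simp only [StrandLift, Strand.subst, SList.subst_map_inl,
        List.forall₂_map_left_iff, List.forall₂_map_right_iff]
      refine List.forall₂_same.2 fun m hm => ⟨_, rfl, ?_⟩
      have heq : ((m.subst fun x => .var (ξ x)).subst ρ.msg).subst ϑ = m.subst τ := by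
        rw [SMsg.subst_subst, SMsg.subst_subst]
        refine SMsg.subst_congr fun x hx => ?_
        have hxU : x ∈ U := ⟨m, by simp [hmsdef, hm], hx⟩
        simp only [Term.subst, hρ]
        rw [h.msg_new _ ⟨x, hxU, rfl⟩, hτξ x hxU, (hτ.2 x).subst]
      rw [heq]
      exact .refl _
    · refine ⟨T, e ▸ hT, ?_⟩
      rwa [StrandSet.begun_inl_cons_of_nil rfl]

end Rules

/-! ### Undoing forwards steps -/

section Completeness

variable {P : Protocol.{u, v, w, z}}

/-- Supplies the value of a rule variable `M`: the `θ`-instance of the term it has to match. -/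
theorem GroundAssign.update {θ : P.sig.Var → Term P.sig} (hθ : GroundAssign θ) {M : P.sig.Var}
    {t : Term P.sig} (hM : P.sig.varSort M = P.msg) (ht : HasSort t P.msg) :
    ∃ τ, GroundAssign τ ∧ τ M = t.subst θ ∧ ∀ x, x ≠ M → τ x = θ x := by
  classical
  refine ⟨Function.update θ M (t.subst θ), ⟨?_, ?_⟩, Function.update_self ..,
    fun x hx => Function.update_of_ne hx _ _⟩
  · refine forall_update (Q := fun x t => HasSort t (P.sig.varSort x)) ?_ hθ.1
    rw [hM]
    exact ht.subst hθ.1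
  · exact forall_update (Q := fun _ t => Term.Ground t) (Term.ground_subst hθ.2 t) hθ.2

variable {csu : CState P.sig → CState P.sig → Set (AVar P.sig) → Set (Subst P.sig)}
  {S : CState P.sig} {W : Set (AVar P.sig)} {θ : P.sig.Var → Term P.sig}
  {q : GState P} {A : Strand P.sig} {p : SList P.sig} {Rest : StrandSet P.sig} {K : Know P.sig}

/-- Narrowing with a rule that does not involve intruder facts. -/
theorem canStep_silent (hcsu : IsUnificationProcedure P csu) (hS : IsSymbolicState P S)
    (hW : W.Finite) (hSW : S.vars ⊆ W) {u₀ : SMsg P.sig}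
    (hu₀ : (∃ t, u₀ = .send t) ∨ (∃ n, u₀ = .cstr .any n) ∨
      ∃ c n, u₀ = .cstr c n ∧ (c.subst θ).Holds P.eqns)
    (hAS : S.strands = .inl A ::ₘ Rest) (hA : A.past = p ++ [.inl u₀])
    (hl : Lifts ⟨.inl ⟨p, A.future⟩ ::ₘ Rest, S.ik, S.store⟩ θ q) : CanStep csu W S q := by
  obtain ⟨L, L', SS, IK, Y, hN⟩ := exists_newNames hW
  obtain ⟨n₀, hn₀⟩ := hS.2.2.2.1
  have hsort : ∀ t ∈ u₀.terms, HasSort t P.msg :=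
    (hS.1.1 A (by simp [hAS])).1 u₀ (by simp [hA])
  -- These rules keep the facts as they are; they differ only in the element `u` and the
  -- disequalities `Z` they add.
  have key : ∀ {V : Set P.sig.Var} {τ : P.sig.Var → Term P.sig} {u : SMsg P.sig}
      {Z : Multiset (Term P.sig × Term P.sig)} {c : Subst P.sig → Prop},
      BRule ⟨{.inr SS, .inl ⟨[.inr L, .inl u], [.inr L']⟩}, {.inr IK}, {.inr Y}⟩
        ⟨{.inr SS, .inl ⟨[.inr L], [.inl u, .inr L']⟩}, {.inr IK}, .inr Y ::ₘ Z.map .inl⟩ c →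
      V.Finite → (∀ x ∈ V, .msg x ∉ W) → (∀ x, .msg x ∈ u.vars → x ∈ V) →
      (∀ d ∈ Z, d.1.vars ∪ d.2.vars ⊆ V) → GroundAssign τ →
      SMsg.EqE P.eqns (u₀.subst θ) (u.subst τ) →
      (∀ d ∈ Z, ¬ EqE P.eqns (d.1.subst τ) (d.2.subst τ)) → CanStep csu W S q := by
    intro V τ u Z c hr hV hVW huV hZ hτ hu hZl
    exact canStep_move (F := 0) (F' := 0) (X := 0) hcsu hS hW hSW hN hr hV hVW huV (by simp)
      (by simp) hZ hτ hAS hA hu (by simp [Know.WF]) (fun _ => by simp [KnowLift]) hn₀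
      (fun _ h => h) (fun _ h => h) (by simp) (fun _ h => .inl h) (by simp [KnowLift]) hZl hl
  rcases hu₀ with ⟨t, rfl⟩ | ⟨n, rfl⟩ | ⟨_ | ⟨a, b⟩ | ⟨a, b⟩, n, rfl, hc⟩
  · obtain ⟨M, hM, hMW⟩ := exists_new_var P.msg hW
    obtain ⟨τ, hτ, hτM, -⟩ := hl.1.update hM (hsort t rfl)
    refine key (V := {M}) (Z := 0) (τ := τ) (BRule.send SS IK L L' Y M hN.ne hM)
      (Set.finite_singleton M) (by simpa using hMW) ?_ (by simp) hτ ?_ (by simp)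
    · simp [SMsg.vars, SMsg.terms, Term.vars]
    · simp only [SMsg.subst, Term.subst, hτM]
      exact .refl _
  · exact key (V := ∅) (Z := 0) (BRule.choice SS IK L L' Y n hN.ne) Set.finite_empty (by simp)
      (by simp [SMsg.vars, SMsg.terms]) (by simp) hl.1 (.refl _) (by simp)
  · exact hc.elim
  · obtain ⟨M, hM, hMW⟩ := exists_new_var P.msg hW
    obtain ⟨τ, hτ, hτM, -⟩ := hl.1.update hM (hsort a (.inl rfl))
    refine key (V := {M}) (Z := 0) (τ := τ) (BRule.condEq SS IK L L' Y n M hN.ne hM)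
      (Set.finite_singleton M) (by simpa using hMW) ?_ (by simp) hτ ?_ (by simp)
    · simp [SMsg.vars, SMsg.terms, Term.vars]
    · simp only [SMsg.subst, Cstr.subst, Term.subst, hτM]
      -- The pattern `M = M` has identical sides; it matches modulo `E` because the equality holds
      -- under `θ`.
      exact .eq n (.refl _) (EqE.symm hc)
  · obtain ⟨M, hM, hMW⟩ := exists_new_var P.msg hW
    obtain ⟨M', hM', hMW'⟩ := exists_new_var P.msg (hW.insert (.msg M))
    have hne : M ≠ M' := by
      rintro rfl
      exact hMW' (.inl rfl)
    obtain ⟨τ₁, hτ₁, hτ₁M, -⟩ := hl.1.update hM (hsort a (.inl rfl))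
    obtain ⟨τ₂, hτ₂, hτ₂M, -⟩ := hl.1.update hM' (hsort b (.inr rfl))
    classical
    let τ : P.sig.Var → Term P.sig := fun x => if x = M then τ₁ x else τ₂ x
    have hτ : GroundAssign τ := by
      refine ⟨fun x => ?_, fun x => ?_⟩ <;> dsimp only [τ] <;> split_ifs
      exacts [hτ₁.1 x, hτ₂.1 x, hτ₁.2 x, hτ₂.2 x]
    have hτM : τ M = a.subst θ := by simp [τ, hτ₁M]
    have hτM' : τ M' = b.subst θ := by simp [τ, hτ₂M, hne.symm]
    refine key (V := {M, M'}) (Z := {(.var M, .var M')}) (τ := τ)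
      (BRule.condNe SS IK L L' Y n M M' hN.ne hne hM hM') (Set.toFinite _) ?_ ?_ ?_ hτ ?_ ?_
    · rintro x (rfl | rfl)
      · exact hMW
      · exact fun h => hMW' (.inr h)
    · simp [SMsg.vars, SMsg.terms, Term.vars]
    · simp [Term.vars]
    · simp only [SMsg.subst, Cstr.subst, Term.subst, hτM, hτM']
      exact .refl _
    · simp only [Multiset.mem_singleton, forall_eq, Term.subst, hτM, hτM']
      exact hc

/-- Narrowing with the rule for received messages. -/
theorem canStep_recv (hcsu : IsUnificationProcedure P csu) (hS : IsSymbolicState P S)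
    (hW : W.Finite) (hSW : S.vars ⊆ W) {t : Term P.sig}
    (ht : ∃ m ∈ q.ik, EqE P.eqns m (t.subst θ))
    (hAS : S.strands = .inl A ::ₘ Rest) (hA : A.past = p ++ [.inl (.recv t)])
    (hl : Lifts ⟨.inl ⟨p, A.future⟩ ::ₘ Rest, S.ik, S.store⟩ θ q) : CanStep csu W S q := by
  obtain ⟨L, L', SS, IK, Y, hN⟩ := exists_newNames hW
  obtain ⟨n₀, hn₀⟩ := hS.2.2.2.1
  obtain ⟨M, hM, hMW⟩ := exists_new_var P.msg hW
  have hsort : HasSort t P.msg :=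
    (hS.1.1 A (by simp [hAS])).1 (.recv t) (by simp [hA]) t rfl
  obtain ⟨τ, hτ, hτM, -⟩ := hl.1.update hM hsort
  have hground : ∀ ϑ, (t.subst θ).subst ϑ = t.subst θ := (Term.ground_subst hl.1.2 t).subst
  -- `S` need not contain the fact that the rule demands. Through `X` a fact variable of `S`
  -- supplies the received message, which is ground and known in `q`.
  refine canStep_move (F := {.pos (.var M)}) (F' := {.pos (.var M)}) (Z := 0) (V := {M})
    (X := {.inl (.pos (t.subst θ))}) (K := S.ik) (τ := τ) hcsu hS hW hSW hN
    (BRule.recv SS IK L L' Y M hN.ne hM) (Set.finite_singleton M) (by simpa using hMW) ?_ ?_ ?_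
    (by simp) hτ hAS hA ?_ ?_ ?_ hn₀ (fun _ h => h) (fun _ h => h) ?_ (fun _ h => .inl h) ?_
    (by simp) hl
  · simp [SMsg.vars, SMsg.terms, Term.vars]
  · simp [Fact.term, Term.vars]
  · simp [Fact.term, Term.vars]
  · simp only [SMsg.subst, Term.subst, hτM]
    exact .refl _
  · simpa [Know.WF, Fact.term] using hsort.subst hl.1.1
  · intro ϑ
    simpa [KnowLift, hground] using ht
  · simp [Fact.subst, Term.subst, hτM]
  · simpa [KnowLift, Term.subst, hτM] using ht

/-- Narrowing with the rule for learning a message that a strand of the state sends. -/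
theorem canStep_sendLearn (hcsu : IsUnificationProcedure P csu) (hS : IsSymbolicState P S)
    (hW : W.Finite) (hSW : S.vars ⊆ W) {t t' : Term P.sig}
    (hK : K ⊆ S.ik) (hKn : ∀ n, .inr n ∈ S.ik → .inr n ∈ K)
    (ht' : .inl (.pos t') ∈ S.ik) (htt' : EqE P.eqns (t'.subst θ) (t.subst θ))
    (hKF : ∀ f', .inl f' ∈ S.ik → .inl f' ∈ K ∨
      Fact.EqE P.eqns (f'.subst θ) (.pos (t.subst θ)))
    (hq : ∀ m ∈ q.ik, ¬ EqE P.eqns m (t.subst θ))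
    (hAS : S.strands = .inl A ::ₘ Rest) (hA : A.past = p ++ [.inl (.send t)])
    (hl : Lifts ⟨.inl ⟨p, A.future⟩ ::ₘ Rest, K, S.store⟩ θ q) : CanStep csu W S q := by
  obtain ⟨L, L', SS, IK, Y, hN⟩ := exists_newNames hW
  obtain ⟨n₀, hn₀⟩ := hS.2.2.2.1
  obtain ⟨M, hM, hMW⟩ := exists_new_var P.msg hW
  have hsort : HasSort t P.msg :=
    (hS.1.1 A (by simp [hAS])).1 (.send t) (by simp [hA]) t rfl
  obtain ⟨τ, hτ, hτM, -⟩ := hl.1.update hM hsort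
  refine canStep_move (F := {.pos (.var M)}) (F' := {.neg (.var M)}) (Z := 0) (V := {M})
    (X := 0) (τ := τ) hcsu hS hW hSW hN
    (BRule.sendLearn SS IK L L' Y M hN.ne hM) (Set.finite_singleton M) (by simpa using hMW) ?_ ?_ ?_
    (by simp) hτ hAS hA ?_ (by simp [Know.WF]) (fun _ => by simp [KnowLift]) hn₀ hK hKn ?_ ?_ ?_
    (by simp) hl
  · simp [SMsg.vars, SMsg.terms, Term.vars]
  · simp [Fact.term, Term.vars]
  · simp [Fact.term, Term.vars]
  · simp only [SMsg.subst, Term.subst, hτM]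
    exact .refl _
  · intro f hf
    rw [Multiset.mem_singleton.1 hf]
    exact .inl ⟨_, ht', .pos (by rwa [Term.subst, hτM])⟩
  · refine fun f' hf' => (hKF f' hf').imp id fun h => ⟨_, Multiset.mem_singleton_self _, ?_⟩
    simpa only [Fact.subst, Term.subst, hτM] using h
  · simpa [KnowLift, Term.subst, hτM] using hq

/-! ## Steps backwards -/

/-- The strand part of a forwards step, read backwards. -/
theorem StrandsLift.backwards {M : StrandSet P.sig} {ro : P.Role} {i : ℕ}
    {pre : List (SMsg P.sig)} {m : SMsg P.sig} {D Q : Multiset (GStrand P)}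
    (h : StrandsLift M θ (⟨ro, i, pre ++ [m]⟩ ::ₘ D))
    (hQ : pre ≠ [] ∧ Q = ⟨ro, i, pre⟩ ::ₘ D ∨ pre = [] ∧ Q = D) :
    StrandsLift M θ D ∨ ∃ A Rest p u₀, M = .inl A ::ₘ Rest ∧ A.past = p ++ [.inl u₀] ∧
      SMsg.EqE P.eqns m (u₀.subst θ) ∧ StrandsLift (.inl ⟨p, A.future⟩ ::ₘ Rest) θ Q := by
  obtain ⟨T, hT, hr⟩ := h
  by_cases hg : (⟨ro, i, pre ++ [m]⟩ : GStrand P) ∈ T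
  swap
  -- The extended ground strand is not used as a counterpart and can be removed.
  · exact .inl ⟨T, (Multiset.le_cons_of_notMem hg).1 hT, hr⟩
  obtain ⟨T', rfl⟩ := Multiset.exists_cons_of_mem hg
  obtain ⟨A, B, hA, hB, hAB⟩ := Multiset.rel_cons_right.1 hr
  have hmem : A ∈ StrandSet.begun M := hAB ▸ Multiset.mem_cons_self _ _
  obtain ⟨hAM, hne⟩ := StrandSet.mem_begun.1 hmem
  obtain ⟨Rest, rfl⟩ := Multiset.exists_cons_of_mem hAM
  rw [StrandSet.begun_inl_cons_of_ne_nil hne, Multiset.cons_inj_right] at hAB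
  subst hAB
  have hT' := (Multiset.cons_le_cons_iff _).1 hT
  -- The partner's past is split at the length of `pre`, leaving exactly one element to match `m`.
  have h1 := List.forall₂_take_append _ _ _ hA
  have h2 := List.forall₂_drop_append _ _ _ hA
  obtain ⟨a, l, ⟨u₀, rfl, hu₀⟩, hl, hd⟩ := List.forall₂_cons_right_iff.1 h2
  rw [List.forall₂_nil_right_iff.1 hl] at hd
  refine .inr ⟨A, Rest, A.past.take pre.length, u₀, rfl, ?_, hu₀, ?_⟩
  · rw [← hd, List.take_append_drop]
  · rcases hQ with ⟨hpre, rfl⟩ | ⟨rfl, rfl⟩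
    · refine ⟨⟨ro, i, pre⟩ ::ₘ T', Multiset.cons_le_cons _ hT', ?_⟩
      rw [StrandSet.begun_inl_cons_of_ne_nil]
      · exact .cons h1 hB
      · intro e
        rw [show A.past.take pre.length = [] from e, List.forall₂_nil_left_iff] at h1
        exact hpre h1
    -- With `pre` empty, the strand has not begun once its bar is moved back, so it loses its
    -- counterpart.
    · refine ⟨T', hT', ?_⟩
      rwa [StrandSet.begun_inl_cons_of_nil (by simp)]

/-- The effect of a forwards step: a strand is extended or added, and either the knowledge stays
as it is or the message that is sent becomes known. -/
theorem FRule.effect {q s : GState P} (h : FRule q s) :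
    ∃ ro i pre m D, s.strands = ⟨ro, i, pre ++ [m]⟩ ::ₘ D ∧
      (pre ≠ [] ∧ q.strands = ⟨ro, i, pre⟩ ::ₘ D ∨ pre = [] ∧ q.strands = D) ∧
      ((s.ik = q.ik ∧ ((∃ t, m = .send t) ∨ (∃ t ∈ q.ik, m = .recv t) ∨ (∃ n, m = .cstr .any n) ∨
          ∃ c n, m = .cstr c n ∧ c.Holds P.eqns)) ∨
        ∃ pre' post t τ, (ro, pre' ++ .send t :: post) ∈ P.strands ∧ GroundAssign τ ∧
          pre = pre'.map (SMsg.subst τ) ∧ m = .send (t.subst τ) ∧ s.ik = t.subst τ ::ₘ q.ik ∧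
          ∀ k ∈ q.ik, ¬ EqE P.eqns k (t.subst τ)) := by
  cases h with
  | sendLearn ro i pre post t τ SS IK hms hne hτ hf hIK =>
    exact ⟨ro, i, _, _, SS, rfl, .inl ⟨by simpa using hne, rfl⟩,
      .inr ⟨pre, post, t, τ, hms, hτ, rfl, rfl, rfl, hIK⟩⟩
  | send ro i pre post t τ SS IK hms hne hτ hf =>
    exact ⟨ro, i, _, _, SS, rfl, .inl ⟨by simpa using hne, rfl⟩, .inl ⟨rfl, .inl ⟨_, rfl⟩⟩⟩
  | newSendLearn ro post t τ SS IK hms hτ hf hIK =>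
    exact ⟨ro, _, [], _, SS, rfl, .inr ⟨rfl, rfl⟩,
      .inr ⟨[], post, t, τ, hms, hτ, rfl, rfl, rfl, hIK⟩⟩
  | newSend ro post t τ SS IK hms hτ hf =>
    exact ⟨ro, _, [], _, SS, rfl, .inr ⟨rfl, rfl⟩, .inl ⟨rfl, .inl ⟨_, rfl⟩⟩⟩
  | recv ro i pre post t τ SS IK hms hne hτ =>
    exact ⟨ro, i, _, _, SS, rfl, .inl ⟨by simpa using hne, rfl⟩,
      .inl ⟨rfl, .inr (.inl ⟨_, Multiset.mem_cons_self _ _, rfl⟩)⟩⟩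
  | newRecv ro post t τ SS IK hms hτ =>
    exact ⟨ro, _, [], _, SS, rfl, .inr ⟨rfl, rfl⟩,
      .inl ⟨rfl, .inr (.inl ⟨_, Multiset.mem_cons_self _ _, rfl⟩)⟩⟩
  | cond ro i pre post c num τ SS IK hms hne hτ hc =>
    exact ⟨ro, i, _, _, SS, rfl, .inl ⟨by simpa using hne, rfl⟩,
      .inl ⟨rfl, .inr (.inr (.inr ⟨_, _, rfl, hc⟩))⟩⟩
  | choice ro i pre post num τ SS IK hms hne hτ =>
    exact ⟨ro, i, _, _, SS, rfl, .inl ⟨by simpa using hne, rfl⟩,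
      .inl ⟨rfl, .inr (.inr (.inl ⟨_, rfl⟩))⟩⟩
  | newChoice ro post num SS IK hms =>
    exact ⟨ro, _, [], _, SS, rfl, .inr ⟨rfl, rfl⟩, .inl ⟨rfl, .inr (.inr (.inl ⟨_, rfl⟩))⟩⟩

/-- A forwards step that leads to an instance of a symbolic state is undone by at most one
backwards narrowing step. -/
theorem lifts_or_canStep (hcsu : IsUnificationProcedure P csu) (hS : IsSymbolicState P S)
    (hW : W.Finite) (hSW : S.vars ⊆ W) {s : GState P} (hqs : FRule q s) (hl : Lifts S θ s) :
    Lifts S θ q ∨ CanStep csu W S q := by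
  obtain ⟨ro, i, pre, m, D, hs, hq, hik⟩ := hqs.effect
  rw [lifts_iff] at hl
  obtain ⟨hθ, hst, hk, hY⟩ := hl
  rw [hs] at hst
  have hmono : StrandsLift S.strands θ D → StrandsLift S.strands θ q.strands := by
    rintro ⟨T, hT, hr⟩
    refine ⟨T, hT.trans ?_, hr⟩
    rcases hq with ⟨-, e⟩ | ⟨-, e⟩ <;> rw [e]
    exact Multiset.le_cons_self _ _
  have hlift : ∀ {M : StrandSet P.sig} {K : Know P.sig} {s : GState P},
      StrandsLift M θ s.strands → KnowLift K θ s.ik → Lifts ⟨M, K, S.store⟩ θ s :=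
    fun h h' => lifts_iff.2 ⟨hθ, h, h', hY⟩
  have hback := hst.backwards hq
  rcases hik with ⟨hik, hm⟩ | ⟨pre', post, t, τ, hms, hτ, rfl, rfl, hik, hnew⟩
  · rw [hik] at hk
    rcases hback with h | ⟨A, Rest, p, u₀, hAS, hA, hmu, h⟩
    · exact .inl (hlift (hmono h) hk)
    · refine .inr ?_
      have hl' := hlift (s := q) h hk
      rcases hm with ⟨t, rfl⟩ | ⟨t, ht, rfl⟩ | ⟨n, rfl⟩ | ⟨c, n, rfl, hc⟩
      · rcases u₀ with t₀ | t₀ | ⟨c₀, n₀⟩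
        · exact canStep_silent hcsu hS hW hSW (.inl ⟨_, rfl⟩) hAS hA hl'
        · cases hmu
        · cases hmu
      · rcases u₀ with t₀ | t₀ | ⟨c₀, n₀⟩
        · cases hmu
        · cases hmu with
          | recv hmu => exact canStep_recv hcsu hS hW hSW ⟨t, ht, hmu⟩ hAS hA hl'
        · cases hmu
      · rcases u₀ with t₀ | t₀ | ⟨_ | ⟨a, b⟩ | ⟨a, b⟩, n₀⟩
        · cases hmu
        · cases hmu
        · exact canStep_silent hcsu hS hW hSW (.inr (.inl ⟨_, rfl⟩)) hAS hA hl'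
        · cases hmu
        · cases hmu
      -- Truth of constraints is invariant under `=_E`, so it passes from the executed constraint to
      -- the symbolic one under `θ`.
      · refine canStep_silent hcsu hS hW hSW (.inr (.inr ?_)) hAS hA hl'
        rcases u₀ with t₀ | t₀ | ⟨_ | ⟨a, b⟩ | ⟨a, b⟩, n₀⟩
        · cases hmu
        · cases hmu
        · cases hmu
          exact hc.elim
        · cases hmu with
          | eq _ h1 h2 => exact ⟨_, _, rfl, (EqE.symm h1).trans (EqE.trans hc h2)⟩
        · cases hmu with
          | ne _ h1 h2 => exact ⟨_, _, rfl, fun e => hc ((h1.trans e).trans h2.symm)⟩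
  · rw [hik] at hk
    have hneg : ∀ t', .inl (.neg t') ∈ S.ik → ¬ ∃ m ∈ q.ik, EqE P.eqns m (t'.subst θ) :=
      fun t' ht' ⟨m, hm, he⟩ => hk.2 t' ht' ⟨m, Multiset.mem_cons_of_mem hm, he⟩
    have hpos : ∀ t', .inl (.pos t') ∈ S.ik → ¬ EqE P.eqns (t.subst τ) (t'.subst θ) →
        ∃ m ∈ q.ik, EqE P.eqns m (t'.subst θ) := by
      intro t' ht' hne
      obtain ⟨m, hm, he⟩ := hk.1 t' ht'
      rcases Multiset.mem_cons.1 hm with rfl | hm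
      · exact absurd he hne
      · exact ⟨m, hm, he⟩
    -- If `S` does not mention the learnt message, learning is invisible and the step is treated
    -- like a plain send.
    by_cases hex : ∃ t', .inl (.pos t') ∈ S.ik ∧ EqE P.eqns (t.subst τ) (t'.subst θ)
    · obtain ⟨t', ht', he⟩ := hex
      classical
      -- All facts equal to the learnt message are removed at once, since none of them holds in `q`;
      -- the single fact of the rule matches them all.
      let K : Know P.sig :=
        S.ik.filter fun f => ∀ t', f = .inl (.pos t') → ¬ EqE P.eqns (t.subst τ) (t'.subst θ)
      have hK : K ⊆ S.ik := Multiset.filter_subset _ _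
      have hKn : ∀ n, .inr n ∈ S.ik → .inr n ∈ K := fun n hn =>
        Multiset.mem_filter.2 ⟨hn, fun _ e => by cases e⟩
      have hKl : KnowLift K θ q.ik := by
        refine ⟨fun t₁ ht₁ => ?_, fun t₁ ht₁ => hneg t₁ (hK ht₁)⟩
        obtain ⟨h1, h2⟩ := Multiset.mem_filter.1 ht₁
        exact hpos t₁ h1 (h2 t₁ rfl)
      have hKF : ∀ f', .inl f' ∈ S.ik → .inl f' ∈ K ∨
          Fact.EqE P.eqns (f'.subst θ) (.pos (t.subst τ)) := by
        intro f' hf'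
        rcases f' with t₁ | t₁
        · by_cases h : EqE P.eqns (t.subst τ) (t₁.subst θ)
          · exact .inr (.pos h.symm)
          · refine .inl (Multiset.mem_filter.2 ⟨hf', ?_⟩)
            rintro _ e
            obtain rfl := Fact.pos.inj (Sum.inl.inj e)
            exact h
        · refine .inl (Multiset.mem_filter.2 ⟨hf', fun _ e => ?_⟩)
          cases e
      refine .inr ?_
      rcases hback with h | ⟨A, Rest, p, u₀, hAS, hA, hmu, h⟩
      · exact canStep_newStrand hcsu hS hW hSW hms hτ hK hKn ht' he.symm hKF hnew
          (hlift (s := ⟨D, q.ik⟩) h hKl) (by simpa using hq)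
      · rcases u₀ with t₀ | t₀ | ⟨c₀, n₀⟩
        · cases hmu with
          | send hmu =>
            refine canStep_sendLearn hcsu hS hW hSW hK hKn ht' (he.symm.trans hmu)
              (fun f' hf' => ?_)
              (fun m hm e => hnew m hm (e.trans hmu.symm)) hAS hA (hlift (s := q) h hKl)
            exact (hKF f' hf').imp id fun h => h.trans (.pos hmu)
        · cases hmu
        · cases hmu
    · have hkq : KnowLift S.ik θ q.ik :=
        ⟨fun t' ht' => hpos t' ht' fun he => hex ⟨t', ht', he⟩, hneg⟩
      rcases hback with h | ⟨A, Rest, p, u₀, hAS, hA, hmu, h⟩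
      · exact .inl (hlift (hmono h) hkq)
      · rcases u₀ with t₀ | t₀ | ⟨c₀, n₀⟩
        · exact .inr (canStep_silent hcsu hS hW hSW (.inl ⟨_, rfl⟩) hAS hA (hlift (s := q) h hkq))
        · cases hmu
        · cases hmu

/-- A begun strand would need a nonempty ground counterpart, and a positive fact a known message; an
initial ground state has neither. -/
theorem Lifts.isInitial {s : GState P} (hl : Lifts S θ s)
    (hs : s.IsInitial) : S.IsInitial := by
  rw [lifts_iff] at hl
  obtain ⟨-, ⟨T, hT, hr⟩, hk, -⟩ := hl
  refine ⟨fun A hA => ?_, fun t ht => ?_⟩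
  · by_contra hne
    obtain ⟨g, hg, hAg⟩ := Multiset.exists_mem_of_rel_of_mem hr (StrandSet.mem_begun.2 ⟨hA, hne⟩)
    rw [StrandLift, hs.1 g (Multiset.mem_of_le hT hg)] at hAg
    exact hne (List.forall₂_nil_right_iff.1 hAg)
  · obtain ⟨m, hm, -⟩ := hk.1 t ht
    rw [hs.2] at hm
    simp at hm

/-- Induction on `n`, peeling off the last forwards step. The symbolic state, the assignment and `W`
all change along the way and are generalized. -/
theorem exists_narrows (hcsu : IsUnificationProcedure P csu) {s₀ : GState P}
    (hinit : s₀.IsInitial) (n : ℕ) {s : GState P} (hsteps : FSteps n s₀ s)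
    (hS : IsSymbolicState P S) (hl : Lifts S θ s) (hW : W.Finite) (hSW : S.vars ⊆ W) :
    ∃ (S₀ : CState P.sig) (μ : Subst P.sig) (θ' : P.sig.Var → Term P.sig) (k : ℕ),
      k ≤ n ∧ IsSymbolicState P S₀ ∧ S₀.IsInitial ∧ Narrows csu W k S μ S₀ ∧ Lifts S₀ θ' s₀ := by
  induction n generalizing s S θ W with
  | zero =>
    have hl₀ := hl.of_gstate_eqE hsteps
    exact ⟨S, Subst.id, θ, 0, le_rfl, hS, hl₀.isInitial hinit, .zero W S, hl₀⟩
  | succ n ih =>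
    obtain ⟨q, hq, q₁, s₁, hqq, hF, hss⟩ := hsteps
    rcases lifts_or_canStep hcsu hS hW hSW hF (hl.of_gstate_eqE hss) with h | h
    -- `S` already lifts the earlier state, so this forwards step costs no narrowing step.
    · obtain ⟨S₀, μ, θ', k, hk, h⟩ := ih hq hS (h.of_gstate_eqE hqq) hW hSW
      exact ⟨S₀, μ, θ', k, hk.trans n.le_succ, h⟩
    · obtain ⟨S₁, μ, θ₁, hstep, hS₁, hl₁⟩ := h
      -- The next set of variables to avoid adds those of `S₁`, which may lie outside `W`, and
      -- retains `W`.
      obtain ⟨S₀, ν, θ', k, hk, h₀, hi, hN, hl₀⟩ := ih hq hS₁ (hl₁.of_gstate_eqE hqq)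
        (hW.union S₁.vars_finite) Set.subset_union_right
      exact ⟨S₀, μ.comp ν, θ', k + 1, Nat.succ_le_succ hk, h₀, hi,
        .succ hstep Set.subset_union_left hN, hl₀⟩

end Completeness

end CStrand

theorem mainTheorem2 (P : CStrand.Protocol.{u, v, w, z})
    (csu : CStrand.CState P.sig → CStrand.CState P.sig → Set (CStrand.AVar P.sig) →
      Set (CStrand.Subst P.sig))
    (hcsu : CStrand.IsUnificationProcedure P csu)
    (s s₀ : CStrand.GState P) (hs : s.IsGroundStrandState) (hs₀ : s₀.IsGroundStrandState)
    (S : CStrand.CState P.sig) (hS : CStrand.IsSymbolicState P S)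
    (θ : P.sig.Var → CStrand.Term P.sig) (n : ℕ)
    (hinit : s₀.IsInitial) (hsteps : CStrand.FSteps n s₀ s) (hlift : CStrand.Lifts S θ s)
    (W : Set (CStrand.AVar P.sig)) (hW : W.Finite) (hSW : S.vars ⊆ W) :
    ∃ (S₀ : CStrand.CState P.sig) (μ : CStrand.Subst P.sig)
      (θ' : P.sig.Var → CStrand.Term P.sig) (k : ℕ),
      k ≤ n ∧ CStrand.IsSymbolicState P S₀ ∧ S₀.IsInitial ∧
      CStrand.Narrows csu W k S μ S₀ ∧ CStrand.Lifts S₀ θ' s₀ := by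
  exact CStrand.exists_narrows hcsu hinit n hsteps hS hlift hW hSW
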